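/- Let $F$ be a field. An \emph{$F$-algebra with involution} $(A,\sigma)$ is a finite-dimensional $F$-algebra $A$ with an $F$-linear anti-automorphism $\sigma$ such that $\sigma\circ\sigma=\mathrm{id}_A$, $F=Z(A)\cap \mathrm{Sym}(\sigma)$, and $A$ has no non-trivial two-sided ideal $I$ with $\sigma(I)=I$. Here $\mathrm{Sym}(\sigma)=\{x\in A: \sigma(x)=x\}$; put also $\mathrm{Skew}(\sigma)=\{x\in A:\sigma(x)=-x\}$ and $\mathrm{Symd}(\sigma)=\{x+\sigma(x): x\in A\}$. Then $[Z(A):F]\in\{1,2\}$. The involution is \emph{unitary} if $[Z(A):F]=2$; if $Z(A)=F$, it is \emph{symplectic} if $\dim_F\mathrm{Symd}(\sigma)<\dim_F\mathrm{Skew}(\sigma)$ and $1\in\mathrm{Symd}(\sigma)$, and \emph{orthogonal} otherwise; this is the \emph{type} of $\sigma$. If $Z(A)$ is a field, $\deg A$ is the degree of the central simple $Z(A)$-algebra $A$, and $(A,\sigma)$ is \emph{split} if $A\cong M_n(Z(A))$ for some $n$; otherwise $Z(A)\cong F\times F$, $A\cong A_0\times A_0^{\mathrm{op}}$ for a central simple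 $F$-algebra $A_0$, $\deg A=\deg A_0$, and $(A,\sigma)$ is split if $A_0\cong M_n(F)$ for some $n$. The \emph{capacity} $\kappa(A,\sigma)$ is $\deg A$ if $\sigma$ is orthogonal or unitary, and $\frac12\deg A$ if $\sigma$ is symplectic. An $F$-algebra is \emph{étale} if it is isomorphic to a finite product of finite separable field extensions of $F$, and an étale $F$-algebra is \emph{split} if it is isomorphic to $F^n$ for some $n$. An $F$-subalgebra $L$ of $A$ is \emph{neat in $(A,\sigma)$} if $L$ is étale, $L\subseteq\mathrm{Sym}(\sigma)$, $A$ is free as a left $L$-module, and for each nonzero idempotent $e\in L$ the restriction of $\sigma$ to $eAe$ has the same type as $\sigma$. \textbf{Theorem.} Let $(A,\sigma)$ be an $F$-algebra with involution and let $K$ be a commutative $F$-subalgebra of $A$. (1) $K$ is neat in $(A,\sigma)$ if and only if $K\subseteq L\subseteq \mathrm{Sym}(\sigma)$ for some étale $F$-subalgebra $L$ of $A$ with $[L:F]=\kappa(A,\sigma)$ such that $L$ is free as a $K$-module. (2) If $K$ is neat in $(A,\sigma)$ and both $K$ and $(A,\sigma)$ are split, then $L$ in (1) can be chosen split. (3)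 If $K$ is neat in $(A,\sigma)$, then $[K:F]$ divides $\kappa(A,\sigma)$. -/

import Mathlib

universe u v

/-- An `F`-algebra is étale if it is isomorphic to a finite product of finite separable field
extensions of `F`. -/
def IsEtaleAlgebra (F : Type u) (B : Type v) [Field F] [Ring B] [Algebra F B] : Prop :=
  ∃ (n : ℕ) (E : Fin n → Type v) (_ : ∀ i, Field (E i)) (_ : ∀ i, Algebra F (E i)),
    (∀ i, FiniteDimensional F (E i) ∧ Algebra.IsSeparable F (E i)) ∧
      Nonempty (B ≃ₐ[F] (∀ i, E i))

/-- For commutative rings this is the notion of étale algebra in Mathlib. -/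
theorem isEtaleAlgebra_iff_etale (F : Type u) (B : Type v) [Field F] [CommRing B] [Algebra F B] :
    IsEtaleAlgebra F B ↔ Algebra.Etale F B := by
  rw [Algebra.Etale.iff_exists_algEquiv_prod]
  constructor
  · rintro ⟨n, E, hF, hA, h, ⟨e⟩⟩
    refine ⟨ULift (Fin n), inferInstance, fun i => E i.down, fun i => hF i.down,
      fun i => hA i.down, e.trans ?_, fun i => h i.down⟩
    exact (AlgEquiv.piCongrLeft F E Equiv.ulift).symm
  · rintro ⟨I, hI, E, hF, hA, e, h⟩
    obtain ⟨n, ⟨s⟩⟩ := Finite.exists_equiv_fin I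
    exact ⟨n, fun i => E (s.symm i), fun i => hF _, fun i => hA _, fun i => h _,
      ⟨e.trans (AlgEquiv.piCongrLeft F E s.symm).symm⟩⟩

/-- An `F`-algebra is split étale if it is isomorphic to `Fⁿ` for some `n`. -/
def IsSplitEtaleAlgebra (F : Type u) (B : Type v) [Field F] [Ring B] [Algebra F B] : Prop :=
  ∃ n : ℕ, Nonempty (B ≃ₐ[F] (Fin n → F))

/-- For `F`-subalgebras `K ⊆ L` of `A`: the ring `L` is free as a left `K`-module. -/
def Subalgebra.IsFreeOver {F : Type u} {A : Type v} [Field F] [Ring A] [Algebra F A]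
    (K L : Subalgebra F A) (h : K ≤ L) : Prop :=
  letI : Module K L := Module.compHom L (Subalgebra.inclusion h).toRingHom
  Module.Free K L

/-- The `F`-algebra structure on the ring `eAe` (whose unity is `e`), in which `c` in `F`
corresponds to `c e`. -/
noncomputable instance IsIdempotentElem.Corner.instAlgebra {F : Type u} {A : Type v} [Field F]
    [Ring A] [Algebra F A] {e : A} (he : IsIdempotentElem e) : Algebra F he.Corner where
  smul c x := ⟨c • x.1, by
    obtain ⟨y, hy⟩ := x.2
    exact ⟨c • y, by simp only [mul_smul_comm, smul_mul_assoc]; rw [← hy]⟩⟩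
  algebraMap :=
    { toFun := fun c => ⟨c • e, ⟨c • e, by
        simp only [mul_smul_comm, smul_mul_assoc, he.eq]⟩⟩
      map_one' := Subtype.ext (one_smul F e)
      map_mul' := fun c d => Subtype.ext (by
        change (c * d) • e = (c • e) * (d • e)
        rw [smul_mul_smul_comm, he.eq])
      map_zero' := Subtype.ext (zero_smul F e)
      map_add' := fun c d => Subtype.ext (add_smul c d e) }
  commutes' c x := Subtype.ext (by
    change (c • e) * x.1 = x.1 * (c • e)
    have hx := (Subsemigroup.mem_corner_iff he).mp x.2
    rw [smul_mul_assoc, mul_smul_comm, hx.1, hx.2])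
  smul_def' c x := Subtype.ext (by
    change c • x.1 = (c • e) * x.1
    have hx := (Subsemigroup.mem_corner_iff he).mp x.2
    rw [smul_mul_assoc, hx.1])

/-- An `F`-involution on `A`: an `F`-linear anti-automorphism `σ` of the ring `A` with
`σ ∘ σ = id`. -/
structure FInvolution (F : Type u) (A : Type v) [Field F] [Ring A] [Algebra F A] where
  toLinearMap : A →ₗ[F] A
  map_mul' : ∀ x y, toLinearMap (x * y) = toLinearMap y * toLinearMap x
  involutive' : ∀ x, toLinearMap (toLinearMap x) = x

/-- The three types of involutions. -/
inductive InvolutionType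
  | orthogonal
  | symplectic
  | unitary

namespace FInvolution

variable {F : Type u} {A : Type v} [Field F] [Ring A] [Algebra F A]

instance : CoeFun (FInvolution F A) (fun _ => A → A) := ⟨fun σ => σ.toLinearMap⟩

/-- `Symm(σ) = {x | σ x = x}`. -/
def symm (σ : FInvolution F A) : Submodule F A :=
  LinearMap.eqLocus σ.toLinearMap LinearMap.id

/-- `Skew(σ) = {x | σ x = -x}`. -/
def skew (σ : FInvolution F A) : Submodule F A :=
  LinearMap.eqLocus σ.toLinearMap (-LinearMap.id)

/-- `Symd(σ) = {x + σ x | x ∈ A}`. -/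
def symd (σ : FInvolution F A) : Submodule F A :=
  LinearMap.range (LinearMap.id + σ.toLinearMap)

/-- `(A, σ)` is an `F`-algebra with involution: `A` is a finite-dimensional `F`-algebra,
`F = Z(A) ∩ Symm(σ)` (with `F` embedded in `A`, so `A ≠ 0`), and `A` has no non-trivial
two-sided ideal `I` with `σ(I) = I`. -/
structure IsAlgebraWithInvolution (σ : FInvolution F A) : Prop where
  nontrivial : Nontrivial A
  finiteDimensional : FiniteDimensional F A
  center_inf_symm : ∀ x : A,
    (x ∈ Subalgebra.center F A ∧ x ∈ σ.symm) ↔ x ∈ (⊥ : Subalgebra F A)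
  eq_bot_or_eq_top : ∀ I : TwoSidedIdeal A, σ '' (I : Set A) = (I : Set A) → I = ⊥ ∨ I = ⊤

open Classical in
/-- The type of an involution. The involution is of the first kind if `[Z(A) : F] = 1`, and then
it is symplectic if `dim Symd(σ) < dim Skew(σ)` and `1 ∈ Symd(σ)`, and orthogonal otherwise.
In the remaining case, `[Z(A) : F] = 2`, it is unitary. -/
noncomputable def type (σ : FInvolution F A) : InvolutionType :=
  if Module.finrank F (Subalgebra.center F A) = 1 then
    if Module.finrank F σ.symd < Module.finrank F σ.skew ∧ (1 : A) ∈ σ.symd then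
      InvolutionType.symplectic
    else InvolutionType.orthogonal
  else InvolutionType.unitary

open Classical in
/-- The degree `deg A` of an `F`-algebra with involution `(A, σ)`. If `Z(A)` is a field, this is
the degree of `A` as a central simple `Z(A)`-algebra, so `dim_{Z(A)} A = (deg A)²`. Otherwise
`Z(A) ≃ F × F` and `A ≃ A₀ × A₀ᵒᵖ` for a central simple `F`-algebra `A₀`, the degree is that of
the two simple components `A₀` and `A₀ᵒᵖ`, and each of these has dimension `(dim_F A) / 2`. -/
noncomputable def degree (_σ : FInvolution F A) : ℕ :=
  if IsField (Subring.center A) then Nat.sqrt (Module.finrank (Subring.center A) A)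
  else Nat.sqrt (Module.finrank F A / 2)

/-- `(A, σ)` is split: if `Z(A)` is a field, `A` is a matrix algebra over `Z(A)`; otherwise, where
`Z(A) ≃ F × F`, the two simple components of `A` are matrix algebras over `F`. -/
def IsSplit (_σ : FInvolution F A) : Prop :=
  (IsField (Subring.center A) ∧
    ∃ n : ℕ, Nonempty (A ≃ₐ[Subring.center A] Matrix (Fin n) (Fin n) (Subring.center A))) ∨
  (¬ IsField (Subring.center A) ∧
    ∃ n : ℕ, Nonempty (A ≃ₐ[F] Matrix (Fin n) (Fin n) F × Matrix (Fin n) (Fin n) F))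

/-- The capacity of `(A, σ)`: half the degree if `σ` is symplectic, and the degree otherwise. -/
noncomputable def capacity (σ : FInvolution F A) : ℕ :=
  match σ.type with
  | InvolutionType.symplectic => σ.degree / 2
  | InvolutionType.orthogonal => σ.degree
  | InvolutionType.unitary => σ.degree

theorem apply_mem_corner (σ : FInvolution F A) {e : A} (he : IsIdempotentElem e)
    (hσ : e ∈ σ.symm) {x : A} (hx : x ∈ Subsemigroup.corner e) : σ x ∈ Subsemigroup.corner e := by
  have h := (Subsemigroup.mem_corner_iff he).mp hx
  have hs : σ e = e := hσ
  have h1 := σ.map_mul' x e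
  have h2 := σ.map_mul' e x
  rw [hs, h.2] at h1
  rw [hs, h.1] at h2
  exact (Subsemigroup.mem_corner_iff he).mpr ⟨h1.symm, h2.symm⟩

/-- The restriction of `σ` to `eAe` for an idempotent `e` with `σ e = e`. -/
noncomputable def restrictCorner (σ : FInvolution F A) {e : A} (he : IsIdempotentElem e)
    (hσ : e ∈ σ.symm) : FInvolution F he.Corner where
  toLinearMap :=
    { toFun := fun x => ⟨σ x.1, σ.apply_mem_corner he hσ x.2⟩
      map_add' := fun x y => Subtype.ext (σ.toLinearMap.map_add x.1 y.1)
      map_smul' := fun c x => Subtype.ext (σ.toLinearMap.map_smul c x.1) }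
  map_mul' x y := Subtype.ext (σ.map_mul' x.1 y.1)
  involutive' x := Subtype.ext (σ.involutive' x.1)

/-- An `F`-subalgebra `L` of `A` is neat in `(A, σ)` if it is étale and contained in `Symm(σ)`,
`A` is free as a left `L`-module, and for each nonzero idempotent `e` of `L` the restriction of
`σ` to `eAe` has the same type as `σ`. -/
structure IsNeat (σ : FInvolution F A) (L : Subalgebra F A) : Prop where
  etale : IsEtaleAlgebra F L
  le_symm : Subalgebra.toSubmodule L ≤ σ.symm
  free : Module.Free L A
  type_eq : ∀ (e : A) (he : IsIdempotentElem e) (heL : e ∈ L), e ≠ 0 →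
    (σ.restrictCorner he (le_symm heL)).type = σ.type

end FInvolution

/-!
Everything is read off from a form. If `A` is split, then `A = End_Z(V)` for its center `Z` and a
left ideal `V = A e`, and the involution is adjoint to an `ε`-hermitian form `h` on `V`; such a
presentation is a `Frame`. An étale subalgebra `K` of symmetric elements has a symmetric
separability idempotent (`SymSep`), and this writes `h` as the trace of a hermitian form `H` over
`K Z`. For a primitive idempotent `f` of `K`, the field `K f` acts on `f V`, and `H` can be
diagonalized there, or decomposed into hyperbolic planes if it is alternating. So `f` is a sum of
orthogonal symmetric idempotents commuting with `K`, called atoms, with images of rank one, or two,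
over `K f ⊗ Z` (`exists_atoms`, `exists_atoms_of_alternating`). For involutions
of the first kind, the form is alternating on `f V` exactly when `ε = -1` and `f` is a symmetrized
element. This is how the type of the corner `f A f` enters, uniformly in all characteristics.

If `K` is neat, then all corners have the same type, so the ranks of all atoms of `f` are the same
multiple of `[K f : F]` for every `f`; and since `A` is free over `K`, every `f` has the same number
`m` of atoms. Choosing one atom for each `f` and adding them up gives `m` orthogonal symmetric
idempotents `P t` with sum one, commuting with `K`, on each of which `K` acts faithfully, where
`m [K : F]` is the capacity (`Frame.exists_idempotents`). In the split case `L = ∑ K (P t)` is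
isomorphic to `K ^ m` and has all the required properties (`exists_subalgebra_of_idempotents`).
Neatness survives the extension of scalars to an algebraic closure (`IsNeat.baseChange`), so the
divisibility holds in general.

It remains to find `L` if `A` need not be split. Over a finite field it is, by Wedderburn's theorem.
Over an infinite field, the combination `∑ c t • P t` with distinct `c t`, formed over an algebraic
closure, is generic: for a basis `b` of `K` the elements `b j * x ^ i` with `i < m` are linearly
independent, and so are the values of `b j * X ^ i` with `i < 2 m` together with those of the
derivative (`IsGeneric`). These are Zariski open conditions, so some symmetric element `x` of `A`
commuting with `K` satisfies them (`exists_isGeneric`); in the symplectic case it is also a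
symmetrized element. Let `L = K[x]`. The first condition says that `[L : F]` is at least the
capacity. It is at most the capacity (`finrank_le_capacity`): over an algebraic closure, a cyclic
vector of `f V` embeds the polynomials in `x` into `f V`, with an isotropic image if the form is
alternating, and for involutions of the second kind `f V` is the sum of two subspaces, each of which
the polynomials embed into. By a count of dimensions, the pairs in the second condition then span
`L × L`. So there is a polynomial over `K` which vanishes at `x` and has derivative one there;
hence `L` is unramified over `K`, and therefore étale over `F` (`IsGeneric.etale_extend`).

Conversely, let `L` be an étale algebra of symmetric elements whose dimension is the capacity. Over
an algebraic closure, the number of its primitive idempotents is the largest that the lower bound on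
their ranks allows, so their ranks are equal. Therefore `A` is free over `L`, all corners have
the same type, and both properties pass to subalgebras `K` over which `L` is free
(`isNeat_of_le`).
-/

universe w

/-! ### Symmetric elements and the center -/

namespace FInvolution

variable {F : Type u} {A : Type v} [Field F] [Ring A] [Algebra F A]

@[simp] theorem apply_mul (σ : FInvolution F A) (x y : A) : σ (x * y) = σ y * σ x := σ.map_mul' x y

@[simp] theorem apply_apply (σ : FInvolution F A) (x : A) : σ (σ x) = x := σ.involutive' x

@[simp] theorem apply_one (σ : FInvolution F A) : σ (1 : A) = 1 := by
  have h := σ.apply_mul (σ 1) 1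
  rw [mul_one, apply_apply, mul_one] at h
  exact h.symm

@[simp] theorem apply_algebraMap (σ : FInvolution F A) (c : F) :
    σ (algebraMap F A c) = algebraMap F A c := by
  simp [Algebra.algebraMap_eq_smul_one]

theorem apply_injective (σ : FInvolution F A) : Function.Injective σ :=
  Function.LeftInverse.injective (g := σ) σ.apply_apply

theorem mem_skew {σ : FInvolution F A} {x : A} : x ∈ σ.skew ↔ σ x = -x := Iff.rfl

theorem mem_symd {σ : FInvolution F A} {x : A} : x ∈ σ.symd ↔ ∃ a, a + σ a = x := Iff.rfl

variable {σ : FInvolution F A}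

/-- A symmetric or skew nonzero element of an algebra with involution generates it as a two-sided
ideal. -/
theorem IsAlgebraWithInvolution.exists_sum_eq_one (hσ : σ.IsAlgebraWithInvolution) {x : A}
    (hx : x ≠ 0) (hs : σ x = x ∨ σ x = -x) :
    ∃ (N : ℕ) (a b : Fin N → A), ∑ i, a i * x * b i = 1 := by
  -- the two-sided ideal generated by `x` is stable under the involution, hence contains `1`
  let I : TwoSidedIdeal A := TwoSidedIdeal.mk'
    {z | ∃ l : List (A × A), (l.map fun p => p.1 * x * p.2).sum = z}
    ⟨[], by simp⟩
    (by
      rintro _ _ ⟨l, rfl⟩ ⟨m, rfl⟩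
      exact ⟨l ++ m, by simp⟩)
    (by
      rintro _ ⟨l, rfl⟩
      refine ⟨l.map fun p => (-p.1, p.2), ?_⟩
      rw [List.map_map]
      induction l with
      | nil => simp
      | cons p l ih => simp [ih]; abel)
    (by
      rintro y _ ⟨l, rfl⟩
      refine ⟨l.map fun p => (y * p.1, p.2), ?_⟩
      rw [List.map_map, ← List.sum_map_mul_left]
      simp [Function.comp_def, mul_assoc])
    (by
      rintro _ y ⟨l, rfl⟩
      refine ⟨l.map fun p => (p.1, p.2 * y), ?_⟩
      rw [List.map_map, ← List.sum_map_mul_right]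
      simp [Function.comp_def, mul_assoc])
  have hI : ∀ z, z ∈ I ↔ ∃ l : List (A × A), (l.map fun p => p.1 * x * p.2).sum = z := fun z => by
    simp only [I, TwoSidedIdeal.mem_mk', Set.mem_ofPred_eq]
  have hxI : x ∈ I := (hI x).2 ⟨[(1, 1)], by simp⟩
  have hstab : ∀ z ∈ I, σ z ∈ I := by
    intro z hz
    obtain ⟨l, rfl⟩ := (hI z).1 hz
    clear hz
    induction l with
    | nil => simp [I.zero_mem]
    | cons p l ih =>
      simp only [List.map_cons, List.sum_cons, map_add, apply_mul]
      refine I.add_mem (I.mul_mem_left _ _ (I.mul_mem_right _ _ ?_)) ih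
      rcases hs with hs | hs <;> rw [hs]
      exacts [hxI, I.neg_mem hxI]
  have himg : σ '' (I : Set A) = (I : Set A) := by
    ext z
    constructor
    · rintro ⟨w, hw, rfl⟩
      exact hstab w hw
    · intro hz
      exact ⟨σ z, hstab z hz, by simp⟩
  rcases hσ.eq_bot_or_eq_top I himg with h | h
  · rw [h, TwoSidedIdeal.mem_bot] at hxI
    exact (hx hxI).elim
  · obtain ⟨l, hl⟩ := (hI 1).1 (h ▸ TwoSidedIdeal.mem_top A)
    refine ⟨l.length, fun i => (l.get i).1, fun i => (l.get i).2, ?_⟩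
    rw [← hl, ← List.sum_ofFn]
    congr 1
    conv_rhs => rw [← List.ofFn_get l, List.map_ofFn]
    rfl

/-- Central symmetric elements are scalars. -/
theorem IsAlgebraWithInvolution.exists_eq_smul_one (hσ : σ.IsAlgebraWithInvolution) {x : A}
    (hc : ∀ a, a * x = x * a) (hs : σ x = x) : ∃ c : F, x = c • 1 := by
  obtain ⟨c, hc⟩ := Algebra.mem_bot.1
    ((hσ.center_inf_symm x).1 ⟨Subalgebra.mem_center_iff.2 hc, hs⟩)
  exact ⟨c, by rw [← hc, Algebra.algebraMap_eq_smul_one]⟩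

/-- A central skew element of square zero vanishes. -/
theorem IsAlgebraWithInvolution.eq_zero_of_sq (hσ : σ.IsAlgebraWithInvolution) {x : A}
    (hc : ∀ a, a * x = x * a) (hs : σ x = x ∨ σ x = -x) (h : x * x = 0) : x = 0 := by
  by_contra hx
  obtain ⟨N, a, b, hab⟩ := hσ.exists_sum_eq_one hx hs
  apply hx
  rw [← mul_one x, ← hab, Finset.mul_sum]
  refine Finset.sum_eq_zero fun i _ => ?_
  rw [← mul_assoc, ← mul_assoc, ← hc, mul_assoc (a i), h, mul_zero, zero_mul]

/-- The center of the algebra consists of scalars; for algebras with involution, this says that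
the involution is of the first kind. -/
def IsFirstKind (F : Type u) (A : Type v) [Field F] [Ring A] [Algebra F A] : Prop :=
  ∀ x : A, (∀ a, a * x = x * a) → ∃ c : F, x = c • 1

theorem commutes_apply {x : A} (hc : ∀ a, a * x = x * a) (a : A) : a * σ x = σ x * a := by
  have := congrArg σ (hc (σ a))
  simpa using this.symm

/-- For an involution of the second kind, the center is `F ⊕ F y`, where `y - σ y` is invertible. -/
theorem IsAlgebraWithInvolution.exists_center_generator (hσ : σ.IsAlgebraWithInvolution)
    (h2 : ¬ IsFirstKind F A) :
    ∃ y : A, (∀ a, a * y = y * a) ∧ (∃ c : F, c ≠ 0 ∧ (y - σ y) * (y - σ y) = c • 1) ∧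
      ∀ z : A, (∀ a, a * z = z * a) → ∃ α β : F, z = α • 1 + β • y := by
  have := hσ.nontrivial
  obtain ⟨y, hy, hys⟩ : ∃ y : A, (∀ a, a * y = y * a) ∧ σ y ≠ y := by
    by_contra hcon
    push Not at hcon
    exact h2 fun x hx => hσ.exists_eq_smul_one hx (hcon x hx)
  -- `d = y - σ y` is central and skew, so its square is a scalar, which is not zero
  obtain ⟨d, hd⟩ : ∃ d, d = y - σ y := ⟨_, rfl⟩
  have hdc : ∀ a, a * d = d * a := fun a => by rw [hd, mul_sub, sub_mul, hy, commutes_apply hy]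
  have hds : σ d = -d := by simp [hd]
  have hd0 : d ≠ 0 := fun h => hys (sub_eq_zero.1 (hd ▸ h)).symm
  obtain ⟨c, hc⟩ := hσ.exists_eq_smul_one (x := d * d)
    (fun a => by rw [← mul_assoc, hdc, mul_assoc, hdc]) (by simp [hds])
  have hc0 : c ≠ 0 := by
    rintro rfl
    exact hd0 (hσ.eq_zero_of_sq hdc (Or.inr hds) (by rw [hc, zero_smul]))
  refine ⟨y, hy, ⟨c, hc0, hd ▸ hc⟩, fun z hz => ?_⟩
  have hzc : ∀ a, a * (z - σ z) = (z - σ z) * a := fun a => by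
    rw [mul_sub, sub_mul, hz, commutes_apply hz]
  -- `(z - σ z) d` is a symmetric central element; this gives the coefficient of `y`
  obtain ⟨β, hβ⟩ := hσ.exists_eq_smul_one (x := (z - σ z) * d)
    (fun a => by rw [← mul_assoc, hzc, mul_assoc, hdc, mul_assoc])
    (by rw [apply_mul, hds, map_sub, apply_apply, neg_mul, ← mul_neg, neg_sub, hzc])
  have hβ' : z - σ z = (β * c⁻¹) • d := by
    have h1 : (z - σ z) * d * d = β • d := by rw [hβ, smul_one_mul]
    rw [mul_assoc, hc, mul_smul_comm, mul_one] at h1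
    rw [mul_comm, mul_smul, ← h1, smul_smul, inv_mul_cancel₀ hc0, one_smul]
  obtain ⟨α, hα⟩ := hσ.exists_eq_smul_one (x := z - (β * c⁻¹) • y)
    (fun a => by rw [mul_sub, sub_mul, hz, mul_smul_comm, hy, smul_mul_assoc])
    (by
      rw [hd, smul_sub] at hβ'
      rw [map_sub, map_smul, ← sub_eq_zero]
      rw [← sub_eq_zero] at hβ'
      rw [← neg_eq_zero, ← hβ']
      abel)
  exact ⟨α, β * c⁻¹, by rw [← hα]; abel⟩

/-- The center of an algebra with involution has dimension one or two. -/
theorem IsAlgebraWithInvolution.finrank_center (hσ : σ.IsAlgebraWithInvolution) :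
    (IsFirstKind F A ∧ Module.finrank F (Subalgebra.center F A) = 1) ∨
      (¬ IsFirstKind F A ∧ Module.finrank F (Subalgebra.center F A) = 2) := by
  have := hσ.nontrivial
  have := hσ.finiteDimensional
  by_cases h : IsFirstKind F A
  · refine Or.inl ⟨h, ?_⟩
    have : Subalgebra.center F A = ⊥ := by
      rw [eq_bot_iff]
      intro x hx
      obtain ⟨c, hc⟩ := h x (Subalgebra.mem_center_iff.1 hx)
      exact Algebra.mem_bot.2 ⟨c, by rw [hc, Algebra.algebraMap_eq_smul_one]⟩
    rw [this, Subalgebra.finrank_bot]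
  · refine Or.inr ⟨h, ?_⟩
    obtain ⟨y, hy, ⟨c, hc0, hc⟩, hz⟩ := hσ.exists_center_generator h
    have hli : LinearIndependent F ![(1 : A), y] := by
      rw [LinearIndependent.pair_iff]
      intro s t hst
      have h1 := congrArg σ hst
      rw [map_add, map_smul, map_smul, apply_one, map_zero] at h1
      have h2 : t • (y - σ y) = 0 := by
        rw [smul_sub, ← sub_zero (0 : A)]
        nth_rewrite 1 [← hst]
        rw [← h1]
        abel
      have ht : t = 0 := by
        have h3 : t • ((y - σ y) * (y - σ y)) = 0 := by rw [← smul_mul_assoc, h2, zero_mul]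
        rw [hc, smul_smul, smul_eq_zero] at h3
        rcases h3 with h3 | h3
        · exact (mul_eq_zero.1 h3).resolve_right hc0
        · exact (one_ne_zero h3).elim
      rw [ht, zero_smul, add_zero, smul_eq_zero] at hst
      exact ⟨hst.resolve_right one_ne_zero, ht⟩
    have hspan : Subalgebra.toSubmodule (Subalgebra.center F A) =
        Submodule.span F (Set.range ![(1 : A), y]) := by
      apply le_antisymm
      · intro z hzc
        have hzc' : z ∈ Subalgebra.center F A := hzc
        obtain ⟨α, β, rfl⟩ := hz z (Subalgebra.mem_center_iff.1 hzc')
        refine Submodule.add_mem _ (Submodule.smul_mem _ _ ?_) (Submodule.smul_mem _ _ ?_)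
        · exact Submodule.subset_span ⟨0, rfl⟩
        · exact Submodule.subset_span ⟨1, rfl⟩
      · rw [Submodule.span_le]
        rintro _ ⟨i, rfl⟩
        fin_cases i
        · exact (Subalgebra.center F A).one_mem
        · exact show y ∈ Subalgebra.center F A from Subalgebra.mem_center_iff.2 hy
    change Module.finrank F (Subalgebra.toSubmodule (Subalgebra.center F A)) = 2
    rw [hspan, finrank_span_eq_card hli]
    simp

/-- Nonzero symmetric idempotents of an algebra with involution cut out algebras with the same
center: `z ↦ z e` is an isomorphism of the centers. -/
theorem IsAlgebraWithInvolution.finrank_center_corner (hσ : σ.IsAlgebraWithInvolution) {e : A}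
    (he : IsIdempotentElem e) (hs : σ e = e) (h0 : e ≠ 0) :
    Module.finrank F (Subalgebra.center F he.Corner) =
      Module.finrank F (Subalgebra.center F A) := by
  obtain ⟨N, a, b, hab⟩ := hσ.exists_sum_eq_one h0 (Or.inl hs)
  -- `f` is the map `z ↦ z e`
  let f : Subalgebra.center F A →ₗ[F] Subalgebra.center F he.Corner :=
    { toFun := fun z => ⟨⟨z.1 * e, (Subsemigroup.mem_corner_iff he).2
          ⟨by rw [← mul_assoc, Subalgebra.mem_center_iff.1 z.2 e, mul_assoc, he.eq],
            by rw [mul_assoc, he.eq]⟩⟩,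
        Subalgebra.mem_center_iff.2 fun x => Subtype.ext (by
          have hx := (Subsemigroup.mem_corner_iff he).mp x.2
          change x.1 * (z.1 * e) = z.1 * e * x.1
          rw [mul_assoc, hx.1, ← mul_assoc, Subalgebra.mem_center_iff.1 z.2, mul_assoc, hx.2])⟩
      map_add' := fun x y => Subtype.ext (Subtype.ext (add_mul x.1 y.1 e))
      map_smul' := fun c x => Subtype.ext (Subtype.ext (smul_mul_assoc c x.1 e)) }
  have hf : Function.Bijective f := by
    constructor
    · rw [injective_iff_map_eq_zero]
      intro z hz
      have hze : z.1 * e = 0 := congrArg (fun x => x.1.1) hz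
      apply Subtype.ext
      rw [← mul_one z.1, ← hab, Finset.mul_sum]
      refine Finset.sum_eq_zero fun i _ => ?_
      rw [← mul_assoc, ← mul_assoc, ← Subalgebra.mem_center_iff.1 z.2, mul_assoc (a i), hze,
        mul_zero, zero_mul]
    · intro c
      have hc := (Subsemigroup.mem_corner_iff he).mp c.1.2
      have hcc : ∀ x : A, c.1.1 * (e * x * e) = e * x * e * c.1.1 := fun x => by
        have := Subalgebra.mem_center_iff.1 c.2 ⟨e * x * e, ⟨x, rfl⟩⟩
        exact (congrArg Subtype.val this).symm
      -- `∑ aᵢ e bᵢ = 1` forces the central element over `c` to be `∑ aᵢ c bᵢ`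
      obtain ⟨z, hz⟩ : ∃ z, z = ∑ i, a i * c.1.1 * b i := ⟨_, rfl⟩
      have key : ∀ y, z * (y * e) = y * c.1.1 := fun y => by
        calc z * (y * e) = ∑ i, a i * (c.1.1 * (e * (b i * y) * e)) := by
              rw [hz, Finset.sum_mul]
              refine Finset.sum_congr rfl fun i _ => ?_
              rw [← mul_assoc c.1.1, ← mul_assoc c.1.1, hc.2]
              simp only [mul_assoc]
          _ = (∑ i, a i * e * b i) * (y * (e * c.1.1)) := by
              rw [Finset.sum_mul]
              refine Finset.sum_congr rfl fun i _ => ?_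
              rw [hcc]
              simp only [mul_assoc]
          _ = y * c.1.1 := by rw [hab, hc.1, one_mul]
      have hzc : ∀ y, y * z = z * y := fun y => by
        calc y * z = ∑ i, y * z * (a i * e) * b i := by
              conv_lhs => rw [← mul_one (y * z), ← hab, Finset.mul_sum]
              simp only [mul_assoc]
          _ = ∑ i, z * (y * a i * e) * b i := by
              refine Finset.sum_congr rfl fun i _ => ?_
              rw [key (y * a i), mul_assoc y z, key (a i), mul_assoc y]
              simp only [mul_assoc]
          _ = z * y := by
              conv_rhs => rw [← mul_one (z * y), ← hab, Finset.mul_sum]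
              simp only [mul_assoc]
      refine ⟨⟨z, Subalgebra.mem_center_iff.2 hzc⟩, Subtype.ext (Subtype.ext ?_)⟩
      change z * e = c.1.1
      have := key 1
      rwa [one_mul, one_mul] at this
  exact (LinearEquiv.ofBijective f hf).finrank_eq.symm

end FInvolution

open TensorProduct

/-! ### Types of corners and scalar extension -/

namespace FInvolution

variable {F : Type u} {A : Type v} [Field F] [Ring A] [Algebra F A]

/-- The map `a ↦ p a q`, whose range is `p A q` when `p` and `q` are idempotents. -/
noncomputable def peirce (F : Type u) {A : Type v} [Field F] [Ring A] [Algebra F A] (p q : A) :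
    A →ₗ[F] A :=
  LinearMap.mulLeft F p ∘ₗ LinearMap.mulRight F q

@[simp] theorem peirce_apply (p q a : A) : peirce F p q a = p * a * q := by
  simp [peirce, mul_assoc]

/-- For a symmetric idempotent `e`, the map `a ↦ eae + σ(eae)`, whose range is the space of
symmetrized elements of `eAe`. -/
noncomputable def symdMap (σ : FInvolution F A) (e : A) : A →ₗ[F] A :=
  (LinearMap.id + σ.toLinearMap) ∘ₗ peirce F e e

/-- For a symmetric idempotent `e`, this says that the symmetrized elements of `eAe` span less
than half of `eAe`, or equivalently that they span a smaller space than the skew elements. -/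
def SkewDominant (σ : FInvolution F A) (e : A) : Prop :=
  2 * Module.finrank F (LinearMap.range (σ.symdMap e)) <
    Module.finrank F (LinearMap.range (peirce F e e))

theorem finrank_symd_add_finrank_skew [FiniteDimensional F A] (σ : FInvolution F A) :
    Module.finrank F σ.symd + Module.finrank F σ.skew = Module.finrank F A := by
  have h : LinearMap.ker (LinearMap.id + σ.toLinearMap) = σ.skew := by
    ext x
    rw [LinearMap.mem_ker, mem_skew, LinearMap.add_apply, LinearMap.id_apply, add_comm]
    exact add_eq_zero_iff_eq_neg
  rw [← h]
  exact LinearMap.finrank_range_add_finrank_ker _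

theorem mem_symd_of_conj {σ : FInvolution F A} {e x : A} (he : σ e = e) (hx : x ∈ σ.symd) :
    e * x * e ∈ σ.symd := by
  obtain ⟨a, rfl⟩ := mem_symd.1 hx
  exact mem_symd.2 ⟨e * a * e, by simp [he, mul_add, add_mul, mul_assoc]⟩

section Types

variable {σ : FInvolution F A}

open Classical in
/-- The type, with the comparison of dimensions expressed by `SkewDominant`. -/
theorem IsAlgebraWithInvolution.type_eq (hσ : σ.IsAlgebraWithInvolution) :
    σ.type = if IsFirstKind F A then
      if σ.SkewDominant 1 ∧ (1 : A) ∈ σ.symd then .symplectic else .orthogonal else .unitary := by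
  have := hσ.finiteDimensional
  have h1 : Module.finrank F (Subalgebra.center F A) = 1 ↔ IsFirstKind F A := by
    rcases hσ.finrank_center with ⟨h, h'⟩ | ⟨h, h'⟩ <;> simp [h, h']
  have h2 : σ.SkewDominant 1 ↔ Module.finrank F σ.symd < Module.finrank F σ.skew := by
    have h3 : peirce F (1 : A) 1 = LinearMap.id := by ext; simp
    have h4 := σ.finrank_symd_add_finrank_skew
    rw [SkewDominant, symdMap, h3, LinearMap.comp_id, LinearMap.range_id, finrank_top, ← h4]
    change 2 * Module.finrank F σ.symd < _ ↔ _
    omega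
  simp only [type, h1, h2]

open Classical in
/-- The type of the restriction to a corner, expressed inside `A`: the corner is of the same kind as
`A`, and `e` is a symmetrized element of `A` if and only if it is one of `e A e`. -/
theorem IsAlgebraWithInvolution.type_restrictCorner (hσ : σ.IsAlgebraWithInvolution) {e : A}
    (he : IsIdempotentElem e) (hs : e ∈ σ.symm) (h0 : e ≠ 0) :
    (σ.restrictCorner he hs).type = if IsFirstKind F A then
      if σ.SkewDominant e ∧ e ∈ σ.symd then .symplectic else .orthogonal else .unitary := by
  have := hσ.finiteDimensional
  have h1 : Module.finrank F (Subalgebra.center F he.Corner) = 1 ↔ IsFirstKind F A := by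
    rw [hσ.finrank_center_corner he hs h0]
    rcases hσ.finrank_center with ⟨h, h'⟩ | ⟨h, h'⟩ <;> simp [h, h']
  let ι : he.Corner →ₗ[F] A :=
    { toFun := fun x => x.1
      map_add' := fun x y => rfl
      map_smul' := fun c x => rfl }
  have hι : Function.Injective ι := Subtype.val_injective
  have hfin : FiniteDimensional F he.Corner := FiniteDimensional.of_injective ι hι
  have hr : LinearMap.range ι = LinearMap.range (peirce F e e) := by
    ext x
    constructor
    · rintro ⟨⟨x, a, rfl⟩, rfl⟩
      exact ⟨a, peirce_apply e e a⟩
    · rintro ⟨a, rfl⟩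
      exact ⟨⟨e * a * e, a, rfl⟩, (peirce_apply e e a).symm⟩
  have hr' : (σ.restrictCorner he hs).symd.map ι = LinearMap.range (σ.symdMap e) := by
    ext x
    constructor
    · rintro ⟨_, ⟨⟨x, a, rfl⟩, rfl⟩, rfl⟩
      exact ⟨a, by simp only [symdMap, LinearMap.comp_apply, peirce_apply]; rfl⟩
    · rintro ⟨a, rfl⟩
      refine ⟨_, ⟨⟨e * a * e, a, rfl⟩, rfl⟩, ?_⟩
      simp only [symdMap, LinearMap.comp_apply, peirce_apply]
      rfl
  have h2 : σ.SkewDominant e ↔ Module.finrank F (σ.restrictCorner he hs).symd <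
      Module.finrank F (σ.restrictCorner he hs).skew := by
    have h4 := (σ.restrictCorner he hs).finrank_symd_add_finrank_skew
    rw [SkewDominant, ← hr, ← hr', LinearMap.finrank_range_of_inj hι, ← h4,
      ← (Submodule.equivMapOfInjective ι hι _).finrank_eq]
    omega
  have h3 : (1 : he.Corner) ∈ (σ.restrictCorner he hs).symd ↔ e ∈ σ.symd := by
    constructor
    · rintro ⟨x, hx⟩
      exact ⟨x.1, congrArg Subtype.val hx⟩
    · rintro ⟨x, hx⟩
      refine ⟨⟨e * x * e, x, rfl⟩, Subtype.ext ?_⟩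
      change e * x * e + σ (e * x * e) = e
      have hs' : σ e = e := hs
      have hx' : x + σ x = e := hx
      rw [apply_mul, apply_mul, hs', ← mul_assoc, ← add_mul, ← mul_add, hx', he.eq, he.eq]
  simp only [type, h1, h2, h3]

end Types

section BaseChange

variable (E : Type w) [Field E] [Algebra F E]

/-- The involution `id ⊗ σ` on `E ⊗ A`. -/
noncomputable def baseChange (σ : FInvolution F A) : FInvolution E (E ⊗[F] A) where
  toLinearMap := σ.toLinearMap.baseChange E
  map_mul' x y := by
    induction x using TensorProduct.induction_on with
    | zero => simp
    | add x₁ x₂ h₁ h₂ => rw [add_mul, map_add, h₁, h₂, map_add, mul_add]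
    | tmul c a =>
      induction y using TensorProduct.induction_on with
      | zero => simp
      | add x₁ x₂ h₁ h₂ => rw [mul_add, map_add, h₁, h₂, map_add, add_mul]
      | tmul d b => simp [mul_comm]
  involutive' x := by
    induction x using TensorProduct.induction_on with
    | zero => simp
    | add x₁ x₂ h₁ h₂ => rw [map_add, map_add, h₁, h₂]
    | tmul c a => simp

variable {E} in
@[simp] theorem baseChange_tmul (σ : FInvolution F A) (c : E) (a : A) :
    σ.baseChange E (c ⊗ₜ a) = c ⊗ₜ σ a := by
  simp [baseChange]

theorem _root_.LinearMap.finrank_range_baseChange {V W : Type*} [AddCommGroup V] [Module F V]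
    [AddCommGroup W] [Module F W] (f : V →ₗ[F] W) :
    Module.finrank E (LinearMap.range (f.baseChange E)) = Module.finrank F (LinearMap.range f) := by
  have h : f.baseChange E = ((LinearMap.range f).subtype.baseChange E) ∘ₗ
      (f.rangeRestrict.baseChange E) := by
    rw [← LinearMap.baseChange_comp]
    rfl
  have hs : Function.Surjective (f.rangeRestrict.baseChange E) :=
    LinearMap.lTensor_surjective E f.surjective_rangeRestrict
  have hi : Function.Injective ((LinearMap.range f).subtype.baseChange E) :=
    Module.Flat.lTensor_preserves_injective_linearMap _ (LinearMap.range f).injective_subtype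
  rw [h, LinearMap.range_comp_of_range_eq_top _ (LinearMap.range_eq_top.2 hs),
    LinearMap.finrank_range_of_inj hi, Module.finrank_baseChange]

theorem peirce_tmul (p q : A) :
    peirce E ((1 : E) ⊗ₜ[F] p) (1 ⊗ₜ q) = (peirce F p q).baseChange E := by
  ext a
  simp

theorem skewDominant_tmul (σ : FInvolution F A) (e : A) :
    (σ.baseChange E).SkewDominant ((1 : E) ⊗ₜ[F] e) ↔ σ.SkewDominant e := by
  have h : (σ.baseChange E).symdMap ((1 : E) ⊗ₜ[F] e) = (σ.symdMap e).baseChange E := by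
    rw [symdMap, symdMap, peirce_tmul, LinearMap.baseChange_comp, LinearMap.baseChange_add,
      LinearMap.baseChange_id]
    rfl
  rw [SkewDominant, SkewDominant, h, peirce_tmul, LinearMap.finrank_range_baseChange,
    LinearMap.finrank_range_baseChange]

/-- Every element of `E ⊗ A` has unique coordinates in `A` with respect to a basis of `E`. -/
theorem exists_tmul_coordinates (E : Type w) [Field E] [Algebra F E] (V : Type*) [AddCommGroup V]
    [Module F V] :
    ∃ (ι : Type w) (β : Module.Basis ι F E) (r : E ⊗[F] V ≃ₗ[F] (ι →₀ V)),
      (∀ c v i, r (c ⊗ₜ v) i = β.repr c i • v) ∧ ∀ x, x = (r x).sum fun i v => β i ⊗ₜ v := by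
  classical
  let β := Module.Basis.ofVectorSpace F E
  refine ⟨_, β, TensorProduct.equivFinsuppOfBasisLeft β, fun c v i =>
    TensorProduct.equivFinsuppOfBasisLeft_apply_tmul_apply β c v i, fun x => ?_⟩
  rw [← TensorProduct.equivFinsuppOfBasisLeft_symm_apply, LinearEquiv.symm_apply_apply]

/-- The ring of endomorphisms generated by the left and right multiplications and the
involution. -/
noncomputable def multiplicationAlgebra (σ : FInvolution F A) :
    Subalgebra F (Module.End F A) :=
  Algebra.adjoin F (Set.range (LinearMap.mulLeft F) ∪ Set.range (LinearMap.mulRight F) ∪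
    {σ.toLinearMap})

/-- The algebra is a simple module, with endomorphism ring `F`, over the ring generated by the
multiplications and the involution. By the density theorem the latter ring consists of all
`F`-linear maps. -/
theorem IsAlgebraWithInvolution.multiplicationAlgebra_eq_top {σ : FInvolution F A}
    (hσ : σ.IsAlgebraWithInvolution) : σ.multiplicationAlgebra = ⊤ := by
  have := hσ.nontrivial
  have := hσ.finiteDimensional
  set R := σ.multiplicationAlgebra with hR
  have hl : ∀ a, LinearMap.mulLeft F a ∈ R := fun a =>
    Algebra.subset_adjoin (Or.inl (Or.inl ⟨a, rfl⟩))
  have hr : ∀ a, LinearMap.mulRight F a ∈ R := fun a =>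
    Algebra.subset_adjoin (Or.inl (Or.inr ⟨a, rfl⟩))
  have hs : (σ.toLinearMap : Module.End F A) ∈ R := Algebra.subset_adjoin (Or.inr rfl)
  -- an `R`-submodule of `A` is a two-sided ideal stable under the involution
  have hsimple : IsSimpleModule R A := by
    rw [isSimpleModule_iff]
    refine { exists_pair_ne := ⟨⊥, ⊤, bot_ne_top⟩, eq_bot_or_eq_top := fun N => ?_ }
    have hNl : ∀ a, ∀ x ∈ N, a * x ∈ N := fun a x hx => N.smul_mem ⟨_, hl a⟩ hx
    have hNr : ∀ a, ∀ x ∈ N, x * a ∈ N := fun a x hx => N.smul_mem ⟨_, hr a⟩ hx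
    have hNs : ∀ x ∈ N, σ x ∈ N := fun x hx => N.smul_mem ⟨_, hs⟩ hx
    let I : TwoSidedIdeal A := TwoSidedIdeal.mk' N N.zero_mem N.add_mem
      (fun {x} hx => by simpa using hNl (-1) x hx)
      (fun {x y} hy => hNl x y hy) (fun {x y} hx => hNr y x hx)
    have hI : ∀ x, x ∈ I ↔ x ∈ N := fun x => by
      simp only [I, TwoSidedIdeal.mem_mk', SetLike.mem_coe]
    rcases hσ.eq_bot_or_eq_top I (by
      ext z
      constructor
      · rintro ⟨w, hw, rfl⟩
        exact (hI _).2 (hNs w ((hI w).1 hw))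
      · intro hz
        exact ⟨σ z, (hI _).2 (hNs z ((hI z).1 hz)), by simp⟩) with h | h
    · left
      rw [eq_bot_iff]
      intro x hx
      have := (hI x).2 hx
      rwa [h, TwoSidedIdeal.mem_bot] at this
    · right
      rw [eq_top_iff]
      intro x _
      exact (hI x).1 (h ▸ TwoSidedIdeal.mem_top A)
  rw [eq_top_iff]
  intro f _
  -- an endomorphism of the `R`-module `A` is the multiplication by the image of `1`, which is
  -- central and symmetric
  have hend : ∀ φ : Module.End R A, ∃ c : F, ∀ x, φ x = c • x := by
    intro φ
    have h1 : ∀ a, φ a = a * φ 1 := fun a => by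
      have := φ.map_smul ⟨_, hl a⟩ 1
      change φ (a * 1) = a * φ 1 at this
      rwa [mul_one] at this
    have h2 : ∀ a, φ a = φ 1 * a := fun a => by
      have := φ.map_smul ⟨_, hr a⟩ 1
      change φ (1 * a) = φ 1 * a at this
      rwa [one_mul] at this
    have h3 : σ (φ 1) = φ 1 := by
      have := φ.map_smul ⟨_, hs⟩ 1
      change φ (σ 1) = σ (φ 1) at this
      rwa [apply_one, eq_comm] at this
    obtain ⟨c, hc⟩ := hσ.exists_eq_smul_one (fun a => by rw [← h1, h2]) h3
    exact ⟨c, fun x => by rw [h2, hc, smul_one_mul]⟩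
  let inst : AddCommGroup A := inferInstance
  let f' : Module.End (Module.End R A) A :=
    { toFun := f
      map_add' := f.map_add
      map_smul' := fun φ x => by
        obtain ⟨c, hc⟩ := hend φ
        change f (φ x) = φ (f x)
        rw [hc, hc, map_smul] }
  let b := Module.finBasis F A
  classical
  obtain ⟨r, hr⟩ := jacobson_density (R := R) (M := A) f' (Finset.univ.image b)
  have : f = r.1 := b.ext fun i => hr _ (Finset.mem_image_of_mem _ (Finset.mem_univ i))
  rw [this]
  exact r.2

/-- Algebras with involution remain so under all scalar extensions. -/
theorem IsAlgebraWithInvolution.baseChange {σ : FInvolution F A}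
    (hσ : σ.IsAlgebraWithInvolution) : (σ.baseChange E).IsAlgebraWithInvolution := by
  have := hσ.nontrivial
  have := hσ.finiteDimensional
  let b := Module.finBasis F A
  have hb : ∀ x : E ⊗[F] A, x = ∑ i, (b.baseChange E).repr x i • ((1 : E) ⊗ₜ[F] b i) := fun x => by
    conv_lhs => rw [← (b.baseChange E).sum_repr x]
    simp
  -- a property of endomorphisms that is stable under sums and products and holds for scalars,
  -- multiplications and the involution holds for the base change of every `F`-linear map, because
  -- these generate all of `Module.End F A`
  have hmem : ∀ (P : Module.End E (E ⊗[F] A) → Prop), (∀ f g, P f → P g → P (f * g)) →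
      (∀ f g, P f → P g → P (f + g)) → (∀ c : E, P (c • 1)) →
      (∀ a : A, P (LinearMap.mulLeft E ((1 : E) ⊗ₜ[F] a))) →
      (∀ a : A, P (LinearMap.mulRight E ((1 : E) ⊗ₜ[F] a))) →
      P (σ.baseChange E).toLinearMap → ∀ f : A →ₗ[F] A, P (f.baseChange E) := by
    intro P hmul hadd hsc hl hr hs f
    have hf : f ∈ σ.multiplicationAlgebra := by
      rw [hσ.multiplicationAlgebra_eq_top]
      trivial
    induction hf using Algebra.adjoin_induction with
    | mem x hx =>
      rcases hx with (⟨a, rfl⟩ | ⟨a, rfl⟩) | rfl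
      · convert hl a using 1
        ext
        simp
      · convert hr a using 1
        ext
        simp
      · exact hs
    | algebraMap r =>
      convert hsc (algebraMap F E r) using 1
      ext
      simp
    | add x y _ _ hx hy =>
      rw [LinearMap.baseChange_add]
      exact hadd _ _ hx hy
    | mul x y _ _ hx hy =>
      convert hmul _ _ hx hy using 1
      exact LinearMap.baseChange_mul x y
  refine ⟨inferInstance, inferInstance, fun x => ⟨?_, ?_⟩, fun I hI => ?_⟩
  · rintro ⟨hc, hs⟩
    rw [Subalgebra.mem_center_iff] at hc
    have hs : σ.baseChange E x = x := hs
    have key := hmem (fun f => ∀ y, f (x * y) = x * f y)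
      (fun f g hf hg y => by simp [hf, hg]) (fun f g hf hg y => by simp [hf, hg, mul_add])
      (fun c y => by simp) (fun a y => by simp [← mul_assoc, hc])
      (fun a y => by simp [mul_assoc])
      (fun y => by rw [apply_mul, hs, hc])
    -- multiplication by `x` commutes with all base changes, in particular with that of a projection
    -- of `A` onto `F`
    obtain ⟨f, hf⟩ := Module.Projective.exists_dual_eq_one F (one_ne_zero : (1 : A) ≠ 0)
    have h1 := key ((LinearMap.toSpanSingleton F A 1).comp f) 1
    have h2 : ∀ z, ∃ c : E, ((LinearMap.toSpanSingleton F A 1).comp f).baseChange E z =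
        algebraMap E _ c := by
      intro z
      induction z using TensorProduct.induction_on with
      | zero => exact ⟨0, by simp⟩
      | tmul c a => exact ⟨f a • c, by simp [TensorProduct.smul_tmul']⟩
      | add z w hz hw =>
        obtain ⟨c, hc⟩ := hz
        obtain ⟨d, hd⟩ := hw
        exact ⟨c + d, by rw [map_add, hc, hd, map_add]⟩
    obtain ⟨c, hc⟩ := h2 x
    have h3 : ((LinearMap.toSpanSingleton F A 1).comp f).baseChange E 1 = 1 := by
      rw [Algebra.TensorProduct.one_def]
      simp [hf]
    rw [mul_one, hc, h3, mul_one] at h1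
    exact Algebra.mem_bot.2 ⟨c, h1⟩
  · intro hx
    obtain ⟨c, rfl⟩ := Algebra.mem_bot.1 hx
    exact ⟨(Subalgebra.center E _).algebraMap_mem c, FInvolution.apply_algebraMap _ c⟩
  · rw [or_iff_not_imp_left]
    intro hne
    obtain ⟨x, hxI, hx0⟩ : ∃ x ∈ I, x ≠ 0 := by
      by_contra hcon
      push Not at hcon
      exact hne (eq_bot_iff.2 fun x hx => by rw [TwoSidedIdeal.mem_bot]; exact hcon x hx)
    have key := hmem (fun f => ∀ y ∈ I, f y ∈ I)
      (fun f g hf hg y hy => hf _ (hg y hy)) (fun f g hf hg y hy => I.add_mem (hf y hy) (hg y hy))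
      (fun c y hy => by
        have := I.mul_mem_left (c • 1) y hy
        rwa [smul_one_mul] at this)
      (fun a y hy => I.mul_mem_left _ _ hy) (fun a y hy => I.mul_mem_right _ _ hy)
      (fun y hy => by
        have : σ.baseChange E y ∈ (σ.baseChange E) '' (I : Set (E ⊗[F] A)) := ⟨y, hy, rfl⟩
        rw [hI] at this
        exact this)
    obtain ⟨j, hj⟩ : ∃ j, (b.baseChange E).repr x j ≠ 0 := by
      by_contra hcon
      push Not at hcon
      apply hx0
      rw [hb x]
      simp [hcon]
    -- the base change of a coordinate map sends `x` to a nonzero scalar in `I`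
    have h1 := key ((LinearMap.toSpanSingleton F A 1).comp (b.coord j)) x hxI
    rw [hb x, map_sum] at h1
    have h2 : ∀ i, ((LinearMap.toSpanSingleton F A 1).comp (b.coord j)).baseChange E
        ((b.baseChange E).repr x i • (1 : E) ⊗ₜ[F] b i) =
        if i = j then (b.baseChange E).repr x j • 1 else 0 := fun i => by
      rw [map_smul, LinearMap.baseChange_tmul, LinearMap.comp_apply, Module.Basis.coord_apply,
        Module.Basis.repr_self, Finsupp.single_apply]
      split_ifs with h
      · rw [h, LinearMap.toSpanSingleton_apply, one_smul, Algebra.TensorProduct.one_def]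
      · simp
    simp only [h2, Finset.sum_ite_eq', Finset.mem_univ, if_true] at h1
    rw [← TwoSidedIdeal.one_mem_iff]
    have h3 := I.mul_mem_left (((b.baseChange E).repr x j)⁻¹ • 1) _ h1
    rwa [smul_one_mul, smul_smul, inv_mul_cancel₀ hj, one_smul] at h3

/-- The kind of the involution is invariant under scalar extension: the coordinates of a central
element of `E ⊗ A` are central. -/
theorem isFirstKind_tmul : IsFirstKind E (E ⊗[F] A) ↔ IsFirstKind F A := by
  obtain ⟨ι, β, r, hr, hx⟩ := exists_tmul_coordinates (F := F) E A
  constructor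
  · intro h x hxc
    obtain ⟨c, hc⟩ := h (1 ⊗ₜ x) (fun a => by
      induction a using TensorProduct.induction_on with
      | zero => simp
      | tmul d a => simp [hxc a]
      | add z w hz hw => rw [add_mul, hz, hw, mul_add])
    rw [Algebra.TensorProduct.one_def, TensorProduct.smul_tmul', smul_eq_mul, mul_one] at hc
    obtain ⟨i, hi⟩ : ∃ i, β.repr 1 i ≠ 0 := by
      by_contra hcon
      push Not at hcon
      have : β.repr 1 = 0 := Finsupp.ext hcon
      simp at this
    have := congrArg (fun z => r z i) hc
    simp only [hr] at this
    exact ⟨(β.repr 1 i)⁻¹ * β.repr c i, by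
      rw [mul_smul, ← this, smul_smul, inv_mul_cancel₀ hi, one_smul]⟩
  · intro h x hxc
    have hl : ∀ a z i, r ((1 ⊗ₜ a) * z) i = a * r z i := fun a z i => by
      induction z using TensorProduct.induction_on with
      | zero => simp
      | tmul d b => simp [hr]
      | add z w hz hw => rw [mul_add, map_add, Finsupp.add_apply, hz, hw, map_add,
          Finsupp.add_apply, mul_add]
    have hr' : ∀ a z i, r (z * (1 ⊗ₜ a)) i = r z i * a := fun a z i => by
      induction z using TensorProduct.induction_on with
      | zero => simp
      | tmul d b => simp [hr]
      | add z w hz hw => rw [add_mul, map_add, Finsupp.add_apply, hz, hw, map_add,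
          Finsupp.add_apply, add_mul]
    choose c hc using fun i => h (r x i) (fun a => by rw [← hl, ← hr', hxc])
    refine ⟨∑ i ∈ (r x).support, c i • β i, ?_⟩
    conv_lhs => rw [hx x]
    rw [Finsupp.sum, Finset.sum_smul]
    refine Finset.sum_congr rfl fun i _ => ?_
    rw [hc, Algebra.TensorProduct.one_def, TensorProduct.smul_tmul', smul_eq_mul, mul_one,
      TensorProduct.smul_tmul]

end BaseChange

end FInvolution

/-! ### Matrix units and split algebras -/

namespace FInvolution

variable {F : Type u} {A : Type v} [Field F] [Ring A] [Algebra F A] {σ : FInvolution F A}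

/-- A nontrivial central idempotent is exchanged with its complement by the involution. -/
theorem IsAlgebraWithInvolution.apply_central_idempotent (hσ : σ.IsAlgebraWithInvolution) {f : A}
    (hc : ∀ a, a * f = f * a) (hf : f * f = f) (h0 : f ≠ 0) (h1 : f ≠ 1) : σ f = 1 - f := by
  have := hσ.nontrivial
  -- `g σ(g)` is a symmetric central idempotent, hence is `0` or `1`
  have key : ∀ g : A, (∀ a, a * g = g * a) → g * g = g → g ≠ 1 → g * σ g = 0 := by
    intro g hgc hgg hg1
    have hσc := commutes_apply (σ := σ) hgc
    have hσg : σ g * σ g = σ g := by rw [← apply_mul, hgg]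
    obtain ⟨c, hcg⟩ := hσ.exists_eq_smul_one (x := g * σ g)
      (fun a => by rw [← mul_assoc, hgc, mul_assoc, hσc, mul_assoc])
      (by rw [apply_mul, apply_apply])
    have hidem : (g * σ g) * (g * σ g) = g * σ g := by
      rw [mul_assoc, ← mul_assoc (σ g), ← hσc g, mul_assoc g, hσg, ← mul_assoc, hgg]
    have hcc : c * c = c := by
      rw [hcg, smul_mul_smul_comm, mul_one] at hidem
      exact smul_left_injective F (one_ne_zero (α := A)) hidem
    rcases mul_eq_zero.1 (show c * (c - 1) = 0 by rw [mul_sub, hcc, mul_one, sub_self]) with h | h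
    · rw [hcg, h, zero_smul]
    · exfalso
      rw [sub_eq_zero.1 h, one_smul] at hcg
      apply hg1
      rw [← hcg]
      conv_lhs => rw [← mul_one g, ← hcg, ← mul_assoc, hgg]
  have k1 := key f hc hf h1
  have k2 := key (1 - f) (fun a => by rw [mul_sub, sub_mul, hc, mul_one, one_mul])
    (by rw [mul_sub, mul_one, sub_mul, one_mul, hf, sub_self, sub_zero])
    (fun h => h0 (by simpa using h))
  rw [map_sub, apply_one, mul_sub, mul_one, sub_mul, one_mul, k1, sub_zero, sub_eq_zero] at k2
  exact k2.symm

/-- Matrix units `E i j` with sum `f`, whose corners `E i i A E i i` consist of the multiples of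
`E i i` by central elements. -/
structure IsSplitBy (f : A) (n : ℕ) (E : Fin n → Fin n → A) : Prop where
  mul_eq : ∀ i j k l, E i j * E k l = if j = k then E i l else 0
  sum_eq : ∑ i, E i i = f
  corner : ∀ i x, ∃ z, (∀ y, y * z = z * y) ∧ E i i * x * E i i = z * E i i

/-- A surjection of a matrix ring over a commutative ring onto a corner provides matrix units, if
the scalar matrices have central images. The map need not preserve the unit, so that its image may
be one of two simple factors. -/
theorem isSplitBy_of_matrix {D : Type*} [CommRing D] {n : ℕ}
    (φ : Matrix (Fin n) (Fin n) D →ₙ+* A) (hsurj : ∀ x, ∃ M, φ M = φ 1 * x * φ 1)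
    (hcen : ∀ (d : D) y, y * φ (Matrix.scalar _ d) = φ (Matrix.scalar _ d) * y) :
    IsSplitBy (φ 1) n fun i j => φ (Matrix.single i j 1) where
  mul_eq i j k l := by
    rw [← map_mul]
    split_ifs with h
    · rw [h, Matrix.single_mul_single_same, mul_one]
    · rw [Matrix.single_mul_single_of_ne _ _ _ _ h, map_zero]
  sum_eq := by
    rw [← map_sum]
    congr 1
    ext i j
    rw [Matrix.sum_apply, Matrix.one_apply]
    simp [Matrix.single_apply, ite_and]
  corner i x := by
    obtain ⟨M, hM⟩ := hsurj x
    refine ⟨φ (Matrix.scalar _ (M i i)), hcen _, ?_⟩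
    have h1 : φ (Matrix.single i i 1) = φ (Matrix.single i i 1) * φ 1 := by rw [← map_mul, mul_one]
    have h2 : φ (Matrix.single i i 1) = φ 1 * φ (Matrix.single i i 1) := by rw [← map_mul, one_mul]
    calc φ (Matrix.single i i 1) * x * φ (Matrix.single i i 1)
        = φ (Matrix.single i i 1) * (φ 1 * x * φ 1) * φ (Matrix.single i i 1) := by
          rw [← mul_assoc, ← mul_assoc, ← h1, mul_assoc _ (φ 1), ← h2]
      _ = φ (Matrix.scalar _ (M i i)) * φ (Matrix.single i i 1) := by
          rw [← hM, ← map_mul, ← map_mul, ← map_mul]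
          congr 1
          rw [Matrix.single_mul_mul_single]
          ext k l
          simp [Matrix.single_apply]

/-- Split data: matrix units `E` generating the algebra over its center, or one half of the algebra
if the center is not a field. -/
def IsUnitSplit (σ : FInvolution F A) : Prop :=
  (IsField (Subring.center A) ∧ ∃ n E, IsSplitBy (1 : A) n E) ∨
    ∃ f : A, (∀ a, a * f = f * a) ∧ f * f = f ∧ f ≠ 0 ∧ f ≠ 1 ∧ σ f = 1 - f ∧
      ∃ n E, IsSplitBy f n E

/-- For a center `F × F`, the matrix units are taken from the first factor of the algebra. -/
theorem IsAlgebraWithInvolution.isUnitSplit_of_isSplit (hσ : σ.IsAlgebraWithInvolution)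
    (hs : σ.IsSplit) : σ.IsUnitSplit := by
  have := hσ.nontrivial
  rcases hs with ⟨hZ, n, ⟨Ψ⟩⟩ | ⟨hZ, n, ⟨Ψ⟩⟩
  · left
    let φ : Matrix (Fin n) (Fin n) (Subring.center A) →ₙ+* A :=
      { toFun := Ψ.symm
        map_mul' := map_mul Ψ.symm
        map_zero' := map_zero Ψ.symm
        map_add' := map_add Ψ.symm }
    have hφ1 : φ 1 = 1 := map_one Ψ.symm
    refine ⟨hZ, n, _, hφ1 ▸ isSplitBy_of_matrix φ ?_ ?_⟩
    · intro x
      exact ⟨Ψ x, by rw [hφ1, one_mul, mul_one]; exact Ψ.symm_apply_apply x⟩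
    · intro d y
      have : Ψ.symm (Matrix.scalar (Fin n) d) = d.1 := Ψ.symm.commutes d
      change y * Ψ.symm _ = Ψ.symm _ * y
      rw [this]
      exact Subring.mem_center_iff.1 d.2 y
  · right
    let φ : Matrix (Fin n) (Fin n) F →ₙ+* A :=
      { toFun := fun M => Ψ.symm (M, 0)
        map_mul' := fun M N => by rw [← map_mul, Prod.mk_mul_mk, zero_mul]
        map_zero' := by rw [← Prod.zero_eq_mk, map_zero]
        map_add' := fun M N => by rw [← map_add, Prod.mk_add_mk, zero_add] }
    have hφ : ∀ M, φ M = Ψ.symm (M, 0) := fun M => rfl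
    have hcen : ∀ (d : F) y, y * φ (Matrix.scalar _ d) = φ (Matrix.scalar _ d) * y := by
      intro d y
      apply Ψ.injective
      simp only [hφ, map_mul, AlgEquiv.apply_symm_apply]
      ext : 1
      · exact ((Matrix.scalar_commute d (fun r => mul_comm _ _) _).eq).symm
      · simp
    have hn : n ≠ 0 := by
      rintro rfl
      exact zero_ne_one (Ψ.injective (Subsingleton.elim (Ψ 0) (Ψ 1)))
    have : Nonempty (Fin n) := ⟨⟨0, Nat.pos_of_ne_zero hn⟩⟩
    have hc : ∀ a, a * φ 1 = φ 1 * a := by simpa using hcen 1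
    have hf : φ 1 * φ 1 = φ 1 := by rw [← map_mul, mul_one]
    have h0 : φ 1 ≠ 0 := by
      rw [hφ, Ne, map_eq_zero_iff _ Ψ.symm.injective]
      simp
    have h1 : φ 1 ≠ 1 := by
      rw [hφ, Ne, map_eq_one_iff _ Ψ.symm.injective]
      simp
    refine ⟨φ 1, hc, hf, h0, h1, hσ.apply_central_idempotent hc hf h0 h1, n, _,
      isSplitBy_of_matrix φ (fun x => ⟨(Ψ x).1, Ψ.injective ?_⟩) hcen⟩
    simp only [hφ, map_mul, AlgEquiv.apply_symm_apply]
    ext : 1 <;> simp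

/-- An algebra with involution which is not simple has a nontrivial central idempotent. -/
theorem IsAlgebraWithInvolution.isSimpleRing_or_exists (hσ : σ.IsAlgebraWithInvolution) :
    IsSimpleRing A ∨ ∃ f : A, (∀ a, a * f = f * a) ∧ f * f = f ∧ f ≠ 0 ∧ f ≠ 1 := by
  have := hσ.nontrivial
  by_contra hcon
  rw [not_or] at hcon
  obtain ⟨hns, hno⟩ := hcon
  apply hns
  rw [isSimpleRing_iff]
  refine { exists_pair_ne := ⟨⊥, ⊤, bot_ne_top⟩, eq_bot_or_eq_top := fun I => ?_ }
  by_contra hI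
  rw [not_or] at hI
  obtain ⟨hI0, hI1⟩ := hI
  have hI1' : (1 : A) ∉ I := fun h => hI1 ((TwoSidedIdeal.one_mem_iff I).1 h)
  obtain ⟨x, hxI, hx0⟩ : ∃ x ∈ I, x ≠ 0 := by
    by_contra hcon
    push Not at hcon
    exact hI0 (eq_bot_iff.2 fun x hx => by rw [TwoSidedIdeal.mem_bot]; exact hcon x hx)
  -- `I ∩ σ I = 0`, as no symmetric or skew element lies in `I`
  have hint : ∀ z ∈ I, σ z ∈ I → z = 0 := by
    have hsym : ∀ z ∈ I, σ z = z ∨ σ z = -z → z = 0 := by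
      intro z hz hzs
      by_contra hz0
      obtain ⟨N, a, b, hab⟩ := hσ.exists_sum_eq_one hz0 hzs
      exact hI1' (hab ▸ sum_mem fun i _ => I.mul_mem_right _ _ (I.mul_mem_left _ _ hz))
    intro z hz hσz
    have h1 := hsym (z + σ z) (I.add_mem hz hσz) (Or.inl (by simp [add_comm]))
    exact hsym z hz (Or.inr (eq_neg_of_add_eq_zero_right h1))
  have hx' : x + σ x ≠ 0 := fun h => hx0 (hint x hxI (by
    rw [eq_neg_of_add_eq_zero_right h]; exact I.neg_mem hxI))
  obtain ⟨N, a, b, hab⟩ := hσ.exists_sum_eq_one hx' (Or.inl (by simp [add_comm]))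
  -- writing `1 = ∑ aᵢ (x + σ x) bᵢ`, the part of `1` in `I` is the required idempotent
  obtain ⟨f, hf⟩ : ∃ f, f = ∑ i, a i * x * b i := ⟨_, rfl⟩
  obtain ⟨g, hg⟩ : ∃ g, g = ∑ i, a i * σ x * b i := ⟨_, rfl⟩
  have hfI : f ∈ I := hf ▸ sum_mem fun i _ => I.mul_mem_right _ _ (I.mul_mem_left _ _ hxI)
  have hgI : σ g ∈ I := by
    rw [hg, map_sum]
    refine sum_mem fun i _ => ?_
    simp only [apply_mul, apply_apply]
    exact I.mul_mem_left _ _ (I.mul_mem_right _ _ hxI)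
  have hfg : f + g = 1 := by
    rw [← hab, hf, hg, ← Finset.sum_add_distrib]
    exact Finset.sum_congr rfl fun i _ => by rw [mul_add, add_mul]
  have hgf : g = 1 - f := by rw [← hfg]; abel
  -- products of elements of `I` and `σ I` vanish
  have hIl : ∀ y ∈ I, y * g = 0 := fun y hy => hint _ (I.mul_mem_right _ _ hy) (by
    rw [apply_mul]; exact I.mul_mem_right _ _ hgI)
  have hIr : ∀ y ∈ I, g * y = 0 := fun y hy => hint _ (I.mul_mem_left _ _ hy) (by
    rw [apply_mul]; exact I.mul_mem_left _ _ hgI)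
  have hl : ∀ y ∈ I, y * f = y := fun y hy => by
    have := hIl y hy
    rwa [hgf, mul_sub, mul_one, sub_eq_zero, eq_comm] at this
  have hr : ∀ y ∈ I, f * y = y := fun y hy => by
    have := hIr y hy
    rwa [hgf, sub_mul, one_mul, sub_eq_zero, eq_comm] at this
  refine hno ⟨f, fun y => ?_, hl f hfI, ?_, fun h => hI1' (h ▸ hfI)⟩
  · rw [← hr (y * f) (I.mul_mem_left _ _ hfI), ← hl (f * y) (I.mul_mem_right _ _ hfI), mul_assoc]
  · rintro rfl
    exact hx0 (by rw [← hl x hxI, mul_zero])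

/-- Over a field without noncommutative finite-dimensional division algebras, all algebras with
involution are split. -/
theorem IsAlgebraWithInvolution.isUnitSplit (hσ : σ.IsAlgebraWithInvolution)
    (hF : ∀ (D : Type v) [DivisionRing D] [Algebra F D] [Module.Finite F D] (x y : D),
      x * y = y * x) : σ.IsUnitSplit := by
  have := hσ.nontrivial
  have := hσ.finiteDimensional
  rcases hσ.isSimpleRing_or_exists with h | ⟨f, hc, hf, h0, h1⟩
  · left
    have := IsArtinianRing.of_finite F A
    obtain ⟨n, _, D, _, _, _, ⟨Ψ⟩⟩ := IsSimpleRing.exists_algEquiv_matrix_divisionRing_finite F A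
    let inst : CommRing D := { (inferInstance : Ring D) with mul_comm := hF D }
    let φ : Matrix (Fin n) (Fin n) D →ₙ+* A :=
      { toFun := Ψ.symm
        map_mul' := map_mul Ψ.symm
        map_zero' := map_zero Ψ.symm
        map_add' := map_add Ψ.symm }
    have hφ1 : φ 1 = 1 := map_one Ψ.symm
    refine ⟨IsSimpleRing.isField_center A, n, _, hφ1 ▸ isSplitBy_of_matrix φ ?_ ?_⟩
    · intro x
      exact ⟨Ψ x, by rw [hφ1, one_mul, mul_one]; exact Ψ.symm_apply_apply x⟩
    · intro d y
      apply Ψ.injective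
      change Ψ (y * Ψ.symm _) = Ψ (Ψ.symm _ * y)
      simp only [map_mul, AlgEquiv.apply_symm_apply]
      exact ((Matrix.scalar_commute d (fun r => mul_comm _ _) _).eq).symm
  · right
    have hσf := hσ.apply_central_idempotent hc hf h0 h1
    refine ⟨f, hc, hf, h0, h1, hσf, ?_⟩
    have he : IsIdempotentElem f := hf
    let ι : he.Corner →ₗ[F] A :=
      { toFun := fun x => x.1
        map_add' := fun x y => rfl
        map_smul' := fun c x => rfl }
    let mk : A → he.Corner := fun y => ⟨f * y * f, y, rfl⟩
    have hfin : FiniteDimensional F he.Corner :=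
      FiniteDimensional.of_injective ι Subtype.val_injective
    have hntr : Nontrivial he.Corner := ⟨0, 1, fun h => h0 (congrArg Subtype.val h).symm⟩
    -- `f A` is simple: for a nonzero `x` in it, `x + σ x` generates the unit ideal of `A`, and
    -- `σ x` is killed by `f`
    have hsimple : IsSimpleRing he.Corner := by
      rw [isSimpleRing_iff]
      refine { exists_pair_ne := ⟨⊥, ⊤, bot_ne_top⟩, eq_bot_or_eq_top := fun J => ?_ }
      rw [or_iff_not_imp_left]
      intro hJ
      obtain ⟨x, hxJ, hx0⟩ : ∃ x ∈ J, x ≠ 0 := by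
        by_contra hcon
        push Not at hcon
        exact hJ (eq_bot_iff.2 fun x hx => by rw [TwoSidedIdeal.mem_bot]; exact hcon x hx)
      have hx := (Subsemigroup.mem_corner_iff he).mp x.2
      have hfσx : f * σ x.1 = 0 := by
        rw [← hx.1, apply_mul, hσf, ← mul_assoc, ← hc, mul_assoc, mul_sub, mul_one, hf, sub_self,
          mul_zero]
      have hx' : x.1 + σ x.1 ≠ 0 := fun h => hx0 (Subtype.ext (by
        change x.1 = 0
        have := congrArg (f * ·) h
        simpa [mul_add, hx.1, hfσx] using this))
      obtain ⟨N, a, b, hab⟩ := hσ.exists_sum_eq_one hx' (Or.inl (by simp [add_comm]))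
      have key : (1 : he.Corner) =
          ∑ i, mk (a i) * x * mk (b i) := by
        apply Subtype.ext
        change f = ι _
        rw [map_sum]
        conv_lhs => rw [← mul_one f, ← hab, Finset.mul_sum]
        refine Finset.sum_congr rfl fun i _ => ?_
        change _ = f * a i * f * x.1 * (f * b i * f)
        rw [mul_add, add_mul, mul_add, ← mul_assoc f, ← mul_assoc f, ← mul_assoc f, ← mul_assoc f,
          ← hc (a i), mul_assoc (a i) f (σ x.1), hfσx, mul_zero, zero_mul, add_zero,
          ← hc (b i), mul_assoc (b i), hf, hc (b i), mul_assoc (a i) f f, hf, ← mul_assoc,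
          mul_assoc _ x.1 f, hx.2]
      rw [← TwoSidedIdeal.one_mem_iff, key]
      exact sum_mem fun i _ => J.mul_mem_right _ _ (J.mul_mem_left _ _ hxJ)
    have := IsArtinianRing.of_finite F he.Corner
    obtain ⟨n, _, D, _, _, _, ⟨Ψ⟩⟩ :=
      IsSimpleRing.exists_algEquiv_matrix_divisionRing_finite F he.Corner
    let inst : CommRing D := { (inferInstance : Ring D) with mul_comm := hF D }
    let φ : Matrix (Fin n) (Fin n) D →ₙ+* A :=
      { toFun := fun M => (Ψ.symm M).1
        map_mul' := fun M N => by rw [map_mul]; rfl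
        map_zero' := by rw [map_zero]; rfl
        map_add' := fun M N => by rw [map_add]; rfl }
    have hφ1 : φ 1 = f := by
      change (Ψ.symm 1).1 = f
      rw [map_one]
      rfl
    refine ⟨n, _, hφ1 ▸ isSplitBy_of_matrix φ ?_ ?_⟩
    · intro x
      rw [hφ1]
      exact ⟨Ψ (mk x), congrArg Subtype.val (Ψ.symm_apply_apply (mk x))⟩
    · intro d y
      have hm := (Subsemigroup.mem_corner_iff he).mp (Ψ.symm (Matrix.scalar (Fin n) d)).2
      have hcomm : mk y * Ψ.symm (Matrix.scalar (Fin n) d) =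
          Ψ.symm (Matrix.scalar (Fin n) d) * mk y := by
        apply Ψ.injective
        simp only [map_mul, AlgEquiv.apply_symm_apply]
        exact ((Matrix.scalar_commute d (fun r => mul_comm _ _) _).eq).symm
      have := congrArg Subtype.val hcomm
      change f * y * f * (Ψ.symm _).1 = (Ψ.symm _).1 * (f * y * f) at this
      change y * (Ψ.symm _).1 = (Ψ.symm _).1 * y
      rw [mul_assoc (f * y), hm.1, ← hc, mul_assoc, hm.1, mul_assoc y f f, hf, hc y, ← mul_assoc,
        hm.2] at this
      exact this

end FInvolution

/-! ### Involutions as adjoint involutions of hermitian forms -/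

namespace FInvolution

variable {F : Type u} {A : Type v} [Field F] [Ring A] [Algebra F A]

/-- A frame presents the algebra as the endomorphism ring, over its center `Z`, of the left ideal
`V = A e`, where `e` is an idempotent with `e A e = Z e`. The elements `a j` and `b j` are dual
bases: they describe `V` and its dual `e A`. The element `t`, with inverse `s`, identifies `e A`
with the conjugate of `V` and so turns the involution into the adjoint involution of the
`ε`-hermitian form on `V` given by `h(w, x) e = t σ(w) x`. -/
structure Frame (σ : FInvolution F A) where
  n : ℕ
  e : A
  a : Fin n → A
  b : Fin n → A
  s : A
  t : A
  ε : F
  ee : e * e = e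
  ae : ∀ j, a j * e = a j
  eb : ∀ j, e * b j = b j
  sum_ab : ∑ j, a j * b j = 1
  ba : ∀ i j, b i * a j = if i = j then e else 0
  corner : ∀ x, ∃ z, (∀ y, y * z = z * y) ∧ e * x * e = z * e
  ts : t * s = e
  st : s * t = σ e
  et : e * t = t
  se : s * e = s
  apply_t : σ t = ε • t
  ε_eq : ε = 1 ∨ ε = -1
  ε_eq_one : ¬ IsFirstKind F A → ε = 1

variable {σ : FInvolution F A}

/-- Frames exist for matrix algebras over a field: the element `s` is taken in the space `σ(e) A e`,
which is one-dimensional over the center, so that `σ s = c s` for a central `c` with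
`σ(c) c = 1`. -/
theorem IsSplitBy.exists_frame_of_isField (hσ : σ.IsAlgebraWithInvolution) {n : ℕ}
    {E : Fin n → Fin n → A} (h : IsSplitBy (1 : A) n E) (hZ : IsField (Subring.center A)) :
    Nonempty (Frame σ) := by
  have := hσ.nontrivial
  have hinv : ∀ z : A, (∀ y, y * z = z * y) → z ≠ 0 → ∃ w, (∀ y, y * w = w * y) ∧ w * z = 1 := by
    intro z hz hz0
    obtain ⟨w, hw⟩ := hZ.mul_inv_cancel (a := ⟨z, Subring.mem_center_iff.2 hz⟩)
      (fun h => hz0 (congrArg Subtype.val h))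
    refine ⟨w.1, Subring.mem_center_iff.1 w.2, ?_⟩
    rw [hz]
    exact congrArg Subtype.val hw
  have hn : n ≠ 0 := by
    rintro rfl
    have := h.sum_eq
    simp at this
  let o : Fin n := ⟨0, Nat.pos_of_ne_zero hn⟩
  obtain ⟨e, he⟩ : ∃ e, e = E o o := ⟨_, rfl⟩
  have hsum : ∑ j, E j o * E o j = 1 := by
    rw [← h.sum_eq]
    exact Finset.sum_congr rfl fun j _ => by rw [h.mul_eq, if_pos rfl]
  have hee : e * e = e := by rw [he, h.mul_eq, if_pos rfl]
  have hae : ∀ j, E j o * e = E j o := fun j => by rw [he, h.mul_eq, if_pos rfl]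
  have heb : ∀ j, e * E o j = E o j := fun j => by rw [he, h.mul_eq, if_pos rfl]
  have hba : ∀ i j, E o i * E j o = if i = j then e else 0 := fun i j => by rw [he, h.mul_eq]
  have hcor : ∀ x, ∃ z, (∀ y, y * z = z * y) ∧ e * x * e = z * e := fun x => he ▸ h.corner o x
  have he0 : e ≠ 0 := fun h0 => one_ne_zero (α := A) (by
    rw [← hsum]
    exact Finset.sum_eq_zero fun j _ => by rw [← hae, h0, mul_zero, zero_mul])
  have hσee : σ e * σ e = σ e := by rw [← apply_mul, hee]
  -- the space `σ(e) A e` is not zero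
  obtain ⟨s, hs0, hσes, hse⟩ : ∃ s, s ≠ 0 ∧ σ e * s = s ∧ s * e = s := by
    by_contra hcon
    push Not at hcon
    have h1 : ∀ x, σ e * x * e = 0 := fun x => by
      by_contra hx
      exact hcon _ hx (by rw [← mul_assoc, ← mul_assoc, hσee]) (by rw [mul_assoc, hee])
    apply he0
    apply σ.apply_injective
    rw [map_zero, ← mul_one (σ e), ← hsum, Finset.mul_sum]
    exact Finset.sum_eq_zero fun j _ => by rw [← hae, ← mul_assoc, ← mul_assoc, h1, zero_mul]
  -- the inverse `t` of `s`, up to a component outside of `e A σ(e)`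
  obtain ⟨t, ht, hts⟩ : ∃ t, e * t = t ∧ t * s = e := by
    obtain ⟨j, hj⟩ : ∃ j, E o j * s ≠ 0 := by
      by_contra hcon
      push Not at hcon
      apply hs0
      rw [← one_mul s, ← hsum, Finset.sum_mul]
      exact Finset.sum_eq_zero fun j _ => by rw [mul_assoc, hcon, mul_zero]
    obtain ⟨z, hz, hzj⟩ := hcor (E o j * s)
    rw [← mul_assoc, heb, mul_assoc, hse] at hzj
    obtain ⟨w, hw, hwz⟩ := hinv z hz (by
      rintro rfl
      exact hj (by rw [hzj, zero_mul]))
    exact ⟨w * E o j * σ e, by rw [← mul_assoc, ← mul_assoc, hw, mul_assoc w e, heb],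
      by rw [mul_assoc, hσes, mul_assoc, hzj, ← mul_assoc, hwz, one_mul]⟩
  have hcs : ∀ z, (∀ y, y * z = z * y) → z * s = 0 → z = 0 := by
    intro z hz hzs
    by_contra hz0
    obtain ⟨w, hw, hwz⟩ := hinv z hz hz0
    exact hs0 (by rw [← one_mul s, ← hwz, mul_assoc, hzs, mul_zero])
  -- `t` may be cut down so that `s t = σ e`
  obtain ⟨t, ht, hts, hst⟩ : ∃ t, e * t = t ∧ t * s = e ∧ s * t = σ e := by
    refine ⟨t * σ e, by rw [← mul_assoc, ht], by rw [mul_assoc, hσes, hts], ?_⟩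
    obtain ⟨z, hz, hzx⟩ := hcor (σ (s * t))
    have h1 : s * (t * σ e) = σ z * σ e := by
      have := congrArg σ hzx
      simp only [apply_mul, apply_apply] at this
      rw [← mul_assoc, ← mul_assoc, hσes] at this
      rw [← mul_assoc, this, commutes_apply hz]
    have h2 : (σ z - 1) * s = 0 := by
      have h3 : s * (t * σ e) * s = s := by rw [mul_assoc, mul_assoc, hσes, hts, hse]
      rw [h1, mul_assoc, hσes] at h3
      rw [sub_mul, one_mul, h3, sub_self]
    have h3 := hcs _ (fun y => by rw [mul_sub, sub_mul, commutes_apply hz, mul_one, one_mul]) h2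
    rw [h1, sub_eq_zero.1 h3, one_mul]
  have htσ : t * σ e = t := by rw [← hst, ← mul_assoc, hts, ht]
  -- `s` and `σ s` differ by a central factor
  obtain ⟨c, hc, hcs'⟩ : ∃ c, (∀ y, y * c = c * y) ∧ σ s = c * s := by
    obtain ⟨z, hz, hzx⟩ := hcor (t * σ s)
    refine ⟨z, hz, ?_⟩
    have h1 : σ s * e = σ s := by rw [← σ.apply_apply e, ← apply_mul, hσes]
    have h2 : σ e * σ s = σ s := by rw [← apply_mul, hse]
    rw [← mul_assoc, ht, mul_assoc, h1] at hzx
    rw [← h2, ← hst, mul_assoc, hzx, ← mul_assoc, hz, mul_assoc, hse]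
  have hσc := commutes_apply (σ := σ) hc
  have hcc : σ c * c = 1 := by
    have h1 := congrArg σ hcs'
    rw [apply_apply, apply_mul, hcs', mul_assoc, hσc, ← mul_assoc] at h1
    have h2 := hcs (c * σ c - 1)
      (fun y => by rw [mul_sub, sub_mul, ← mul_assoc, hc, mul_assoc, hσc, mul_assoc, mul_one,
        one_mul])
      (by rw [sub_mul, one_mul, ← h1, sub_self])
    rw [← sub_eq_zero, ← h2, hc]
  have hσt : σ t = σ c * t := by
    have h1 : t * (σ s * σ t) = t := by rw [← apply_mul, hts, htσ]
    have h2 : e * σ t = σ t := by rw [← σ.apply_apply e, ← apply_mul, htσ]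
    rw [hcs', mul_assoc, ← mul_assoc, hc, mul_assoc, ← mul_assoc t, hts, h2] at h1
    conv_rhs => rw [← h1, ← mul_assoc, hcc, one_mul]
  by_cases h1k : IsFirstKind F A
  · obtain ⟨ε, hε⟩ := h1k c hc
    have hσc' : σ c = ε • 1 := by rw [hε, map_smul, apply_one]
    refine ⟨⟨n, e, fun j => E j o, fun j => E o j, s, t, ε, hee, hae, heb, hsum, hba, hcor, hts,
      hst, ht, hse, by rw [hσt, hσc', smul_one_mul], ?_, fun h => (h h1k).elim⟩⟩
    rw [hσc', hε, smul_mul_smul_comm, mul_one] at hcc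
    have : ε * ε = 1 := smul_left_injective F (one_ne_zero (α := A)) (by simpa using hcc)
    exact mul_self_eq_one_iff.1 this
  · -- scale `s` and `t` by a central element so that they become symmetric
    obtain ⟨z, hz, hz0⟩ : ∃ z, (∀ y, y * z = z * y) ∧ z + σ z * c ≠ 0 := by
      by_contra hcon
      push Not at hcon
      have h1 := hcon 1 (fun y => by rw [mul_one, one_mul])
      rw [apply_one, one_mul] at h1
      apply h1k
      intro x hx
      apply hσ.exists_eq_smul_one hx
      have h2 := hcon x hx
      rw [eq_neg_of_add_eq_zero_right h1, mul_neg, mul_one, ← sub_eq_add_neg, sub_eq_zero] at h2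
      exact h2.symm
    have hσz := commutes_apply (σ := σ) hz
    have hωc : ∀ y, y * (z + σ z * c) = (z + σ z * c) * y := fun y => by
      rw [mul_add, add_mul, hz, ← mul_assoc, hσz, mul_assoc, hc, mul_assoc]
    obtain ⟨w, hw, hwω⟩ := hinv _ hωc hz0
    have hσω : σ (z + σ z * c) * c = z + σ z * c := by
      rw [map_add, apply_mul, apply_apply, add_mul, hz, mul_assoc, hcc, mul_one, add_comm]
    have hσw : σ w * σ c = w := by
      have h3 : σ w * σ (z + σ z * c) = 1 := by rw [← apply_mul, hw, hwω, apply_one]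
      have h4 : σ (z + σ z * c) = (z + σ z * c) * σ c := by
        conv_rhs => rw [← hσω, mul_assoc, hσc, hcc, mul_one]
      rw [h4, ← hωc, ← mul_assoc, hωc] at h3
      have h5 := congrArg (w * ·) h3
      simp only [mul_one] at h5
      rwa [← mul_assoc, hwω, one_mul] at h5
    have hω1 : (z + σ z * c) * w = 1 := by rw [hw, hwω]
    refine ⟨⟨n, e, fun j => E j o, fun j => E o j, (z + σ z * c) * s, w * t, 1, hee, hae, heb, hsum,
      hba, hcor, ?_, ?_, ?_, ?_, ?_, Or.inl rfl, fun _ => rfl⟩⟩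
    · rw [mul_assoc, ← mul_assoc t, hωc, mul_assoc, hts, ← mul_assoc, hwω, one_mul]
    · rw [mul_assoc, ← mul_assoc s, hw, mul_assoc, hst, ← mul_assoc, hω1, one_mul]
    · rw [← mul_assoc, hw, mul_assoc, ht]
    · rw [mul_assoc, hse]
    · rw [apply_mul, hσt, one_smul, commutes_apply hw, ← mul_assoc, hσw]

/-- If the center is not a field, then `E i j + σ (E j i)` are matrix units for the whole algebra,
and the form is given by `s = t = e` and `ε = 1`. -/
theorem IsSplitBy.exists_frame {n : ℕ}
    {E : Fin n → Fin n → A} {f : A} (h : IsSplitBy f n E) (hf : ∀ a, a * f = f * a)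
    (hff : f * f = f) (h0 : f ≠ 0) (hσf : σ f = 1 - f) :
    Nonempty (Frame σ) := by
  have hn : n ≠ 0 := by
    rintro rfl
    have := h.sum_eq
    simp at this
    exact h0 this.symm
  let o : Fin n := ⟨0, Nat.pos_of_ne_zero hn⟩
  have hfE : ∀ i j, f * E i j = E i j := fun i j => by
    rw [← h.sum_eq, Finset.sum_mul]
    simp [h.mul_eq]
  have hff' : f * (1 - f) = 0 := by rw [mul_sub, mul_one, hff, sub_self]
  have hσE : ∀ i j, (1 - f) * σ (E i j) = σ (E i j) := fun i j => by
    rw [← hσf, ← apply_mul, hf, hfE]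
  have hf1 : ∀ a, a * (1 - f) = (1 - f) * a := fun a => by
    rw [mul_sub, sub_mul, hf, mul_one, one_mul]
  have hEσ : ∀ i j k l (x : A), E i j * x * σ (E k l) = 0 := fun i j k l x => by
    rw [← hfE i j, ← hσE k l, ← mul_assoc, hf1, mul_assoc f, ← mul_assoc (1 - f), ← hf1, hff',
      zero_mul, zero_mul]
  have hσE' : ∀ i j k l (x : A), σ (E i j) * x * E k l = 0 := fun i j k l x => by
    rw [← hfE k l, ← hσE i j, ← mul_assoc, hf, mul_assoc (1 - f), ← mul_assoc f, hff',
      zero_mul, zero_mul]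
  have hmul : ∀ i j k l i' j' k' l', (E i j + σ (E k l)) * (E i' j' + σ (E k' l')) =
      E i j * E i' j' + σ (E k' l' * E k l) := fun i j k l i' j' k' l' => by
    have h1 := hEσ i j k' l' 1
    have h2 := hσE' k l i' j' 1
    rw [mul_one] at h1 h2
    rw [add_mul, mul_add, mul_add, h1, h2, add_zero, zero_add, apply_mul]
  have hcor : ∀ x, ∃ c, (∀ y, y * c = c * y) ∧
      (E o o + σ (E o o)) * x * (E o o + σ (E o o)) = c * (E o o + σ (E o o)) := by
    intro x
    obtain ⟨z, hz, hzx⟩ := h.corner o x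
    obtain ⟨w, hw, hwx⟩ := h.corner o (σ x)
    have hσw := commutes_apply (σ := σ) hw
    refine ⟨z * f + σ w * (1 - f), fun y => ?_, ?_⟩
    · rw [mul_add, add_mul, ← mul_assoc, hz, mul_assoc, hf, ← mul_assoc, ← mul_assoc, hσw,
        mul_assoc _ y, hf1, ← mul_assoc]
    · have h3 : σ (E o o) * x * σ (E o o) = σ w * σ (E o o) := by
        have := congrArg σ hwx
        simp only [apply_mul, apply_apply] at this
        rw [← mul_assoc] at this
        rw [this, hσw]
      have h4 : f * σ (E o o) = 0 := by
        rw [← hσE, ← mul_assoc, hff', zero_mul]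
      have h5 : (1 - f) * E o o = 0 := by
        rw [← hfE, ← mul_assoc, ← hf1, hff', zero_mul]
      rw [add_mul, add_mul, mul_add, mul_add, hzx, hEσ, hσE', h3, add_zero, zero_add, add_mul,
        mul_add, mul_add, mul_assoc z, mul_assoc z, hfE, h4, mul_assoc (σ w), mul_assoc (σ w), h5,
        hσE, mul_zero, mul_zero, add_zero, zero_add]
  have hee : (E o o + σ (E o o)) * (E o o + σ (E o o)) = E o o + σ (E o o) := by
    rw [hmul, h.mul_eq, if_pos rfl]
  have hσe : σ (E o o + σ (E o o)) = E o o + σ (E o o) := by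
    rw [map_add, apply_apply, add_comm]
  refine ⟨⟨n, E o o + σ (E o o), fun j => E j o + σ (E o j), fun j => E o j + σ (E j o),
    E o o + σ (E o o), E o o + σ (E o o), 1, hee, fun j => ?_, fun j => ?_, ?_, fun i j => ?_,
    hcor, hee, hee.trans hσe.symm, hee, hee, by rw [hσe, one_smul], Or.inl rfl, fun _ => rfl⟩⟩
  · rw [hmul, h.mul_eq, if_pos rfl, h.mul_eq, if_pos rfl]
  · rw [hmul, h.mul_eq, if_pos rfl, h.mul_eq, if_pos rfl]
  · simp only [hmul, h.mul_eq, if_true, Finset.sum_add_distrib, ← map_sum, h.sum_eq, hσf]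
    abel
  · rw [hmul, h.mul_eq, h.mul_eq]
    by_cases hij : i = j
    · subst hij
      simp
    · rw [if_neg hij, if_neg (Ne.symm hij), map_zero, add_zero, if_neg hij]

theorem IsUnitSplit.exists_frame (hσ : σ.IsAlgebraWithInvolution) (h : σ.IsUnitSplit) :
    Nonempty (Frame σ) := by
  rcases h with ⟨hZ, n, E, hE⟩ | ⟨f, hf, hff, h0, -, hσf, n, E, hE⟩
  · exact hE.exists_frame_of_isField hσ hZ
  · exact hE.exists_frame hf hff h0 hσf

end FInvolution

/-! ### Ranks, the hermitian form, and separability idempotents -/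

namespace FInvolution

variable {F : Type u} {A : Type v} [Field F] [Ring A] [Algebra F A]

/-- Additivity of the dimension of `p A q` in the idempotent `p`. -/
theorem finrank_peirce_sum [FiniteDimensional F A] {ι : Type*} [Fintype ι] [DecidableEq ι]
    {p : ι → A} (hp : ∀ i j, p i * p j = if i = j then p i else 0) (q : A) :
    Module.finrank F (LinearMap.range (peirce F (∑ i, p i) q)) =
      ∑ i, Module.finrank F (LinearMap.range (peirce F (p i) q)) := by
  have hps : ∀ i, p i * ∑ j, p j = p i := fun i => by simp [Finset.mul_sum, hp]
  have hsp : ∀ i, (∑ j, p j) * p i = p i := fun i => by simp [Finset.sum_mul, hp]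
  rw [← Module.finrank_pi_fintype]
  refine LinearEquiv.finrank_eq (LinearEquiv.ofBijective
    (LinearMap.pi fun i => ((LinearMap.mulLeft F (p i)) ∘ₗ
      (LinearMap.range (peirce F (∑ i, p i) q)).subtype).codRestrict _ ?_) ⟨?_, ?_⟩)
  · rintro ⟨_, x, rfl⟩
    exact ⟨x, by simp [← mul_assoc, hps]⟩
  · rw [injective_iff_map_eq_zero]
    rintro ⟨_, x, rfl⟩ h
    apply Subtype.ext
    have h1 : ∀ i, p i * ((∑ i, p i) * x * q) = 0 := fun i => by
      simpa using congrArg Subtype.val (congrFun h i)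
    simp only [← mul_assoc, hps] at h1
    change peirce F _ _ x = 0
    rw [peirce_apply, Finset.sum_mul, Finset.sum_mul]
    exact Finset.sum_eq_zero fun i _ => h1 i
  · intro y
    choose x hx using fun i => (y i).2
    refine ⟨⟨∑ i, p i * x i * q, ∑ i, p i * x i, ?_⟩, ?_⟩
    · rw [peirce_apply, Finset.mul_sum, Finset.sum_mul]
      simp only [← mul_assoc, hsp]
    · funext i
      apply Subtype.ext
      have h2 : p i * ∑ j, p j * x j * q = p i * x i * q := by
        rw [Finset.mul_sum, Finset.sum_eq_single i]
        · simp [← mul_assoc, hp]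
        · intro j _ hj
          rw [← mul_assoc, ← mul_assoc, hp, if_neg hj.symm, zero_mul, zero_mul]
        · simp
      exact h2.trans ((peirce_apply _ _ _).symm.trans (hx i))

namespace Frame

variable {σ : FInvolution F A} (B : Frame σ)

/-- The dimension over `F` of `p V`, where `V = A e`. -/
noncomputable def rank (p : A) : ℕ := Module.finrank F (LinearMap.range (peirce F p B.e))

/-- The right ideal `p A` is the sum of `n` copies of `p V`. -/
theorem finrank_peirce_one [FiniteDimensional F A] (p : A) :
    Module.finrank F (LinearMap.range (peirce F p 1)) = B.n * B.rank p := by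
  let f : LinearMap.range (peirce F p 1) →ₗ[F] Fin B.n → LinearMap.range (peirce F p B.e) :=
    LinearMap.pi fun j => ((LinearMap.mulRight F (B.a j)) ∘ₗ
      (LinearMap.range (peirce F p 1)).subtype).codRestrict _ (by
        rintro ⟨_, x, rfl⟩
        exact ⟨x * B.a j, by simp [mul_assoc, B.ae]⟩)
  have hf : ∀ x j, (f x j).1 = x.1 * B.a j := fun x j => rfl
  have hbij : Function.Bijective f := by
    constructor
    · rw [injective_iff_map_eq_zero]
      intro x hx
      apply Subtype.ext
      have h1 : x.1 = ∑ j, x.1 * B.a j * B.b j := by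
        simp only [mul_assoc]
        rw [← Finset.mul_sum]
        exact ((congrArg _ B.sum_ab).trans (mul_one _)).symm
      refine h1.trans (Finset.sum_eq_zero fun j _ => ?_)
      rw [← hf, hx]
      exact zero_mul _
    · intro y
      choose x hx using fun i => (y i).2
      refine ⟨⟨∑ i, p * x i * B.e * B.b i, ∑ i, x i * B.e * B.b i, ?_⟩, ?_⟩
      · rw [peirce_apply, mul_one, Finset.mul_sum]
        simp only [← mul_assoc]
      · funext j
        apply Subtype.ext
        refine (hf _ _).trans ((?_ : _ = p * x j * B.e).trans
          ((peirce_apply _ _ _).symm.trans (hx j)))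
        change (∑ i, p * x i * B.e * B.b i) * B.a j = _
        rw [Finset.sum_mul, Finset.sum_eq_single j]
        · rw [mul_assoc _ (B.b j), B.ba, if_pos rfl, mul_assoc, B.ee]
        · intro i _ hi
          rw [mul_assoc _ (B.b i), B.ba, if_neg hi, mul_zero]
        · simp
  rw [(LinearEquiv.ofBijective f hbij).finrank_eq, Module.finrank_pi_fintype]
  simp [rank]

theorem eq_zero_of_mul_e {z : A} (hz : ∀ y, y * z = z * y) (h : z * B.e = 0) : z = 0 := by
  rw [← one_mul z, ← B.sum_ab, Finset.sum_mul]
  refine Finset.sum_eq_zero fun j _ => ?_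
  rw [← B.ae, mul_assoc, mul_assoc, hz, ← mul_assoc B.e, hz, h, zero_mul, mul_zero]

theorem eq_zero_of_rank [FiniteDimensional F A] {p : A} (h : B.rank p = 0) : p = 0 := by
  rw [rank, Submodule.finrank_eq_zero] at h
  rw [← mul_one p, ← B.sum_ab, Finset.mul_sum]
  refine Finset.sum_eq_zero fun j _ => ?_
  have : peirce F p B.e (B.a j) = 0 := by
    rw [← Submodule.mem_bot F, ← h]
    exact ⟨_, rfl⟩
  rw [peirce_apply, mul_assoc, B.ae] at this
  rw [← mul_assoc, this, zero_mul]

theorem rank_one [FiniteDimensional F A] :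
    B.rank 1 = B.n * Module.finrank F (Subalgebra.center F A) := by
  let f : (Fin B.n → Subalgebra.center F A) →ₗ[F] A :=
    ∑ j, (LinearMap.mulLeft F (B.a j)) ∘ₗ (Subalgebra.toSubmodule
      (Subalgebra.center F A)).subtype ∘ₗ LinearMap.proj j
  have hf : ∀ z, f z = ∑ j, B.a j * (z j).1 := fun z => by
    simp only [f, LinearMap.sum_apply]
    rfl
  have hfi : Function.Injective f := by
    rw [injective_iff_map_eq_zero]
    intro z hz
    funext i
    apply Subtype.ext
    have hzc := Subalgebra.mem_center_iff.1 (z i).2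
    apply B.eq_zero_of_mul_e hzc
    have h1 := congrArg (B.b i * ·) hz
    simp only [hf, Finset.mul_sum, mul_zero, ← mul_assoc, B.ba] at h1
    simpa [← hzc] using h1
  have hr : LinearMap.range f = LinearMap.range (peirce F 1 B.e) := by
    ext x
    constructor
    · rintro ⟨z, rfl⟩
      refine ⟨f z, ?_⟩
      rw [peirce_apply, one_mul, hf, Finset.sum_mul]
      refine Finset.sum_congr rfl fun j _ => ?_
      rw [mul_assoc, ← Subalgebra.mem_center_iff.1 (z j).2, ← mul_assoc, B.ae]
    · rintro ⟨y, rfl⟩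
      choose z hz hzy using fun j => B.corner (B.b j * y)
      refine ⟨fun j => ⟨z j, Subalgebra.mem_center_iff.2 (hz j)⟩, ?_⟩
      rw [hf, peirce_apply, one_mul, ← one_mul (y * B.e), ← B.sum_ab, Finset.sum_mul]
      refine Finset.sum_congr rfl fun j _ => ?_
      rw [mul_assoc, ← mul_assoc (B.b j), ← B.eb j, mul_assoc B.e, hzy, ← hz, ← mul_assoc, B.ae]
  rw [rank, ← hr, LinearMap.finrank_range_of_inj hfi, Module.finrank_pi_fintype]
  simp

theorem finrank_eq [FiniteDimensional F A] : Module.finrank F A =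
    B.n * (B.n * Module.finrank F (Subalgebra.center F A)) := by
  have h := B.finrank_peirce_one 1
  have h1 : peirce F (1 : A) 1 = LinearMap.id := by ext; simp
  rw [h1, LinearMap.range_id, finrank_top, B.rank_one] at h
  exact h

/-- Elements of `A` acting as zero on `V = A e` vanish. -/
theorem ext_mul {c d : A} (h : ∀ x, x * B.e = x → c * x = d * x) : c = d := by
  rw [← mul_one c, ← mul_one d, ← B.sum_ab, Finset.mul_sum, Finset.mul_sum]
  exact Finset.sum_congr rfl fun j _ => by rw [← mul_assoc, ← mul_assoc, h _ (B.ae j)]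

/-- The hermitian form `h` on `V = A e`, with values in the center; it is characterized by
`h(w, x) e = t σ(w) x`. -/
noncomputable def form (w x : A) : A := ∑ j, B.a j * (B.t * σ w * x) * B.b j

/-- The values of the form lie in the center, and `h(w, x) e = t σ(w) x`. -/
theorem form_spec (w : A) {x : A} (hx : x * B.e = x) :
    (∀ y, y * B.form w x = B.form w x * y) ∧ B.form w x * B.e = B.t * σ w * x := by
  obtain ⟨z, hz, hzx⟩ := B.corner (B.t * σ w * x)
  rw [← mul_assoc, ← mul_assoc, B.et, mul_assoc _ x, hx] at hzx
  have : B.form w x = z := by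
    rw [form, ← mul_one z, ← B.sum_ab, Finset.mul_sum]
    refine Finset.sum_congr rfl fun j _ => ?_
    rw [hzx, ← hz, ← mul_assoc, B.ae, hz, mul_assoc]
  rw [this]
  exact ⟨hz, hzx.symm⟩

theorem mul_form (w : A) {v x : A} (hv : v * B.e = v) (hx : x * B.e = x) :
    v * (B.t * σ w * x) = B.form w x * v := by
  rw [← (B.form_spec w hx).2, ← mul_assoc, (B.form_spec w hx).1, mul_assoc, hv]

theorem form_add_right (w x y : A) : B.form w (x + y) = B.form w x + B.form w y := by
  simp [form, mul_add, add_mul, Finset.sum_add_distrib]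

theorem form_smul_right (c : F) (w x : A) : B.form w (c • x) = c • B.form w x := by
  simp [form, Finset.smul_sum]

theorem form_add_left (w x y : A) : B.form (w + x) y = B.form w y + B.form x y := by
  simp [form, mul_add, add_mul, Finset.sum_add_distrib]

theorem form_mul_left (c w x : A) : B.form (c * w) x = B.form w (σ c * x) := by
  simp [form, mul_assoc]

theorem form_central_right {z : A} (hz : ∀ y, y * z = z * y) (w x : A) :
    B.form w (z * x) = z * B.form w x := by
  rw [form, form, Finset.mul_sum]
  refine Finset.sum_congr rfl fun j _ => ?_
  rw [← mul_assoc _ z, hz (B.t * σ w), mul_assoc z, ← mul_assoc _ z, hz (B.a j), mul_assoc z,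
    mul_assoc z]

/-- The form is `ε`-hermitian. -/
theorem apply_form {w x : A} (hw : w * B.e = w) (hx : x * B.e = x) :
    σ (B.form w x) = B.ε • B.form x w := by
  obtain ⟨hc, h⟩ := B.form_spec w hx
  obtain ⟨hc', h'⟩ := B.form_spec x hw
  have hσc := commutes_apply (σ := σ) hc
  have h1 : B.form w x * B.t = B.t * σ w * x * B.t := by rw [← h, mul_assoc, B.et]
  have h2 := congrArg σ h1
  simp only [apply_mul, apply_apply, B.apply_t] at h2
  have hεε : B.ε * B.ε = 1 := by rcases B.ε_eq with h | h <;> rw [h] <;> simp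
  have h3 : B.ε • (σ (B.form w x) * B.t) = B.form x w * B.t := by
    have h6 : B.form x w * B.t = B.t * σ x * w * B.t := by rw [← h', mul_assoc, B.et]
    rw [h6, ← hσc, ← smul_mul_assoc, h2]
    simp only [smul_mul_assoc, mul_smul_comm, smul_smul, hεε, one_smul, mul_assoc]
  have h4 := congrArg (· * B.s) h3
  simp only [smul_mul_assoc, mul_assoc, B.ts] at h4
  have h5 : σ (B.form w x) - B.ε • B.form x w = 0 := by
    refine B.eq_zero_of_mul_e (fun y => ?_) ?_
    · rw [mul_sub, sub_mul, hσc, mul_smul_comm, hc', smul_mul_assoc]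
    · rw [sub_mul, smul_mul_assoc, ← h4, smul_smul, hεε, one_smul, sub_self]
  exact sub_eq_zero.1 h5

/-- The form is nondegenerate. -/
theorem eq_zero_of_form {w : A} (hw : w * B.e = w)
    (h : ∀ x, x * B.e = x → B.form w x = 0) : w = 0 := by
  have h1 : ∀ x, x * B.e = x → B.t * σ w * x = 0 := fun x hx => by
    rw [← (B.form_spec w hx).2, h x hx, zero_mul]
  have h2 : B.t * σ w = 0 := B.ext_mul fun x hx => by rw [h1 x hx, zero_mul]
  apply σ.apply_injective
  rw [map_zero, ← hw, apply_mul, ← B.st, mul_assoc, h2, mul_zero]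

end Frame

/-- A commutative subalgebra `K` of symmetric elements, with a separability idempotent `∑ uᵢ ⊗ vᵢ`
whose first components `uᵢ` are linearly independent. The identities for the separability
idempotent are phrased in terms of bilinear maps. -/
structure SymSep (σ : FInvolution F A) (K : Subalgebra F A) where
  comm : ∀ x ∈ K, ∀ y ∈ K, x * y = y * x
  symm : ∀ x ∈ K, σ x = x
  N : ℕ
  u : Fin N → A
  v : Fin N → A
  u_mem : ∀ i, u i ∈ K
  v_mem : ∀ i, v i ∈ K
  sum_uv : ∑ i, u i * v i = 1
  transport : ∀ (φ : A →ₗ[F] A →ₗ[F] A), ∀ k ∈ K, ∑ i, φ (k * u i) (v i) = ∑ i, φ (u i) (k * v i)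
  swap : ∀ (φ : A →ₗ[F] A →ₗ[F] A), ∑ i, φ (u i) (v i) = ∑ i, φ (v i) (u i)
  dual : Fin N → A →ₗ[F] F
  dual_u : ∀ i j, dual i (u j) = if i = j then 1 else 0

open TensorProduct in
/-- The separability idempotent of an étale algebra is unchanged when its two components are
swapped, because a tensor multiplied by it only depends on the product of the components. -/
theorem exists_symSep [FiniteDimensional F A] {σ : FInvolution F A} {K : Subalgebra F A}
    (hc : ∀ x ∈ K, ∀ y ∈ K, x * y = y * x) (hs : ∀ x ∈ K, σ x = x) (he : IsEtaleAlgebra F K) :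
    Nonempty (SymSep σ K) := by
  let inst : CommRing K := { (inferInstance : Ring K) with
    mul_comm := fun x y => Subtype.ext (hc x.1 x.2 y.1 y.2) }
  have het : Algebra.Etale F K := (isEtaleAlgebra_iff_etale F K).1 he
  let b := Module.finBasis F K
  let r := TensorProduct.equivFinsuppOfBasisLeft (N := K) b
  obtain ⟨θ, hθ⟩ : ∃ θ, θ = Algebra.FormallyUnramified.elem F K := ⟨_, rfl⟩
  have h1 : ∀ k : K, (1 ⊗ₜ k) * θ = (k ⊗ₜ 1) * θ := fun k => by
    rw [hθ]; exact Algebra.FormallyUnramified.one_tmul_mul_elem k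
  have h2 : Algebra.TensorProduct.lmul' F θ = 1 := by
    rw [hθ]; exact Algebra.FormallyUnramified.lmul_elem
  have h3 : θ = ∑ i, b i ⊗ₜ r θ i := by
    conv_lhs => rw [← r.symm_apply_apply θ]
    simp only [r]
    rw [TensorProduct.equivFinsuppOfBasisLeft_symm_apply, Finsupp.sum_fintype _ _ (by simp)]
  -- a tensor multiplied by `θ` only depends on its product
  have h4 : ∀ x, x * θ = (Algebra.TensorProduct.lmul' F x ⊗ₜ 1) * θ := by
    intro x
    induction x with
    | zero => simp
    | add x y hx hy => rw [add_mul, hx, hy, map_add, TensorProduct.add_tmul, add_mul]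
    | tmul x y =>
      rw [Algebra.TensorProduct.lmul'_apply_tmul, ← mul_one (x ⊗ₜ y),
        show (x ⊗ₜ[F] y) * 1 = (x ⊗ₜ 1) * (1 ⊗ₜ y) by simp, mul_assoc, h1, ← mul_assoc]
      simp
  have h5 : Algebra.TensorProduct.comm F K K θ = θ := by
    have h6 : Algebra.TensorProduct.lmul' F (Algebra.TensorProduct.comm F K K θ) = 1 := by
      rw [← h2]
      generalize θ = x
      induction x with
      | zero => simp
      | add x y hx hy => simp only [map_add, hx, hy]
      | tmul x y => simp [mul_comm]
    have h7 : Algebra.TensorProduct.comm F K K θ * θ = θ := by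
      rw [h4, h6, ← Algebra.TensorProduct.one_def, one_mul]
    have h8 := congrArg (Algebra.TensorProduct.comm F K K) h7
    rw [map_mul, show Algebra.TensorProduct.comm F K K (Algebra.TensorProduct.comm F K K θ) = θ
      from (Algebra.TensorProduct.comm F K K).symm_apply_apply θ, mul_comm, h7] at h8
    exact h8.symm
  choose d hd using fun i => (b.coord i).exists_extend (p := Subalgebra.toSubmodule K)
  let m (φ : A →ₗ[F] A →ₗ[F] A) : K ⊗[F] K →ₗ[F] A := TensorProduct.lift
    (φ.compl₁₂ (Subalgebra.toSubmodule K).subtype (Subalgebra.toSubmodule K).subtype)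
  have hm : ∀ φ x y, m φ (x ⊗ₜ y) = φ x.1 y.1 := fun φ x y => rfl
  refine ⟨⟨hc, hs, _, fun i => (b i).1, fun i => (r θ i).1, fun i => (b i).2,
    fun i => (r θ i).2, ?_, ?_, ?_, d, ?_⟩⟩
  · rw [h3] at h2
    have := congrArg Subtype.val h2
    simpa using this
  · intro φ k hk
    have := congrArg (m φ) (h1 ⟨k, hk⟩)
    rw [h3] at this
    simp only [Finset.mul_sum, Algebra.TensorProduct.tmul_mul_tmul, one_mul, map_sum, hm] at this
    exact this.symm
  · intro φ
    have := congrArg (m φ) h5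
    rw [h3] at this
    simp only [map_sum, Algebra.TensorProduct.comm_tmul, hm] at this
    exact this.symm
  · intro i j
    have := LinearMap.congr_fun (hd i) (b j)
    refine this.trans ?_
    rw [b.coord_apply, b.repr_self, Finsupp.single_apply]
    simp only [eq_comm]

end FInvolution

/-! ### The hermitian form over an étale subalgebra -/

namespace FInvolution

variable {F : Type u} {A : Type v} [Field F] [Ring A] [Algebra F A]

namespace SymSep

variable {σ : FInvolution F A} {K : Subalgebra F A} (S : SymSep σ K)

/-- The projection `a ↦ ∑ uᵢ a vᵢ` of `A` onto the centralizer of `K`. -/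
noncomputable def proj : A →ₗ[F] A :=
  ∑ i, LinearMap.mulLeft F (S.u i) ∘ₗ LinearMap.mulRight F (S.v i)

theorem proj_apply (a : A) : S.proj a = ∑ i, S.u i * a * S.v i := by
  simp [proj, LinearMap.sum_apply, mul_assoc]

theorem proj_comm (a : A) {k : A} (hk : k ∈ K) : k * S.proj a = S.proj a * k := by
  have h := S.transport (LinearMap.compl₂ (LinearMap.mul F A) (LinearMap.mulLeft F a)) k hk
  simp only [LinearMap.compl₂_apply, LinearMap.mul_apply', LinearMap.mulLeft_apply] at h
  rw [proj_apply, Finset.mul_sum, Finset.sum_mul]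
  simp only [mul_assoc] at h ⊢
  rw [h]
  exact Finset.sum_congr rfl fun i _ => by rw [S.comm _ hk _ (S.v_mem i)]

theorem proj_mul_left {c : A} (hc : ∀ k ∈ K, k * c = c * k) (a : A) :
    S.proj (c * a) = c * S.proj a := by
  rw [proj_apply, proj_apply, Finset.mul_sum]
  exact Finset.sum_congr rfl fun i _ => by
    rw [← mul_assoc, hc _ (S.u_mem i), mul_assoc, mul_assoc, mul_assoc]

theorem proj_mul_right {c : A} (hc : ∀ k ∈ K, k * c = c * k) (a : A) :
    S.proj (a * c) = S.proj a * c := by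
  rw [proj_apply, proj_apply, Finset.sum_mul]
  exact Finset.sum_congr rfl fun i _ => by
    rw [mul_assoc, mul_assoc, ← hc _ (S.v_mem i), mul_assoc, mul_assoc]

theorem proj_one : S.proj 1 = 1 := by
  simp [proj_apply, S.sum_uv]

theorem apply_proj (a : A) : σ (S.proj a) = S.proj (σ a) := by
  have h := S.swap (LinearMap.compl₂ (LinearMap.mul F A) (LinearMap.mulLeft F (σ a)))
  simp only [LinearMap.compl₂_apply, LinearMap.mul_apply', LinearMap.mulLeft_apply] at h
  rw [proj_apply, proj_apply, map_sum]
  simp only [mul_assoc, apply_mul, S.symm _ (S.u_mem _), S.symm _ (S.v_mem _)] at h ⊢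
  exact h.symm

theorem comm_apply (S : SymSep σ K) {c : A} (hc : ∀ k ∈ K, k * c = c * k) :
    ∀ k ∈ K, k * σ c = σ c * k := fun k hk => by
  have := congrArg σ (hc k hk)
  rw [apply_mul, apply_mul, S.symm k hk] at this
  exact this.symm

/-- A linear relation over the center between elements of `K` holds coordinate by coordinate. -/
theorem sum_eq_zero_of_center (S : SymSep σ K) (hσ : σ.IsAlgebraWithInvolution) {ι : Type*}
    [Fintype ι]
    {z k : ι → A} (hz : ∀ i y, y * z i = z i * y) (hk : ∀ i, k i ∈ K) (h : ∑ i, z i * k i = 0)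
    (l : A →ₗ[F] F) : ∑ i, l (k i) • z i = 0 := by
  by_cases h1 : IsFirstKind F A
  · choose c hc using fun i => h1 (z i) (hz i)
    simp only [hc, smul_mul_assoc, one_mul] at h
    simp only [hc, smul_smul, ← Finset.sum_smul]
    have := congrArg l h
    simp only [map_sum, map_smul, smul_eq_mul, map_zero] at this
    rw [Finset.sum_congr rfl fun i _ => mul_comm (l (k i)) (c i), this, zero_smul]
  · obtain ⟨y, hy, ⟨c, hc, hyc⟩, hspan⟩ := hσ.exists_center_generator h1
    choose α β hαβ using fun i => hspan (z i) (hz i)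
    have h2 : ∑ i, α i • k i + y * ∑ i, β i • k i = 0 := by
      rw [← h, Finset.mul_sum, ← Finset.sum_add_distrib]
      exact Finset.sum_congr rfl fun i _ => by rw [hαβ, add_mul]; simp
    have hs : ∀ γ : ι → F, σ (∑ i, γ i • k i) = ∑ i, γ i • k i := fun γ => by
      simp [map_sum, S.symm _ (hk _)]
    have h3 := congrArg σ h2
    rw [map_add, apply_mul, hs, hs, map_zero, commutes_apply hy] at h3
    have h4 : (y - σ y) * ∑ i, β i • k i = 0 := by
      rw [sub_mul, ← add_sub_add_left_eq_sub _ _ (∑ i, α i • k i), h2, h3, sub_zero]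
    have h5 : ∑ i, β i • k i = 0 := by
      have h6 : (y - σ y) * ((y - σ y) * ∑ i, β i • k i) = 0 := by rw [h4, mul_zero]
      rw [← mul_assoc, hyc, smul_one_mul] at h6
      exact (smul_eq_zero.1 h6).resolve_left hc
    rw [h5, mul_zero, add_zero] at h2
    have h6 := congrArg l h2
    have h7 := congrArg l h5
    simp only [map_sum, map_smul, smul_eq_mul, map_zero] at h6 h7
    simp only [hαβ, smul_add, smul_smul, Finset.sum_add_distrib, ← Finset.sum_smul]
    rw [Finset.sum_congr rfl fun i _ => mul_comm (l (k i)) (α i), h6,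
      Finset.sum_congr rfl fun i _ => mul_comm (l (k i)) (β i), h7]
    simp

variable (B : Frame σ)

/-- The hermitian form on `V = A e` over the algebra generated by `K` and the center that has
the form of the frame as its trace. -/
noncomputable def form (w x : A) : A := ∑ i, B.form w (S.u i * x) * S.v i

theorem form_add_right (w x y : A) : S.form B w (x + y) = S.form B w x + S.form B w y := by
  simp [form, mul_add, B.form_add_right, add_mul, Finset.sum_add_distrib]

theorem form_add_left (w x y : A) : S.form B (w + x) y = S.form B w y + S.form B x y := by
  simp [form, B.form_add_left, add_mul, Finset.sum_add_distrib]

theorem form_zero_right (w : A) : S.form B w 0 = 0 := by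
  simpa using S.form_add_right B w 0 0

theorem form_sub_right (w x y : A) : S.form B w (x - y) = S.form B w x - S.form B w y := by
  rw [eq_sub_iff_add_eq, ← form_add_right, sub_add_cancel]

theorem form_sub_left (w x y : A) : S.form B (w - x) y = S.form B w y - S.form B x y := by
  rw [eq_sub_iff_add_eq, ← form_add_left, sub_add_cancel]

/-- The map `y ↦ h(w, y x)`. -/
noncomputable def formMap (w x : A) : A →ₗ[F] A where
  toFun y := B.form w (y * x)
  map_add' y y' := by rw [add_mul, B.form_add_right]
  map_smul' c y := by rw [smul_mul_assoc, B.form_smul_right]; rfl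

theorem formMap_apply (w x y : A) : formMap B w x y = B.form w (y * x) := rfl

theorem form_mem_right (w x : A) {k : A} (hk : k ∈ K) :
    S.form B w (k * x) = S.form B w x * k := by
  have h := S.transport (LinearMap.mul F A ∘ₗ formMap B w x) k hk
  simp only [LinearMap.comp_apply, LinearMap.mul_apply', formMap_apply] at h
  rw [form, form, Finset.sum_mul]
  calc _ = ∑ i, B.form w (k * S.u i * x) * S.v i := Finset.sum_congr rfl fun i _ => by
          rw [← mul_assoc, S.comm _ hk _ (S.u_mem i)]
    _ = _ := h
    _ = _ := Finset.sum_congr rfl fun i _ => by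
          rw [S.comm _ hk _ (S.v_mem i), mul_assoc]

theorem form_comm (w : A) {x : A} (hx : x * B.e = x) {c : A} (hc : ∀ k ∈ K, k * c = c * k) :
    c * S.form B w x = S.form B w x * c := by
  rw [form, Finset.mul_sum, Finset.sum_mul]
  refine Finset.sum_congr rfl fun i _ => ?_
  rw [← mul_assoc, (B.form_spec w (by rw [mul_assoc, hx])).1, mul_assoc, mul_assoc,
    hc _ (S.v_mem i)]

theorem form_mul_left (w x : A) {c : A} (hc : ∀ k ∈ K, k * c = c * k) :
    S.form B (c * w) x = S.form B w (σ c * x) := by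
  rw [form, form]
  refine Finset.sum_congr rfl fun i _ => ?_
  rw [B.form_mul_left, ← mul_assoc, ← S.comm_apply hc _ (S.u_mem i), mul_assoc]

theorem form_central_right {z : A} (hz : ∀ y, y * z = z * y) (w x : A) :
    S.form B w (z * x) = z * S.form B w x := by
  rw [form, form, Finset.mul_sum]
  refine Finset.sum_congr rfl fun i _ => ?_
  rw [← mul_assoc, hz, mul_assoc, B.form_central_right hz, mul_assoc]

theorem apply_form {w x : A} (hw : w * B.e = w) (hx : x * B.e = x) :
    σ (S.form B w x) = B.ε • S.form B x w := by
  rw [form, form, map_sum, Finset.smul_sum]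
  refine Finset.sum_congr rfl fun i _ => ?_
  rw [apply_mul, B.apply_form hw (by rw [mul_assoc, hx]), S.symm _ (S.v_mem i), B.form_mul_left,
    S.symm _ (S.u_mem i), mul_smul_comm, (B.form_spec x (by rw [mul_assoc, hw])).1]

/-- The operator of rank one over `K` given by `v` and `w`: it is the projection onto the
centralizer of `K` of the operator `x ↦ h(w, x) v`. -/
noncomputable def op (v w : A) : A := S.proj (v * B.t * σ w)

theorem op_comm (v w : A) {k : A} (hk : k ∈ K) : k * S.op B v w = S.op B v w * k :=
  S.proj_comm _ hk

/-- The operator `op v w` acts on `V` as `x ↦ H(w, x) v`, where `H` is the form over `K`. -/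
theorem op_apply {v : A} (hv : v * B.e = v) (w : A) {x : A} (hx : x * B.e = x) :
    S.op B v w * x = S.form B w x * v := by
  have h := S.swap (LinearMap.mul F A ∘ₗ formMap B w x)
  simp only [LinearMap.comp_apply, LinearMap.mul_apply', formMap_apply] at h
  rw [op, proj_apply, form, h, Finset.sum_mul, Finset.sum_mul]
  refine Finset.sum_congr rfl fun i _ => ?_
  have hx' : S.v i * x * B.e = S.v i * x := by rw [mul_assoc, hx]
  have h1 := B.mul_form w hv hx'
  rw [← (B.form_spec w hx').1, mul_assoc _ _ v, ← h1]
  simp only [mul_assoc]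

theorem apply_op (v w : A) : σ (S.op B v w) = B.ε • S.op B w v := by
  rw [op, op, apply_proj, ← map_smul]
  congr 1
  simp [apply_mul, B.apply_t, mul_assoc]

theorem mul_op (v w : A) {c : A} (hc : ∀ k ∈ K, k * c = c * k) :
    c * S.op B v w = S.op B (c * v) w := by
  rw [op, op, ← S.proj_mul_left hc, mul_assoc, mul_assoc, mul_assoc]

theorem op_mul (v w : A) {c : A} (hc : ∀ k ∈ K, k * c = c * k) :
    S.op B v w * c = S.op B v (σ c * w) := by
  rw [op, op, ← S.proj_mul_right hc, mul_assoc, apply_mul, apply_apply]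

/-- The form over `K` is nondegenerate. -/
theorem eq_zero_of_form (hσ : σ.IsAlgebraWithInvolution) {w : A} (hw : w * B.e = w)
    (h : ∀ x, x * B.e = x → S.form B w x = 0) : w = 0 := by
  -- apply the functional dual to `u j` to `H(w, x) = 0`, after swapping the separability idempotent
  have h1 : ∀ x, x * B.e = x → ∀ j, B.form w (S.v j * x) = 0 := by
    intro x hx j
    have h2 := S.sum_eq_zero_of_center hσ
      (fun i => (B.form_spec w (x := S.u i * x) (by rw [mul_assoc, hx])).1) S.v_mem (h x hx)
      (S.dual j)
    have h3 := S.swap ((LinearMap.lsmul F A).flip.compl₁₂ (formMap B w x) (S.dual j))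
    simp only [LinearMap.compl₁₂_apply, LinearMap.flip_apply, formMap_apply] at h3
    have h4 := h3.symm.trans h2
    simpa [S.dual_u] using h4
  refine B.eq_zero_of_form hw fun x hx => ?_
  have h2 : B.form w x = ∑ j, formMap B w (S.u j * x) (S.v j) := by
    have h3 : x = ∑ j, S.v j * (S.u j * x) := by
      simp only [← mul_assoc]
      rw [← Finset.sum_mul]
      simp only [S.comm _ (S.v_mem _) _ (S.u_mem _)]
      rw [S.sum_uv, one_mul]
    have h4 : B.form w x = formMap B w x (∑ j, S.v j * S.u j) := by
      rw [formMap_apply, Finset.sum_mul]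
      simp only [mul_assoc]
      rw [← h3]
    rw [h4, map_sum]
    exact Finset.sum_congr rfl fun j _ => by rw [formMap_apply, formMap_apply, mul_assoc]
  rw [h2]
  exact Finset.sum_eq_zero fun j _ => h1 (S.u j * x) (by rw [mul_assoc, hx]) j

/-- The form over `K` is not zero on `p V`, since `p V` is an orthogonal summand of `V`. -/
theorem exists_form_ne_zero (hσ : σ.IsAlgebraWithInvolution) {p : A}
    (hp : ∀ k ∈ K, k * p = p * k) (hpp : p * p = p) (hs : σ p = p) (h0 : p ≠ 0) :
    ∃ v w, v * B.e = v ∧ w * B.e = w ∧ p * v = v ∧ p * w = w ∧ S.form B v w ≠ 0 := by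
  by_contra hcon
  push Not at hcon
  apply h0
  refine B.ext_mul fun x hx => ?_
  rw [zero_mul]
  refine S.eq_zero_of_form B hσ (by rw [mul_assoc, hx]) fun y hy => ?_
  have h1 := hcon (p * x) (p * y) (by rw [mul_assoc, hx]) (by rw [mul_assoc, hy])
    (by rw [← mul_assoc, hpp]) (by rw [← mul_assoc, hpp])
  rw [S.form_mul_left B _ _ hp, hs, ← mul_assoc, hpp] at h1
  rw [S.form_mul_left B _ _ hp, hs, h1]

/-- For an involution of the first kind, the form takes its values in `K`. -/
theorem form_mem (h1 : IsFirstKind F A) (w : A) {x : A} (hx : x * B.e = x) :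
    S.form B w x ∈ K := by
  refine K.sum_mem fun i _ => ?_
  obtain ⟨c, hc⟩ := h1 _ (B.form_spec w (x := S.u i * x) (by rw [mul_assoc, hx])).1
  rw [hc, smul_one_mul]
  exact K.smul_mem (S.v_mem i) c

/-- For an involution of the second kind, the form takes its values in the algebra generated by
`K` and the center. -/
theorem exists_form_eq (w : A) {x : A} (hx : x * B.e = x) {y : A}
    (hspan : ∀ z : A, (∀ a, a * z = z * a) → ∃ α β : F, z = α • 1 + β • y) :
    ∃ k ∈ K, ∃ l ∈ K, S.form B w x = k + y * l := by
  choose α β hαβ using fun i => hspan _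
    (B.form_spec w (x := S.u i * x) (by rw [mul_assoc, hx])).1
  refine ⟨∑ i, α i • S.v i, K.sum_mem fun i _ => K.smul_mem (S.v_mem i) _,
    ∑ i, β i • S.v i, K.sum_mem fun i _ => K.smul_mem (S.v_mem i) _, ?_⟩
  rw [form, Finset.mul_sum, ← Finset.sum_add_distrib]
  exact Finset.sum_congr rfl fun i _ => by rw [hαβ, add_mul]; simp

/-- For an involution of the second kind, the sum `K + K y` is direct. -/
theorem eq_zero_of_add_mul (S : SymSep σ K) {y k l : A} (hy : ∀ a, a * y = y * a) {c : F}
    (hc : c ≠ 0)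
    (hyc : (y - σ y) * (y - σ y) = c • 1) (hk : k ∈ K) (hl : l ∈ K) (h : k + y * l = 0) :
    k = 0 ∧ l = 0 := by
  have h3 := congrArg σ h
  rw [map_add, apply_mul, S.symm _ hk, S.symm _ hl, map_zero, commutes_apply hy] at h3
  have h4 : (y - σ y) * l = 0 := by
    rw [sub_mul, ← add_sub_add_left_eq_sub _ _ k, h, h3, sub_zero]
  have h5 : l = 0 := by
    have h6 : (y - σ y) * ((y - σ y) * l) = 0 := by rw [h4, mul_zero]
    rw [← mul_assoc, hyc, smul_one_mul] at h6
    exact (smul_eq_zero.1 h6).resolve_left hc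
  rw [h5, mul_zero, add_zero] at h
  exact ⟨h, h5⟩

/-- The diagonal values of the form lie in `K`. -/
theorem form_self_mem (hσ : σ.IsAlgebraWithInvolution) {x : A} (hx : x * B.e = x) :
    S.form B x x ∈ K := by
  by_cases h1 : IsFirstKind F A
  · exact S.form_mem B h1 x hx
  · obtain ⟨y, hy, ⟨c, hc, hyc⟩, hspan⟩ := hσ.exists_center_generator h1
    obtain ⟨k, hk, l, hl, h⟩ := S.exists_form_eq B x hx hspan
    have h2 := S.apply_form B hx hx
    rw [B.ε_eq_one h1, one_smul, h, map_add, apply_mul, S.symm _ hk, S.symm _ hl,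
      commutes_apply hy, add_right_inj] at h2
    have h4 : (y - σ y) * ((y - σ y) * l) = 0 := by
      rw [sub_mul y _ l, h2, sub_self, mul_zero]
    rw [← mul_assoc, hyc, smul_one_mul] at h4
    rw [h, (smul_eq_zero.1 h4).resolve_left hc, mul_zero, add_zero]
    exact hk

/-- If `ε = -1` and `p` is a symmetrized element, the form is alternating on `p V`. -/
theorem form_self_eq_zero (h1 : IsFirstKind F A) (hε : B.ε = -1) {p : A}
    (hp : ∀ k ∈ K, k * p = p * k) (hpd : p ∈ σ.symd) {x : A} (hx : x * B.e = x)
    (hpx : p * x = x) : S.form B x x = 0 := by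
  obtain ⟨a, ha⟩ := mem_symd.1 hpd
  -- `p` is the symmetrization of an element that commutes with `K`
  have hE : S.proj a + σ (S.proj a) = p := by
    rw [apply_proj, ← map_add, ha]
    have := S.proj_mul_left hp 1
    rwa [mul_one, S.proj_one, mul_one] at this
  have hc : ∀ k ∈ K, k * S.proj a = S.proj a * k := fun k hk => S.proj_comm a hk
  have hcx : S.proj a * x * B.e = S.proj a * x := by rw [mul_assoc, hx]
  have h3 : S.form B x x = S.form B (p * x) x := by rw [hpx]
  rw [h3, S.form_mul_left B _ _ hp, ← hE, map_add, apply_apply, add_mul, form_add_right,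
    ← S.form_mul_left B _ _ hc]
  have h2 := S.apply_form B hx hcx
  rw [S.symm _ (S.form_mem B h1 _ hcx), hε, neg_smul, one_smul] at h2
  rw [h2, add_neg_cancel]

end SymSep

end FInvolution

/-! ### The sign of the form and the type of the involution -/

namespace FInvolution

variable {F : Type u} {A : Type v} [Field F] [Ring A] [Algebra F A]

namespace Frame

variable {σ : FInvolution F A} (B : Frame σ)

/-- The map `w ↦ h(w, x)`. -/
noncomputable def formLeft (x : A) : A →ₗ[F] A where
  toFun w := B.form w x
  map_add' w w' := B.form_add_left w w' x
  map_smul' c w := by simp [form, Finset.smul_sum]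

theorem formLeft_apply (x w : A) : B.formLeft x w = B.form w x := rfl

theorem mem_range_peirce {p : A} (hp : p * p = p) {x : A} :
    x ∈ LinearMap.range (peirce F p B.e) ↔ p * x = x ∧ x * B.e = x := by
  constructor
  · rintro ⟨y, rfl⟩
    rw [peirce_apply]
    exact ⟨by rw [← mul_assoc, ← mul_assoc, hp], by rw [mul_assoc, B.ee]⟩
  · rintro ⟨h, h'⟩
    exact ⟨x, by rw [peirce_apply, h, h']⟩

/-- For an involution of the first kind, the operators `x ↦ h(v_c, x) v_a`, where the `v_a` form a
basis of `e V`, form a basis of `e A e`. -/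
theorem exists_basis_corner [FiniteDimensional F A] (h1 : IsFirstKind F A) {e : A}
    (hee : e * e = e) (hs : σ e = e) :
    ∃ v : Fin (B.rank e) → A,
      LinearIndependent F (fun p : Fin (B.rank e) × Fin (B.rank e) => v p.1 * B.t * σ (v p.2)) ∧
      Submodule.span F (Set.range fun p : Fin (B.rank e) × Fin (B.rank e) =>
        v p.1 * B.t * σ (v p.2)) = LinearMap.range (peirce F e e) := by
  obtain ⟨v, hv, hli, hspan⟩ : ∃ v : Fin (B.rank e) → A,
      (∀ a, e * v a = v a ∧ v a * B.e = v a) ∧ LinearIndependent F v ∧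
      ∀ x, e * x = x → x * B.e = x → ∃ c : Fin (B.rank e) → F, x = ∑ a, c a • v a := by
    let b := Module.finBasis F (LinearMap.range (peirce F e B.e))
    refine ⟨fun a => (b a).1, fun a => (B.mem_range_peirce hee).1 (b a).2,
      b.linearIndependent.map' (Submodule.subtype _) (Submodule.ker_subtype _), ?_⟩
    intro x hx hx'
    refine ⟨b.repr ⟨x, (B.mem_range_peirce hee).2 ⟨hx, hx'⟩⟩, ?_⟩
    have := congrArg Subtype.val (b.sum_repr ⟨x, (B.mem_range_peirce hee).2 ⟨hx, hx'⟩⟩)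
    rw [Submodule.coe_sum] at this
    exact this.symm
  refine ⟨v, ?_, le_antisymm (Submodule.span_le.2 ?_) ?_⟩
  · rw [Fintype.linearIndependent_iff]
    rintro g hg ⟨a, c⟩
    have h2 : ∀ x, x * B.e = x → B.form (∑ c, g (a, c) • v c) x = 0 := by
      intro x hx
      choose l hl using fun c => h1 _ (B.form_spec (v c) hx).1
      have h3 := congrArg (· * x) hg
      have h4 : ∀ a c, v a * B.t * σ (v c) * x = l c • v a := fun a c => by
        rw [mul_assoc (v a), mul_assoc (v a), B.mul_form _ (hv a).2 hx, hl, smul_one_mul]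
      simp only [Finset.sum_mul, smul_mul_assoc, h4, zero_mul, smul_smul] at h3
      rw [Fintype.sum_prod_type] at h3
      simp only [← Finset.sum_smul] at h3
      have h4 := Fintype.linearIndependent_iff.1 hli _ h3 a
      rw [← formLeft_apply, map_sum]
      simp only [map_smul, formLeft_apply, hl, smul_smul, ← Finset.sum_smul, h4, zero_smul]
    have h3 := B.eq_zero_of_form (by
      rw [Finset.sum_mul]
      exact Finset.sum_congr rfl fun c _ => by rw [smul_mul_assoc, (hv c).2]) h2
    exact Fintype.linearIndependent_iff.1 hli _ h3 c
  · rintro _ ⟨⟨a, c⟩, rfl⟩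
    refine ⟨v a * B.t * σ (v c), ?_⟩
    have h2 := congrArg σ (hv c).1
    rw [apply_mul, hs] at h2
    rw [peirce_apply, ← mul_assoc, ← mul_assoc, (hv a).1, mul_assoc, h2]
  · rintro _ ⟨x, rfl⟩
    have h2 : peirce F e e x = ∑ j, (e * x * B.a j) * B.t * σ (e * σ (B.s * B.b j)) := by
      have h3 : ∀ j, (e * x * B.a j) * B.t * σ (e * σ (B.s * B.b j)) =
          e * x * (B.a j * B.b j) * e := fun j => by
        rw [apply_mul, apply_apply, hs, ← mul_assoc, ← mul_assoc, mul_assoc _ B.t, B.ts,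
          mul_assoc _ (B.a j), B.ae, mul_assoc (e * x)]
      rw [Finset.sum_congr rfl fun j _ => h3 j, ← Finset.sum_mul, ← Finset.mul_sum, B.sum_ab,
        mul_one, peirce_apply]
    rw [h2]
    refine Submodule.sum_mem _ fun j _ => ?_
    have hσs : σ (B.s * B.b j) * B.e = σ (B.s * B.b j) := by
      apply σ.apply_injective
      rw [apply_mul, apply_apply, ← mul_assoc, ← B.st, mul_assoc B.s, B.ts, B.se]
    obtain ⟨c, hc⟩ := hspan (e * x * B.a j) (by rw [← mul_assoc, ← mul_assoc, hee])
      (by rw [mul_assoc, B.ae])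
    obtain ⟨d, hd⟩ := hspan (e * σ (B.s * B.b j)) (by rw [← mul_assoc, hee])
      (by rw [mul_assoc, hσs])
    rw [hc, hd, map_sum, Finset.sum_mul, Finset.sum_mul]
    refine Submodule.sum_mem _ fun i _ => ?_
    rw [Finset.mul_sum]
    refine Submodule.sum_mem _ fun k _ => ?_
    rw [map_smul, smul_mul_assoc, smul_mul_assoc, mul_smul_comm]
    exact Submodule.smul_mem _ _ (Submodule.smul_mem _ _ (Submodule.subset_span ⟨(i, k), rfl⟩))

/-- There are `r (r - 1) / 2` pairs `a < b` in `Fin r`. -/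
theorem _root_.Fin.two_mul_card_lt (r : ℕ) :
    2 * Fintype.card {p : Fin r × Fin r // p.1 < p.2} + r = r * r := by
  have h1 : Fintype.card {p : Fin r × Fin r // p.1 < p.2} =
      Fintype.card {p : Fin r × Fin r // p.2 < p.1} :=
    Fintype.card_congr ((Equiv.prodComm _ _).subtypeEquiv fun p => Iff.rfl)
  have h2 : Fintype.card {p : Fin r × Fin r // p.1 = p.2} = r := by
    rw [Fintype.card_congr (β := Fin r) ⟨fun p => p.1.1, fun a => ⟨(a, a), rfl⟩,
      fun p => Subtype.ext (Prod.ext rfl p.2), fun a => rfl⟩, Fintype.card_fin]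
  have h3 : Fintype.card {p : Fin r × Fin r // p.1 < p.2} +
      Fintype.card {p : Fin r × Fin r // p.2 < p.1} +
      Fintype.card {p : Fin r × Fin r // p.1 = p.2} = r * r := by
    simp only [Fintype.card_subtype]
    rw [← Finset.card_union_of_disjoint, ← Finset.card_union_of_disjoint]
    · rw [← Finset.filter_or, ← Finset.filter_or, Finset.filter_true_of_mem]
      · simp
      · intro p _
        rcases lt_trichotomy p.1 p.2 with h | h | h <;> simp [h]
    · rw [← Finset.filter_or, Finset.disjoint_filter]
      rintro p _ (h | h) h'
      · exact h.ne h'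
      · exact h.ne' h'
    · rw [Finset.disjoint_filter]
      exact fun p _ h h' => h.asymm h'
  omega

/-- The sign `ε` decides whether the skew elements dominate in the corners. -/
theorem skewDominant_iff [FiniteDimensional F A] (h1 : IsFirstKind F A) {e : A}
    (hee : e * e = e) (hs : σ e = e) (h0 : e ≠ 0) : σ.SkewDominant e ↔ B.ε = -1 := by
  obtain ⟨v, hli, hspan⟩ := B.exists_basis_corner h1 hee hs
  have hr : B.rank e ≠ 0 := fun h => h0 (B.eq_zero_of_rank h)
  have hdim : Module.finrank F (LinearMap.range (peirce F e e)) = B.rank e * B.rank e := by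
    rw [← hspan, finrank_span_eq_card hli]
    simp
  -- `N` is the space of alternating operators, of dimension at most `r (r - 1) / 2`; it contains
  -- all `x - ε σ(x)` with `x` in the corner
  let N : Submodule F A := Submodule.span F (Set.range fun p : {p : Fin (B.rank e) ×
    Fin (B.rank e) // p.1 < p.2} => v p.1.1 * B.t * σ (v p.1.2) - v p.1.2 * B.t * σ (v p.1.1))
  have hN : Module.finrank F N ≤ Fintype.card {p : Fin (B.rank e) × Fin (B.rank e) // p.1 < p.2} :=
    finrank_range_le_card _
  have hcard := Fin.two_mul_card_lt (B.rank e)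
  have hmem : ∀ x ∈ LinearMap.range (peirce F e e), x - B.ε • σ x ∈ N := by
    intro x hx
    have hεε : B.ε * B.ε = 1 := by rcases B.ε_eq with h | h <;> rw [h] <;> simp
    rw [← hspan] at hx
    induction hx using Submodule.span_induction with
    | mem x hx =>
      obtain ⟨⟨a, c⟩, rfl⟩ := hx
      have h2 : v a * B.t * σ (v c) - B.ε • σ (v a * B.t * σ (v c)) =
          v a * B.t * σ (v c) - v c * B.t * σ (v a) := by
        simp [apply_mul, B.apply_t, smul_smul, hεε, mul_assoc]
      rw [h2]
      rcases lt_trichotomy a c with h | h | h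
      · exact Submodule.subset_span ⟨⟨(a, c), h⟩, rfl⟩
      · rw [h, sub_self]
        exact N.zero_mem
      · rw [← neg_sub]
        exact N.neg_mem (Submodule.subset_span ⟨⟨(c, a), h⟩, rfl⟩)
    | zero => simp
    | add x y _ _ hx hy =>
      rw [map_add, smul_add, add_sub_add_comm]
      exact N.add_mem hx hy
    | smul c x _ hx =>
      rw [map_smul, smul_comm, ← smul_sub]
      exact N.smul_mem _ hx
  rw [SkewDominant, hdim]
  constructor
  · intro h
    by_contra hε
    have hε1 := B.ε_eq.resolve_right hε
    rw [hε1] at hε hmem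
    have h2 : (2 : F) ≠ 0 := fun h2 => hε (by
      rw [eq_neg_iff_add_eq_zero, one_add_one_eq_two, h2])
    -- for `ε = 1` and characteristic not two, the corner is contained in the sum of `N` and the
    -- symmetrized elements
    have hle : LinearMap.range (peirce F e e) ≤ N ⊔ LinearMap.range (σ.symdMap e) := by
      intro x hx
      have h3 : x + σ x ∈ LinearMap.range (σ.symdMap e) := by
        obtain ⟨y, rfl⟩ := hx
        exact ⟨y, rfl⟩
      have h4 : x = (2 : F)⁻¹ • ((x - (1 : F) • σ x) + (x + σ x)) := by
        rw [one_smul, sub_add_add_cancel, ← two_smul F x, smul_smul, inv_mul_cancel₀ h2, one_smul]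
      rw [h4]
      exact Submodule.smul_mem _ _ (Submodule.add_mem_sup (hmem x hx) h3)
    have h3 := Submodule.finrank_mono hle
    have h4 := Submodule.finrank_add_le_finrank_add_finrank N (LinearMap.range (σ.symdMap e))
    rw [hdim] at h3
    omega
  · intro hε
    -- for `ε = -1`, the symmetrized elements lie in `N`
    have hle : LinearMap.range (σ.symdMap e) ≤ N := by
      rintro _ ⟨y, rfl⟩
      have := hmem (peirce F e e y) ⟨y, rfl⟩
      rw [hε, neg_smul, one_smul, sub_neg_eq_add] at this
      exact this
    have h3 := Submodule.finrank_mono hle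
    omega

end Frame

end FInvolution

/-! ### Symmetric idempotents from anisotropic vectors -/

namespace FInvolution

variable {F : Type u} {A : Type v} [Field F] [Ring A] [Algebra F A]

/-- Symmetric idempotents of `A` commuting with the subalgebra `K`. -/
structure SymIdempotent (σ : FInvolution F A) (K : Subalgebra F A) (p : A) : Prop where
  idem : p * p = p
  symm : σ p = p
  comm : ∀ k ∈ K, k * p = p * k

theorem SymIdempotent.sub {σ : FInvolution F A} {K : Subalgebra F A} {p q : A}
    (hp : SymIdempotent σ K p) (hq : SymIdempotent σ K q) (h : p * q = q) (h' : q * p = q) :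
    SymIdempotent σ K (p - q) where
  idem := by rw [sub_mul, mul_sub, mul_sub, hp.idem, hq.idem, h, h', sub_self, sub_zero]
  symm := by rw [map_sub, hp.symm, hq.symm]
  comm k hk := by rw [mul_sub, sub_mul, hp.comm k hk, hq.comm k hk]

/-- The elements `k` of `K` with `k f = k`; this is `K f` when `f` is an idempotent of `K`. -/
def cornerOf (K : Subalgebra F A) (f : A) : Submodule F A :=
  Subalgebra.toSubmodule K ⊓ LinearMap.eqLocus (LinearMap.mulRight F f) LinearMap.id

theorem mem_cornerOf {K : Subalgebra F A} {f x : A} : x ∈ cornerOf K f ↔ x ∈ K ∧ x * f = x :=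
  Iff.rfl

/-- Primitive idempotents of a commutative reduced algebra: `K f` is a field. -/
structure IsPrimitive (K : Subalgebra F A) (f : A) : Prop where
  mem : f ∈ K
  idem : f * f = f
  ne_zero : f ≠ 0
  exists_inv : ∀ k ∈ cornerOf K f, k ≠ 0 → ∃ l ∈ cornerOf K f, l * k = f

namespace Frame

variable {σ : FInvolution F A} (B : Frame σ)

theorem rank_sum [FiniteDimensional F A] {ι : Type*} [Fintype ι] [DecidableEq ι]
    {p : ι → A} (hp : ∀ i j, p i * p j = if i = j then p i else 0) :
    B.rank (∑ i, p i) = ∑ i, B.rank (p i) := finrank_peirce_sum hp B.e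

theorem rank_add [FiniteDimensional F A] {p q : A} (hp : p * p = p) (hq : q * q = q)
    (hpq : p * q = 0) (hqp : q * p = 0) : B.rank (p + q) = B.rank p + B.rank q := by
  have := B.rank_sum (p := ![p, q]) (by
    intro i j
    fin_cases i <;> fin_cases j <;> simp [hp, hq, hpq, hqp])
  simpa using this

/-- Repeatedly splitting off atoms decomposes an idempotent into orthogonal atoms. -/
theorem exists_decomposition [FiniteDimensional F A] (B : Frame σ) {Good Atom : A → Prop}
    (hgood : ∀ p, Good p → p * p = p) (hatom : ∀ q, Atom q → q * q = q ∧ q ≠ 0)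
    (hstep : ∀ p, Good p → p ≠ 0 → ∃ q, Atom q ∧ p * q = q ∧ q * p = q ∧ Good (p - q)) {p : A}
    (hp : Good p) :
    ∃ (m : ℕ) (q : Fin m → A), (∀ t, Atom (q t)) ∧
      (∀ s t, q s * q t = if s = t then q s else 0) ∧ ∑ t, q t = p := by
  obtain ⟨n, hn⟩ : ∃ n, B.rank p ≤ n := ⟨_, le_rfl⟩
  induction n generalizing p with
  | zero =>
    refine ⟨0, Fin.elim0, fun t => t.elim0, fun t => t.elim0, ?_⟩
    rw [B.eq_zero_of_rank (Nat.le_zero.1 hn)]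
    simp
  | succ n ih =>
    by_cases h0 : p = 0
    · refine ⟨0, Fin.elim0, fun t => t.elim0, fun t => t.elim0, ?_⟩
      rw [h0]
      simp
    obtain ⟨q, hq, hpq, hqp, hg⟩ := hstep p hp h0
    obtain ⟨hqq, hq0⟩ := hatom q hq
    have h1 : q * (p - q) = 0 := by rw [mul_sub, hqp, hqq, sub_self]
    have h2 : (p - q) * q = 0 := by rw [sub_mul, hpq, hqq, sub_self]
    have h3 := B.rank_add hqq (hgood _ hg) h1 h2
    rw [add_sub_cancel] at h3
    have h4 : B.rank q ≠ 0 := fun h => hq0 (B.eq_zero_of_rank h)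
    obtain ⟨m, r, hr, horth, hsum⟩ := ih hg (by omega)
    have h5 : ∀ t, q * r t = 0 := fun t => by
      have : (p - q) * r t = r t := by simp [← hsum, Finset.sum_mul, horth]
      rw [← this, ← mul_assoc, h1, zero_mul]
    have h6 : ∀ t, r t * q = 0 := fun t => by
      have : r t * (p - q) = r t := by simp [← hsum, Finset.mul_sum, horth]
      rw [← this, mul_assoc, h2, mul_zero]
    refine ⟨m + 1, Fin.cons q r, fun t => ?_, fun s t => ?_, ?_⟩
    · refine Fin.cases ?_ (fun t => ?_) t
      · exact hq
      · exact hr t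
    · refine Fin.cases ?_ (fun s => ?_) s <;> refine Fin.cases ?_ (fun t => ?_) t
      · simp [hqq]
      · simp [h5, (Fin.succ_ne_zero t).symm]
      · simp [h6, Fin.succ_ne_zero]
      · simp [horth]
    · rw [Fin.sum_univ_succ]
      simp [hsum]

/-- If `q V` is free over `K f` on the family `g`, then its dimension is that of `(K f)^m`. -/
theorem rank_eq_mul [FiniteDimensional F A] {K : Subalgebra F A} {f q : A} (hq : q * q = q) {m : ℕ}
    (hqc : ∀ k ∈ K, k * q = q * k)
    (g : Fin m → A) (hg : ∀ j, q * g j = g j ∧ g j * B.e = g j)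
    (hinj : ∀ l : Fin m → A, (∀ j, l j ∈ cornerOf K f) → ∑ j, l j * g j = 0 → ∀ j, l j = 0)
    (hspan : ∀ x, q * x = x → x * B.e = x → ∃ l : Fin m → A, (∀ j, l j ∈ cornerOf K f) ∧
      x = ∑ j, l j * g j) :
    B.rank q = m * Module.finrank F (cornerOf K f) := by
  let φ : (Fin m → cornerOf K f) →ₗ[F] A :=
    ∑ j, LinearMap.mulRight F (g j) ∘ₗ (cornerOf K f).subtype ∘ₗ LinearMap.proj j
  have hφ : ∀ l, φ l = ∑ j, (l j).1 * g j := fun l => by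
    simp only [φ, LinearMap.sum_apply]
    rfl
  have hi : Function.Injective φ := by
    rw [injective_iff_map_eq_zero]
    intro l hl
    rw [hφ] at hl
    funext j
    exact Subtype.ext (hinj (fun j => (l j).1) (fun j => (l j).2) hl j)
  have hr : LinearMap.range φ = LinearMap.range (peirce F q B.e) := by
    ext x
    rw [B.mem_range_peirce hq]
    constructor
    · rintro ⟨l, rfl⟩
      rw [hφ]
      constructor
      · rw [Finset.mul_sum]
        exact Finset.sum_congr rfl fun j _ => by
          rw [← mul_assoc, ← hqc _ (l j).2.1, mul_assoc, (hg j).1]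
      · rw [Finset.sum_mul]
        exact Finset.sum_congr rfl fun j _ => by rw [mul_assoc, (hg j).2]
    · rintro ⟨h1, h2⟩
      obtain ⟨l, hl, rfl⟩ := hspan x h1 h2
      exact ⟨fun j => ⟨l j, hl j⟩, hφ _⟩
  rw [rank, ← hr, LinearMap.finrank_range_of_inj hi, Module.finrank_pi_fintype]
  simp

end Frame

namespace SymSep

variable {σ : FInvolution F A} {K : Subalgebra F A} (S : SymSep σ K) (B : Frame σ)

theorem eq_zero_of_mul {f k l : A} (hf : IsPrimitive K f) (hk : k ∈ cornerOf K f)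
    (hl : l ∈ cornerOf K f) (h : k * l = 0) (hk0 : k ≠ 0) (S : SymSep σ K) : l = 0 := by
  obtain ⟨k', -, hkk⟩ := hf.exists_inv k hk hk0
  rw [← (mem_cornerOf.1 hl).2, S.comm _ hl.1 _ hf.mem, ← hkk, mul_assoc, h, mul_zero]

theorem form_mul_right {f : A} (hf : f ∈ K) (w : A) {x : A} (hfx : f * x = x) :
    S.form B w x * f = S.form B w x := by
  rw [← S.form_mem_right B w x hf, hfx]

theorem comm_mem (S : SymSep σ K) {l : A} (hl : l ∈ K) : ∀ k ∈ K, k * l = l * k :=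
  fun k hk => S.comm k hk l hl

/-- An anisotropic vector `v` of `f V` spans, over the algebra generated by `K f` and the center,
the image of an atomic symmetric idempotent. -/
theorem exists_atom_of_anisotropic (hσ : σ.IsAlgebraWithInvolution) {f : A} (hf : IsPrimitive K f)
    {v : A} (hv : v * B.e = v) (hfv : f * v = v) (h0 : S.form B v v ≠ 0) :
    ∃ q k, SymIdempotent σ K q ∧ q * v = v ∧ k ∈ K ∧ (q ≠ 0) ∧
      (∀ x, x * B.e = x → q * x = k * S.form B v x * v) ∧
      (∀ p, SymIdempotent σ K p → p * v = v → p * q = q ∧ q * p = q) ∧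
      B.rank q = Module.finrank F (Subalgebra.center F A) * Module.finrank F (cornerOf K f) := by
  have := hσ.finiteDimensional
  have hh : S.form B v v ∈ cornerOf K f :=
    ⟨S.form_self_mem B hσ hv, S.form_mul_right B hf.mem v hfv⟩
  obtain ⟨k, hk, hkh⟩ := hf.exists_inv _ hh h0
  -- a skew form is alternating unless the characteristic is two, and then `1 = -1`
  have hε : B.ε = 1 := by
    rcases B.ε_eq with h | h
    · exact h
    · have h1 := S.apply_form B hv hv
      rw [S.symm _ hh.1, h, neg_smul, one_smul] at h1
      by_contra hne
      have h2 : (2 : F) ≠ 0 := fun h2 => hne (by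
        rw [h, neg_eq_iff_add_eq_zero, one_add_one_eq_two, h2])
      apply h0
      have h3 : (2 : F) • S.form B v v = 0 := by
        rw [two_smul]
        nth_rewrite 1 [h1]
        rw [neg_add_cancel]
      exact (smul_eq_zero.1 h3).resolve_left h2
  have hfc := S.comm_mem hf.mem
  have hkc := S.comm_mem hk.1
  -- the orthogonal projection onto the line of `v`, where `k` is the inverse of `H(v, v)` in `K f`
  obtain ⟨q, hq⟩ : ∃ q, q = k * S.op B v v := ⟨_, rfl⟩
  have hT : ∀ l ∈ K, l * S.op B v v = S.op B v v * l := fun l hl => S.op_comm B v v hl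
  have hqc : ∀ l ∈ K, l * q = q * l := fun l hl => by
    rw [hq, ← mul_assoc, hkc l hl, mul_assoc, hT l hl, mul_assoc]
  have hqx : ∀ x, x * B.e = x → q * x = k * S.form B v x * v := fun x hx => by
    rw [hq, mul_assoc, S.op_apply B hv v hx, mul_assoc]
  have hqv : q * v = v := by rw [hqx v hv, hkh, hfv]
  have hqI : SymIdempotent σ K q := by
    refine ⟨B.ext_mul fun x hx => ?_, ?_, hqc⟩
    · have h1 := S.form_comm B v hx hqc
      rw [mul_assoc, hqx x hx, ← mul_assoc, ← mul_assoc, ← hqc k hk.1, mul_assoc k, h1, mul_assoc k,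
        mul_assoc _ q, hqv, mul_assoc]
    · rw [hq, apply_mul, S.apply_op, hε, one_smul, S.symm _ hk.1, hT k hk.1]
  refine ⟨q, k, hqI, hqv, hk.1, ?_, hqx, fun p hp hpv => ⟨?_, ?_⟩, ?_⟩
  · rintro rfl
    apply h0
    rw [← hqv, zero_mul, S.form_zero_right]
  · rw [hq, ← mul_assoc, ← hp.comm k hk.1, mul_assoc, S.mul_op B v v hp.comm, hpv]
  · rw [hq, mul_assoc, S.op_mul B v v hp.comm, hp.symm, hpv]
  · rcases hσ.finrank_center with ⟨h1, hd⟩ | ⟨h1, hd⟩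
    · rw [hd]
      refine B.rank_eq_mul hqI.idem hqc (fun _ => v) (fun _ => ⟨hqv, hv⟩) ?_ ?_
      · intro l hl hsum j
        obtain rfl : j = 0 := Subsingleton.elim _ _
        rw [Fin.sum_univ_one] at hsum
        refine eq_zero_of_mul hf hh (hl 0) ?_ h0 S
        rw [← S.form_mem_right B v v (hl 0).1, hsum, S.form_zero_right]
      · intro x hx hxe
        refine ⟨fun _ => k * S.form B v x * f, fun _ => ⟨?_, ?_⟩, ?_⟩
        · exact K.mul_mem (K.mul_mem hk.1 (S.form_mem B h1 v hxe)) hf.mem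
        · exact (mul_assoc _ _ _).trans (by rw [hf.idem]; rfl)
        · rw [Fin.sum_univ_one, mul_assoc, hfv, ← hqx x hxe, hx]
    · rw [hd]
      -- `v` and `y v` form a basis of `q V` over `K f`
      obtain ⟨y, hy, ⟨c, hc, hyc⟩, hspan⟩ := hσ.exists_center_generator h1
      refine B.rank_eq_mul hqI.idem hqc ![v, y * v] ?_ ?_ ?_
      · intro j
        fin_cases j
        · exact ⟨hqv, hv⟩
        · exact ⟨by
            change q * (y * v) = y * v
            rw [← mul_assoc, hy, mul_assoc, hqv], by
            change y * v * B.e = y * v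
            rw [mul_assoc, hv]⟩
      · intro l hl hsum
        rw [Fin.sum_univ_two] at hsum
        change l 0 * v + l 1 * (y * v) = 0 at hsum
        have h2 := congrArg (S.form B v) hsum
        rw [S.form_add_right, S.form_zero_right, S.form_mem_right B _ _ (hl 0).1,
          S.form_mem_right B _ _ (hl 1).1, S.form_central_right B hy, mul_assoc] at h2
        obtain ⟨h3, h4⟩ := S.eq_zero_of_add_mul hy hc hyc (K.mul_mem hh.1 (hl 0).1)
          (K.mul_mem hh.1 (hl 1).1) h2
        intro j
        fin_cases j
        · exact eq_zero_of_mul hf hh (hl 0) h3 h0 S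
        · exact eq_zero_of_mul hf hh (hl 1) h4 h0 S
      · intro x hx hxe
        obtain ⟨a, ha, b, hb, hab⟩ := S.exists_form_eq B v hxe hspan
        refine ⟨![k * a * f, k * b * f], fun j => ?_, ?_⟩
        · fin_cases j
          · exact ⟨K.mul_mem (K.mul_mem hk.1 ha) hf.mem, by
              change k * a * f * f = k * a * f
              rw [mul_assoc, hf.idem]⟩
          · exact ⟨K.mul_mem (K.mul_mem hk.1 hb) hf.mem, by
              change k * b * f * f = k * b * f
              rw [mul_assoc, hf.idem]⟩
        · rw [Fin.sum_univ_two]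
          change x = k * a * f * v + k * b * f * (y * v)
          rw [← hx, hqx x hxe, hab, mul_add, add_mul, mul_assoc (k * a), mul_assoc (k * b),
            ← mul_assoc f y, hy f, mul_assoc y f, hfv, ← mul_assoc k y, hy k]
          rw [← mul_assoc (k * b) y, hy, mul_assoc y k]

end SymSep

end FInvolution

/-! ### Hyperbolic pairs and the decomposition into atoms -/

namespace FInvolution

variable {F : Type u} {A : Type v} [Field F] [Ring A] [Algebra F A]

namespace SymSep

variable {σ : FInvolution F A} {K : Subalgebra F A} (S : SymSep σ K) (B : Frame σ)

/-- A hyperbolic pair of `f V` spans over `K f` the image of an atomic symmetric idempotent, and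
this idempotent is a symmetrized element. -/
theorem exists_atom_of_hyperbolic (hσ : σ.IsAlgebraWithInvolution) (h1 : IsFirstKind F A) {f : A}
    (hf : IsPrimitive K f) {v w : A} (hv : v * B.e = v) (hfv : f * v = v) (hw : w * B.e = w)
    (hfw : f * w = w) (hvv : S.form B v v = 0) (hww : S.form B w w = 0)
    (hvw : S.form B v w ≠ 0) (hwv : S.form B w v = -S.form B v w) :
    B.ε = -1 ∧ ∃ q, SymIdempotent σ K q ∧ q ≠ 0 ∧ q ∈ σ.symd ∧
      (∀ p, SymIdempotent σ K p → p * v = v → p * w = w → p * q = q ∧ q * p = q) ∧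
      B.rank q = 2 * Module.finrank F (cornerOf K f) := by
  have := hσ.finiteDimensional
  have hg : S.form B v w ∈ cornerOf K f :=
    ⟨S.form_mem B h1 v hw, S.form_mul_right B hf.mem v hfw⟩
  have hε : B.ε = -1 := by
    rcases B.ε_eq with h | h
    · have h2 := S.apply_form B hw hv
      rw [hwv, map_neg, S.symm _ hg.1, h, one_smul] at h2
      by_contra hne
      have h3 : (2 : F) ≠ 0 := fun h3 => hne (by
        rw [h, eq_neg_iff_add_eq_zero, one_add_one_eq_two, h3])
      apply hvw
      have h4 : (2 : F) • S.form B v w = 0 := by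
        rw [two_smul]
        nth_rewrite 1 [← h2]
        rw [neg_add_cancel]
      exact (smul_eq_zero.1 h4).resolve_left h3
    · exact h
  refine ⟨hε, ?_⟩
  obtain ⟨k, hk, hkg⟩ := hf.exists_inv _ hg hvw
  have hkc := S.comm_mem hk.1
  -- rescale `w` so that the value of the form is `f`
  obtain ⟨x, hx, hfx, hxx, hvx, hxv, hpx⟩ : ∃ x, x * B.e = x ∧ f * x = x ∧ S.form B x x = 0 ∧
      S.form B v x = f ∧ S.form B x v = -f ∧
      ∀ p, SymIdempotent σ K p → p * w = w → p * x = x := by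
    refine ⟨k * w, by rw [mul_assoc, hw], ?_, ?_, ?_, ?_, fun p hp hpw => ?_⟩
    · rw [← mul_assoc, hkc f hf.mem, mul_assoc, hfw]
    · rw [S.form_mem_right B _ _ hk.1, S.form_mul_left B _ _ hkc, S.symm _ hk.1,
        S.form_mem_right B _ _ hk.1, hww, zero_mul, zero_mul]
    · rw [S.form_mem_right B _ _ hk.1, hkc _ hg.1, hkg]
    · rw [S.form_mul_left B _ _ hkc, S.symm _ hk.1, S.form_mem_right B _ _ hk.1, hwv, neg_mul,
        hkc _ hg.1, hkg]
    · rw [← mul_assoc, ← hp.comm k hk.1, mul_assoc, hpw]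
  -- the orthogonal projection onto the plane of `v` and `x`; it is the symmetrization of `op x v`
  obtain ⟨q, hq⟩ : ∃ q, q = S.op B x v - S.op B v x := ⟨_, rfl⟩
  have hqc : ∀ l ∈ K, l * q = q * l := fun l hl => by
    rw [hq, mul_sub, sub_mul, S.op_comm B x v hl, S.op_comm B v x hl]
  have hqa : ∀ y, y * B.e = y → q * y = S.form B v y * x - S.form B x y * v := fun y hy => by
    rw [hq, sub_mul, S.op_apply B hx v hy, S.op_apply B hv x hy]
  have hqv : q * v = v := by
    rw [hqa v hv, hvv, hxv, zero_mul, neg_mul, hfv, sub_neg_eq_add, zero_add]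
  have hqx : q * x = x := by rw [hqa x hx, hxx, hvx, zero_mul, hfx, sub_zero]
  have hqI : SymIdempotent σ K q := by
    refine ⟨B.ext_mul fun y hy => ?_, ?_, hqc⟩
    · rw [mul_assoc, hqa y hy, mul_sub, ← mul_assoc, ← mul_assoc, ← hqc _ (S.form_mem B h1 v hy),
        ← hqc _ (S.form_mem B h1 x hy), mul_assoc, mul_assoc, hqv, hqx]
    · rw [hq, map_sub, S.apply_op, S.apply_op, hε]
      simp only [neg_smul, one_smul]
      abel
  refine ⟨q, hqI, ?_, mem_symd.2 ⟨S.op B x v, ?_⟩, fun p hp hpv hpw => ?_, ?_⟩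
  · rintro rfl
    apply hvw
    rw [← hqv, zero_mul]
    simpa using S.form_add_left B 0 0 w
  · rw [S.apply_op, hε, neg_smul, one_smul, hq, sub_eq_add_neg]
  · have hpx := hpx p hp hpw
    rw [hq, mul_sub, sub_mul, S.mul_op B _ _ hp.comm, S.mul_op B _ _ hp.comm,
      S.op_mul B _ _ hp.comm, S.op_mul B _ _ hp.comm, hp.symm, hpv, hpx]
    exact ⟨rfl, rfl⟩
  · refine B.rank_eq_mul hqI.idem hqc ![x, v] ?_ ?_ ?_
    · intro j
      fin_cases j
      · exact ⟨hqx, hx⟩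
      · exact ⟨hqv, hv⟩
    · intro l hl hsum
      rw [Fin.sum_univ_two] at hsum
      change l 0 * x + l 1 * v = 0 at hsum
      have hv' := congrArg (S.form B v) hsum
      have hx' := congrArg (S.form B x) hsum
      rw [S.form_add_right, S.form_zero_right, S.form_mem_right B _ _ (hl 0).1,
        S.form_mem_right B _ _ (hl 1).1] at hv' hx'
      rw [hvv, hvx, zero_mul, add_zero, ← S.comm_mem hf.mem _ (hl 0).1,
        (mem_cornerOf.1 (hl 0)).2] at hv'
      rw [hxx, hxv, zero_mul, zero_add, neg_mul, ← S.comm_mem hf.mem _ (hl 1).1,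
        (mem_cornerOf.1 (hl 1)).2, neg_eq_zero] at hx'
      intro j
      fin_cases j
      · exact hv'
      · exact hx'
    · intro y hy hye
      refine ⟨![S.form B v y * f, -(S.form B x y * f)], fun j => ?_, ?_⟩
      · fin_cases j
        · exact mem_cornerOf.2 ⟨K.mul_mem (S.form_mem B h1 v hye) hf.mem, by
            change S.form B v y * f * f = S.form B v y * f
            rw [mul_assoc, hf.idem]⟩
        · exact mem_cornerOf.2 ⟨K.neg_mem (K.mul_mem (S.form_mem B h1 x hye) hf.mem), by
            change -(S.form B x y * f) * f = -(S.form B x y * f)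
            rw [neg_mul, mul_assoc, hf.idem]⟩
      · rw [Fin.sum_univ_two]
        change y = S.form B v y * f * x + -(S.form B x y * f) * v
        rw [neg_mul, mul_assoc, mul_assoc, hfx, hfv, ← sub_eq_add_neg, ← hqa y hye, hy]

/-- A form that is alternating on `p V` is skew-symmetric there. -/
theorem form_swap_of_alternating {p : A}
    (halt : ∀ v, v * B.e = v → p * v = v → S.form B v v = 0) {v w : A} (hv : v * B.e = v)
    (hpv : p * v = v) (hw : w * B.e = w) (hpw : p * w = w) :
    S.form B w v = -S.form B v w := by
  have h := halt (v + w) (by rw [add_mul, hv, hw]) (by rw [mul_add, hpv, hpw])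
  rw [form_add_left, form_add_right, form_add_right, halt v hv hpv, halt w hw hpw, zero_add,
    add_zero] at h
  exact eq_neg_of_add_eq_zero_right h

theorem mul_eq_of_mul_eq {f p v : A} (hp : f * p = p) (hv : p * v = v) : f * v = v := by
  rw [← hv, ← mul_assoc, hp]

/-- If the form is alternating on `f V`, then `f` is a sum of atomic symmetrized idempotents. -/
theorem exists_atoms_of_alternating (hσ : σ.IsAlgebraWithInvolution) (h1 : IsFirstKind F A) {f : A}
    (hf : IsPrimitive K f) (halt : ∀ v, v * B.e = v → f * v = v → S.form B v v = 0) :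
    B.ε = -1 ∧ ∃ (m : ℕ) (q : Fin m → A), (∀ t, SymIdempotent σ K (q t) ∧ q t ≠ 0 ∧
        B.rank (q t) = 2 * Module.finrank F (cornerOf K f) ∧ q t ∈ σ.symd) ∧
      (∀ s t, q s * q t = if s = t then q s else 0) ∧ ∑ t, q t = f := by
  have := hσ.finiteDimensional
  have key : ∀ p, SymIdempotent σ K p → f * p = p → p ≠ 0 → B.ε = -1 ∧
      ∃ q, (SymIdempotent σ K q ∧ q ≠ 0 ∧ B.rank q = 2 * Module.finrank F (cornerOf K f) ∧
        q ∈ σ.symd) ∧ p * q = q ∧ q * p = q := by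
    intro p hp hfp hp0
    obtain ⟨v, w, hv, hw, hpv, hpw, hvw⟩ := S.exists_form_ne_zero B hσ hp.comm hp.idem hp.symm hp0
    have hfv := mul_eq_of_mul_eq hfp hpv
    have hfw := mul_eq_of_mul_eq hfp hpw
    obtain ⟨hε, q, h2, h3, h4, h5, h6⟩ := S.exists_atom_of_hyperbolic B hσ h1 hf hv hfv hw hfw
      (halt v hv hfv) (halt w hw hfw) hvw (S.form_swap_of_alternating B halt hv hfv hw hfw)
    exact ⟨hε, q, ⟨h2, h3, h6, h4⟩, h5 p hp hpv hpw⟩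
  have hfI : SymIdempotent σ K f := ⟨hf.idem, S.symm f hf.mem, S.comm_mem hf.mem⟩
  refine ⟨(key f hfI hf.idem hf.ne_zero).1, ?_⟩
  refine B.exists_decomposition (Good := fun p => SymIdempotent σ K p ∧ f * p = p)
    (Atom := fun q => SymIdempotent σ K q ∧ q ≠ 0 ∧
      B.rank q = 2 * Module.finrank F (cornerOf K f) ∧ q ∈ σ.symd)
    (fun p hp => hp.1.idem) (fun q hq => ⟨hq.1.idem, hq.2.1⟩) ?_ ⟨hfI, hf.idem⟩
  rintro p ⟨hp, hfp⟩ hp0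
  obtain ⟨-, q, hq, hpq, hqp⟩ := key p hp hfp hp0
  refine ⟨q, hq, hpq, hqp, hp.sub hq.1 hpq hqp, ?_⟩
  rw [mul_sub, hfp, ← hpq, ← mul_assoc, hfp]

/-- Unless the form is alternating on `f V`, the idempotent `f` is a sum of atomic symmetric
idempotents with images of rank one over the algebra generated by `K f` and the center. -/
theorem exists_atoms (S : SymSep σ K) (B : Frame σ) (hσ : σ.IsAlgebraWithInvolution) {f : A}
    (hf : IsPrimitive K f)
    (hnd : IsFirstKind F A → ¬ (B.ε = -1 ∧ f ∈ σ.symd)) :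
    ∃ (m : ℕ) (q : Fin m → A), (∀ t, SymIdempotent σ K (q t) ∧ q t ≠ 0 ∧
        B.rank (q t) = Module.finrank F (Subalgebra.center F A) *
          Module.finrank F (cornerOf K f)) ∧
      (∀ s t, q s * q t = if s = t then q s else 0) ∧ ∑ t, q t = f := by
  have := hσ.finiteDimensional
  have hfI : SymIdempotent σ K f := ⟨hf.idem, S.symm f hf.mem, S.comm_mem hf.mem⟩
  -- the induction keeps an anisotropic vector in the image of the remaining idempotent
  refine B.exists_decomposition (Good := fun p => SymIdempotent σ K p ∧ f * p = p ∧
      (IsFirstKind F A → p = 0 ∨ ∃ v, v * B.e = v ∧ p * v = v ∧ S.form B v v ≠ 0))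
    (Atom := fun q => SymIdempotent σ K q ∧ q ≠ 0 ∧
        B.rank q = Module.finrank F (Subalgebra.center F A) * Module.finrank F (cornerOf K f))
    (fun p hp => hp.1.idem) (fun q hq => ⟨hq.1.idem, hq.2.1⟩) ?_ ⟨hfI, hf.idem, fun h1 => ?_⟩
  · rintro p ⟨hp, hfp, hpg⟩ hp0
    have hfsub : ∀ q, p * q = q → f * (p - q) = p - q := fun q hpq => by
      rw [mul_sub, hfp, ← hpq, ← mul_assoc, hfp]
    by_cases h1 : IsFirstKind F A
    · obtain ⟨v, hv, hpv, hvv⟩ := (hpg h1).resolve_left hp0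
      have hfv := mul_eq_of_mul_eq hfp hpv
      obtain ⟨q, k, hq, hqv, hk, hq0, hqx, hqp, hr⟩ :=
        S.exists_atom_of_anisotropic B hσ hf hv hfv hvv
      obtain ⟨hpq, hqp⟩ := hqp p hp hpv
      have hs := hp.sub hq hpq hqp
      by_cases hcon : p - q = 0 ∨ ∃ v, v * B.e = v ∧ (p - q) * v = v ∧ S.form B v v ≠ 0
      · exact ⟨q, ⟨hq, hq0, hr⟩, hpq, hqp, hs, hfsub q hpq, fun _ => hcon⟩
      -- the complement is alternating: replace `v` by `v + w` with `w` in the complement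
      push Not at hcon
      obtain ⟨hpq0, halt⟩ := hcon
      obtain ⟨w, x, hw, hx, hpw, hpx, hwx⟩ :=
        S.exists_form_ne_zero B hσ hs.comm hs.idem hs.symm hpq0
      have hpp : p * (p - q) = p - q := by rw [mul_sub, hp.idem, hpq]
      have hqp' : q * (p - q) = 0 := by rw [mul_sub, hqp, hq.idem, sub_self]
      have hvz : ∀ z, (p - q) * z = z → S.form B v z = 0 := fun z hz => by
        rw [← hqv, S.form_mul_left B _ _ hq.comm, hq.symm, ← hz, ← mul_assoc, hqp', zero_mul,
          S.form_zero_right]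
      have hzv : ∀ z, (p - q) * z = z → S.form B z v = 0 := fun z hz => by
        rw [← hz, S.form_mul_left B _ _ hs.comm, hs.symm, sub_mul, hpv, hqv, sub_self,
          S.form_zero_right]
      have hvw : (v + w) * B.e = v + w := by rw [add_mul, hv, hw]
      have hpvw : p * (v + w) = v + w := by rw [mul_add, hpv, mul_eq_of_mul_eq hpp hpw]
      have hpx' := mul_eq_of_mul_eq hpp hpx
      have hh : S.form B (v + w) (v + w) = S.form B v v := by
        rw [form_add_left, form_add_right, form_add_right, hvz w hpw, hzv w hpw, halt w hw hpw]
        simp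
      have hgx : S.form B (v + w) x = S.form B w x := by rw [form_add_left, hvz x hpx, zero_add]
      have hxg : S.form B x (v + w) = -S.form B w x := by
        rw [form_add_right, hzv x hpx, zero_add,
          S.form_swap_of_alternating B halt hw hpw hx hpx]
      have hfx := mul_eq_of_mul_eq hfp hpx'
      have hhK : S.form B v v ∈ cornerOf K f :=
        ⟨S.form_mem B h1 v hv, S.form_mul_right B hf.mem v hfv⟩
      have hgK : S.form B w x ∈ cornerOf K f :=
        ⟨S.form_mem B h1 w hx, S.form_mul_right B hf.mem w hfx⟩
      obtain ⟨q', k', hq', hqv', hk', hq0', hqx', hqp', hr'⟩ :=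
        S.exists_atom_of_anisotropic B hσ hf hvw (mul_eq_of_mul_eq hfp hpvw) (hh ▸ hvv)
      obtain ⟨hpq', hqp'⟩ := hqp' p hp hpvw
      -- the complement of `v + w` contains the anisotropic vector `H(v, v) x - H(w, x) (v + w)`
      refine ⟨q', ⟨hq', hq0', hr'⟩, hpq', hqp', hp.sub hq' hpq' hqp', hfsub q' hpq', fun _ =>
        Or.inr ⟨S.form B v v * x - S.form B w x * (v + w), ?_, ?_, ?_⟩⟩
      · rw [sub_mul, mul_assoc, mul_assoc, hx, hvw]
      · rw [sub_mul, hqx' _ (by rw [sub_mul, mul_assoc, mul_assoc, hx, hvw]), S.form_sub_right,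
          S.form_mem_right B _ _ hhK.1, S.form_mem_right B _ _ hgK.1, hh, hgx,
          S.comm _ hgK.1 _ hhK.1, sub_self, mul_zero, zero_mul, sub_zero, mul_sub, ← mul_assoc,
          ← mul_assoc, ← hp.comm _ hhK.1, ← hp.comm _ hgK.1, mul_assoc, mul_assoc, hpx', hpvw]
      · have h2 : S.form B (S.form B v v * x - S.form B w x * (v + w))
            (S.form B v v * x - S.form B w x * (v + w)) =
            S.form B w x * (S.form B w x * S.form B v v) := by
          rw [S.form_sub_left, S.form_mul_left B _ _ (S.comm_mem hhK.1),
            S.form_mul_left B _ _ (S.comm_mem hgK.1), S.symm _ hhK.1, S.symm _ hgK.1,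
            S.form_mem_right B _ _ hhK.1, S.form_mem_right B _ _ hgK.1, S.form_sub_right,
            S.form_sub_right, S.form_mem_right B _ _ hhK.1, S.form_mem_right B _ _ hhK.1,
            S.form_mem_right B _ _ hgK.1, S.form_mem_right B _ _ hgK.1, halt x hx hpx, hgx, hxg, hh]
          have hc := S.comm _ hgK.1 _ hhK.1
          generalize S.form B w x = g at *
          generalize S.form B v v = h at *
          simp only [zero_mul, zero_sub, neg_mul, neg_neg, sub_mul, mul_assoc]
          rw [hc, ← mul_assoc g h g, hc, mul_assoc]
          abel
        rw [h2]
        intro h3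
        have h4 : S.form B w x * S.form B v v ∈ cornerOf K f :=
          mem_cornerOf.2 ⟨K.mul_mem hgK.1 hhK.1, by rw [mul_assoc, (mem_cornerOf.1 hhK).2]⟩
        have h5 := eq_zero_of_mul hf hgK h4 h3 hwx S
        exact hvv (eq_zero_of_mul hf hgK hhK h5 hwx S)
    · -- a hermitian form of the second kind is not alternating: otherwise
      -- `H(v, y w) = y H(v, w)` and `H(y w, v) = σ(y) H(w, v)` give `(y - σ y) H(v, w) = 0`
      obtain ⟨v, hv, hpv, hvv⟩ : ∃ v, v * B.e = v ∧ p * v = v ∧ S.form B v v ≠ 0 := by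
        by_contra halt
        push Not at halt
        obtain ⟨v, w, hv, hw, hpv, hpw, hvw⟩ :=
          S.exists_form_ne_zero B hσ hp.comm hp.idem hp.symm hp0
        obtain ⟨y, hy, ⟨c, hc, hyc⟩, -⟩ := hσ.exists_center_generator h1
        have h2 := S.form_swap_of_alternating B halt hv hpv hw hpw
        have h3 := S.form_swap_of_alternating B halt hv hpv (w := y * w)
          (by rw [mul_assoc, hw]) (by rw [← mul_assoc, hy, mul_assoc, hpw])
        rw [S.form_mul_left B w v (fun k _ => hy k), S.form_central_right B hy,
          S.form_central_right B (commutes_apply hy), h2, mul_neg, neg_inj] at h3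
        have h4 : (y - σ y) * ((y - σ y) * S.form B v w) = 0 := by
          rw [sub_mul y _ (S.form B v w), h3, sub_self, mul_zero]
        rw [← mul_assoc, hyc, smul_one_mul] at h4
        exact hvw ((smul_eq_zero.1 h4).resolve_left hc)
      obtain ⟨q, k, hq, -, -, hq0, -, hqp, hr⟩ :=
        S.exists_atom_of_anisotropic B hσ hf hv (mul_eq_of_mul_eq hfp hpv) hvv
      obtain ⟨hpq, hqp⟩ := hqp p hp hpv
      exact ⟨q, ⟨hq, hq0, hr⟩, hpq, hqp, hp.sub hq hpq hqp, hfsub q hpq, fun h => (h1 h).elim⟩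
  · by_contra hcon
    push Not at hcon
    obtain ⟨hε, m, q, hq, -, hsum⟩ := S.exists_atoms_of_alternating B hσ h1 hf hcon.2
    exact hnd h1 ⟨hε, hsum ▸ Submodule.sum_mem _ fun t _ => (hq t).2.2.2⟩

end SymSep

end FInvolution

/-! ### Symmetric idempotents for neat subalgebras -/

namespace FInvolution

variable {F : Type u} {A : Type v} [Field F] [Ring A] [Algebra F A]

/-- The primitive idempotents of an étale algebra are the units of its factors. -/
theorem exists_isPrimitive {K : Subalgebra F A} (he : IsEtaleAlgebra F K) :
    ∃ (s : ℕ) (f : Fin s → A), (∀ i, IsPrimitive K (f i)) ∧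
      (∀ i j, f i * f j = if i = j then f i else 0) ∧ ∑ i, f i = 1 := by
  obtain ⟨s, E, hE, hE', -, ⟨φ⟩⟩ := he
  have horth : ∀ i j, φ.symm (Pi.single i 1) * φ.symm (Pi.single j 1) =
      if i = j then φ.symm (Pi.single i 1) else 0 := by
    intro i j
    rw [← map_mul]
    split_ifs with h
    · subst h
      rw [← Pi.single_mul, one_mul]
    · rw [← map_zero φ.symm]
      congr 1
      funext k
      by_cases hk : k = i
      · subst hk
        simp [h]
      · simp [hk]
  refine ⟨s, fun i => (φ.symm (Pi.single i 1)).1, fun i => ⟨(φ.symm _).2, ?_, ?_, ?_⟩, ?_, ?_⟩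
  · have := congrArg Subtype.val (horth i i)
    rwa [if_pos rfl] at this
  · intro h
    have h1 : φ.symm (Pi.single i 1) = 0 := Subtype.ext h
    rw [map_eq_zero_iff _ φ.symm.injective, Pi.single_eq_zero_iff] at h1
    exact one_ne_zero h1
  · rintro k ⟨hk, hkf⟩ hk0
    obtain ⟨x, hx⟩ : ∃ x, φ.symm x = ⟨k, hk⟩ := φ.symm.surjective _
    have hxi : Pi.single i (x i) = x := by
      apply φ.symm.injective
      have h1 : x * Pi.single i 1 = Pi.single i (x i) := by
        rw [← Pi.single_mul_right, mul_one]
      rw [← h1, map_mul, hx]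
      exact Subtype.ext hkf
    have hxi0 : x i ≠ 0 := by
      intro h
      rw [h, Pi.single_zero] at hxi
      rw [← hxi, map_zero] at hx
      exact hk0 (congrArg Subtype.val hx).symm
    have hmul : ∀ a b : E i, φ.symm (Pi.single i a) * φ.symm (Pi.single i b) =
        φ.symm (Pi.single i (a * b)) := fun a b => by rw [← map_mul, ← Pi.single_mul]
    refine ⟨(φ.symm (Pi.single i (x i)⁻¹)).1, mem_cornerOf.2 ⟨(φ.symm _).2, ?_⟩, ?_⟩
    · have := congrArg Subtype.val (hmul (x i)⁻¹ 1)
      rwa [mul_one] at this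
    · have := congrArg Subtype.val (hmul (x i)⁻¹ (x i))
      rwa [hxi, hx, inv_mul_cancel₀ hxi0] at this
  · intro i j
    have := congrArg Subtype.val (horth i j)
    split_ifs with h
    · rwa [if_pos h] at this
    · rwa [if_neg h] at this
  · have h1 : ∑ i, φ.symm (Pi.single i 1) = 1 := by
      rw [← map_sum, ← map_one φ.symm]
      congr 1
      exact Finset.univ_sum_single (1 : ∀ i, E i)
    have := congrArg Subtype.val h1
    rwa [AddSubmonoidClass.coe_finsetSum] at this

/-- If `A` is free as a `K`-module, then `f A` is free over `K f` of the same rank. -/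
theorem exists_finrank_peirce_eq [FiniteDimensional F A] {K : Subalgebra F A}
    (hc : ∀ x ∈ K, ∀ y ∈ K, x * y = y * x) (hfree : Module.Free K A) :
    ∃ r, ∀ f ∈ K, f * f = f →
      Module.finrank F (LinearMap.range (peirce F f 1)) = r * Module.finrank F (cornerOf K f) := by
  have : Module.Finite K A := Module.Finite.of_restrictScalars_finite F K A
  obtain ⟨ι, _, ⟨b⟩⟩ : ∃ (ι : Type v) (_ : Fintype ι), Nonempty (Module.Basis ι K A) := by
    rcases subsingleton_or_nontrivial K with h | h
    · have : Subsingleton A := Module.subsingleton K A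
      exact ⟨PEmpty, inferInstance, ⟨Module.Basis.empty A⟩⟩
    · exact ⟨_, inferInstance, ⟨Module.Free.chooseBasis K A⟩⟩
  refine ⟨Fintype.card ι, fun f hf hff => ?_⟩
  let φ : (ι → cornerOf K f) →ₗ[F] A :=
    ∑ j, LinearMap.mulRight F (b j) ∘ₗ (cornerOf K f).subtype ∘ₗ LinearMap.proj j
  have hφ : ∀ l, φ l = ∑ j, (l j).1 * b j := fun l => by
    simp only [φ, LinearMap.sum_apply]
    rfl
  have hi : Function.Injective φ := by
    rw [injective_iff_map_eq_zero]
    intro l hl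
    rw [hφ] at hl
    funext j
    have h1 := Fintype.linearIndependent_iff.1 b.linearIndependent
      (fun j => ⟨(l j).1, (l j).2.1⟩) hl j
    exact Subtype.ext (Subtype.ext_iff.1 h1 : _)
  have hr : LinearMap.range φ = LinearMap.range (peirce F f 1) := by
    ext x
    constructor
    · rintro ⟨l, rfl⟩
      refine ⟨φ l, ?_⟩
      rw [peirce_apply, mul_one, hφ, Finset.mul_sum]
      exact Finset.sum_congr rfl fun j _ => by
        rw [← mul_assoc, hc f hf _ (l j).2.1, (mem_cornerOf.1 (l j).2).2]
    · rintro ⟨x, rfl⟩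
      refine ⟨fun j => ⟨f * (b.repr x j).1, mem_cornerOf.2 ⟨K.mul_mem hf (b.repr x j).2, ?_⟩⟩, ?_⟩
      · rw [hc f hf _ (b.repr x j).2, mul_assoc, hff]
      · rw [hφ, peirce_apply, mul_one]
        have h1 : x = ∑ j, (b.repr x j).1 * b j := (b.sum_repr x).symm
        conv_rhs => rw [h1, Finset.mul_sum]
        exact Finset.sum_congr rfl fun j _ => mul_assoc _ _ _
  rw [← hr, LinearMap.finrank_range_of_inj hi, Module.finrank_pi_fintype]
  simp

theorem finrank_cornerOf_sum [FiniteDimensional F A] {K : Subalgebra F A} {ι : Type*} [Fintype ι]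
    [DecidableEq ι] {f : ι → A} (hf : ∀ i, f i ∈ K)
    (horth : ∀ i j, f i * f j = if i = j then f i else 0) :
    Module.finrank F (cornerOf K (∑ i, f i)) = ∑ i, Module.finrank F (cornerOf K (f i)) := by
  let φ : (∀ i, cornerOf K (f i)) →ₗ[F] A := ∑ i, (cornerOf K (f i)).subtype ∘ₗ LinearMap.proj i
  have hφ : ∀ l, φ l = ∑ i, (l i).1 := fun l => by
    simp only [φ, LinearMap.sum_apply]
    rfl
  have hl : ∀ (l : ∀ i, cornerOf K (f i)) i j, (l i).1 * f j = if i = j then (l i).1 else 0 := by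
    intro l i j
    rw [← (mem_cornerOf.1 (l i).2).2, mul_assoc, horth]
    split_ifs <;> simp
  have hi : Function.Injective φ := by
    rw [injective_iff_map_eq_zero]
    intro l h
    funext i
    apply Subtype.ext
    have h1 := congrArg (· * f i) h
    simpa [hφ, Finset.sum_mul, hl] using h1
  have hr : LinearMap.range φ = cornerOf K (∑ i, f i) := by
    ext x
    constructor
    · rintro ⟨l, rfl⟩
      rw [hφ]
      refine mem_cornerOf.2 ⟨K.sum_mem fun i _ => (l i).2.1, ?_⟩
      rw [Finset.sum_mul]
      refine Finset.sum_congr rfl fun i _ => ?_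
      rw [Finset.mul_sum]
      simp [hl]
    · intro hx
      obtain ⟨hx, hxs⟩ := mem_cornerOf.1 hx
      refine ⟨fun i => ⟨x * f i, mem_cornerOf.2 ⟨K.mul_mem hx (hf i), ?_⟩⟩, ?_⟩
      · rw [mul_assoc, horth, if_pos rfl]
      · rw [hφ, ← Finset.mul_sum, hxs]
  rw [← hr, LinearMap.finrank_range_of_inj hi, Module.finrank_pi_fintype]

theorem cornerOf_one (K : Subalgebra F A) : cornerOf K 1 = Subalgebra.toSubmodule K := by
  ext x
  simp [mem_cornerOf]

theorem finrank_eq_sum_cornerOf [FiniteDimensional F A] {K : Subalgebra F A}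
    {s : ℕ} {f : Fin s → A} (hf : ∀ i, f i ∈ K)
    (horth : ∀ i j, f i * f j = if i = j then f i else 0)
    (hsum : ∑ i, f i = 1) :
    Module.finrank F K = ∑ i, Module.finrank F (cornerOf K (f i)) := by
  rw [← finrank_cornerOf_sum hf horth, hsum, cornerOf_one]
  rfl

theorem isField_center_of_isFirstKind [Nontrivial A] (h : IsFirstKind F A) :
    IsField (Subring.center A) where
  exists_pair_ne := ⟨0, 1, zero_ne_one⟩
  mul_comm := mul_comm
  mul_inv_cancel {x} hx := by
    obtain ⟨c, hc⟩ := h x.1 (Subring.mem_center_iff.1 x.2)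
    have hc0 : c ≠ 0 := fun h0 => hx (Subtype.ext (by rw [hc, h0, zero_smul]; rfl))
    refine ⟨⟨c⁻¹ • 1, Subring.mem_center_iff.2 fun y => by simp⟩, Subtype.ext ?_⟩
    change x.1 * (c⁻¹ • 1) = 1
    rw [hc, smul_mul_smul_comm, mul_one, mul_inv_cancel₀ hc0, one_smul]

/-- The two cases in the definition of the degree agree, because the center is two-dimensional if it
is not a field. -/
theorem IsAlgebraWithInvolution.degree_eq {σ : FInvolution F A}
    (hσ : σ.IsAlgebraWithInvolution) :
    σ.degree = Nat.sqrt (Module.finrank F A / Module.finrank F (Subalgebra.center F A)) := by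
  have := hσ.nontrivial
  have := hσ.finiteDimensional
  have hpos : 0 < Module.finrank F (Subalgebra.center F A) := by
    rcases hσ.finrank_center with ⟨-, h⟩ | ⟨-, h⟩ <;> omega
  rw [degree]
  split_ifs with hZ
  · have hZ' : IsField (Subalgebra.center F A) := by
      refine ⟨⟨0, 1, zero_ne_one⟩, mul_comm, fun {x} hx => ?_⟩
      obtain ⟨y, hy⟩ := hZ.mul_inv_cancel (a := ⟨x.1, x.2⟩)
        (fun h => hx (Subtype.ext (congrArg Subtype.val h)))
      exact ⟨⟨y.1, y.2⟩, Subtype.ext (congrArg Subtype.val hy)⟩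
    have h2 : Module.finrank (Subring.center A) A =
        Module.finrank (Subalgebra.center F A) A := by
      refine Algebra.finrank_eq_of_equiv_equiv (RingEquiv.refl (Subring.center A))
        (RingEquiv.refl A) ?_
      rfl
    let := hZ'.toField
    have h3 := Module.finrank_mul_finrank F (Subalgebra.center F A) A
    rw [h2, ← h3, Nat.mul_div_cancel_left _ hpos]
  · rcases hσ.finrank_center with ⟨h1, -⟩ | ⟨-, h1⟩
    · exact absurd (isField_center_of_isFirstKind h1) hZ
    · rw [h1]

namespace Frame

variable {σ : FInvolution F A} (B : Frame σ)

theorem degree_eq (hσ : σ.IsAlgebraWithInvolution) : σ.degree = B.n := by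
  have := hσ.finiteDimensional
  have hpos : 0 < Module.finrank F (Subalgebra.center F A) := by
    rcases hσ.finrank_center with ⟨-, h⟩ | ⟨-, h⟩ <;> omega
  rw [hσ.degree_eq, B.finrank_eq, ← mul_assoc, Nat.mul_div_cancel _ hpos, Nat.sqrt_eq]

/-- The involution is symplectic if and only if it is of the first kind and the form is alternating,
that is, skew-symmetric with `1` a symmetrized element. -/
theorem type_eq_symplectic_iff (hσ : σ.IsAlgebraWithInvolution) :
    σ.type = .symplectic ↔ IsFirstKind F A ∧ B.ε = -1 ∧ (1 : A) ∈ σ.symd := by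
  have := hσ.nontrivial
  have := hσ.finiteDimensional
  rw [hσ.type_eq]
  by_cases h1 : IsFirstKind F A
  · rw [if_pos h1, B.skewDominant_iff h1 (mul_one 1) σ.apply_one one_ne_zero]
    by_cases h2 : B.ε = -1 ∧ (1 : A) ∈ σ.symd
    · simp [h1, h2]
    · rw [if_neg h2]
      simp [h2]
  · simp [h1]

/-- The condition on types in the definition of neat subalgebras: the form is alternating on `e V`
if and only if it is alternating on `V`. -/
theorem type_restrictCorner_eq_iff (hσ : σ.IsAlgebraWithInvolution) {e : A}
    (he : IsIdempotentElem e) (hs : e ∈ σ.symm) (h0 : e ≠ 0) :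
    (σ.restrictCorner he hs).type = σ.type ↔
      (IsFirstKind F A → B.ε = -1 → (e ∈ σ.symd ↔ (1 : A) ∈ σ.symd)) := by
  have := hσ.nontrivial
  have := hσ.finiteDimensional
  rw [hσ.type_eq, hσ.type_restrictCorner he hs h0]
  by_cases h1 : IsFirstKind F A
  · rw [if_pos h1, if_pos h1, B.skewDominant_iff h1 (mul_one 1) σ.apply_one one_ne_zero,
      B.skewDominant_iff h1 he hs h0]
    by_cases h2 : B.ε = -1
    · by_cases h3 : e ∈ σ.symd <;> by_cases h4 : (1 : A) ∈ σ.symd <;> simp [h1, h2, h3, h4]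
    · simp [h2]
  · simp [h1]

/-- Families of atoms of the corners `f_i` of equal length add up to idempotents on which `K` acts
faithfully. -/
theorem exists_idempotents_of_atoms (hσ : σ.IsAlgebraWithInvolution) {K : Subalgebra F A}
    (hc : ∀ x ∈ K, ∀ y ∈ K, x * y = y * x) (hfree : Module.Free K A) {s : ℕ} {f : Fin s → A}
    (hf : ∀ i, IsPrimitive K (f i)) (horth : ∀ i j, f i * f j = if i = j then f i else 0)
    (hsum : ∑ i, f i = 1) {δ : ℕ} (hδ : δ ≠ 0) {N : Submodule F A}
    (h : ∀ i, ∃ (m : ℕ) (q : Fin m → A), (∀ t, SymIdempotent σ K (q t) ∧ q t ≠ 0 ∧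
        B.rank (q t) = δ * Module.finrank F (cornerOf K (f i)) ∧ q t ∈ N) ∧
      (∀ s t, q s * q t = if s = t then q s else 0) ∧ ∑ t, q t = f i) :
    ∃ (m : ℕ) (P : Fin m → A), (∀ t, SymIdempotent σ K (P t) ∧ P t ∈ N ∧
        ∀ k ∈ K, k * P t = 0 → k = 0) ∧
      (∀ s t, P s * P t = if s = t then P s else 0) ∧ ∑ t, P t = 1 ∧
      m * δ * Module.finrank F K = B.rank 1 := by
  have := hσ.nontrivial
  have := hσ.finiteDimensional
  obtain ⟨r, hr⟩ := exists_finrank_peirce_eq hc hfree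
  choose m q hq hqorth hqsum using h
  have hs : s ≠ 0 := by
    rintro rfl
    simp at hsum
  have hn : B.n ≠ 0 := by
    intro h0
    have := B.finrank_eq
    rw [h0, zero_mul] at this
    exact Module.finrank_pos.ne' this
  have hrank : ∀ i, B.rank (f i) = m i * (δ * Module.finrank F (cornerOf K (f i))) := fun i => by
    have h1 := B.rank_sum (hqorth i)
    rw [hqsum i, Finset.sum_congr rfl fun t _ => (hq i t).2.2.1] at h1
    simpa using h1
  have hd : ∀ i, Module.finrank F (cornerOf K (f i)) ≠ 0 := fun i h0 => by
    rw [Submodule.finrank_eq_zero] at h0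
    have : f i ∈ cornerOf K (f i) := mem_cornerOf.2 ⟨(hf i).mem, (hf i).idem⟩
    rw [h0] at this
    exact (hf i).ne_zero this
  -- `A` is free over `K`, so the length of the family of atoms does not depend on `i`
  have hm : ∀ i, B.n * (m i * δ) = r := fun i => by
    have h1 := hr (f i) (hf i).mem (hf i).idem
    rw [B.finrank_peirce_one, hrank] at h1
    refine Nat.eq_of_mul_eq_mul_right (Nat.pos_of_ne_zero (hd i)) ?_
    rw [← h1]
    ring
  obtain ⟨m₀, rfl⟩ : ∃ m₀, m = fun _ => m₀ := by
    refine ⟨m ⟨0, Nat.pos_of_ne_zero hs⟩, funext fun i => ?_⟩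
    have h1 := (hm i).trans (hm ⟨0, Nat.pos_of_ne_zero hs⟩).symm
    exact Nat.eq_of_mul_eq_mul_right (Nat.pos_of_ne_zero hδ)
      (Nat.eq_of_mul_eq_mul_left (Nat.pos_of_ne_zero hn) h1)
  have hfq : ∀ i t, f i * q i t = q i t := fun i t => by
    rw [← hqsum i]
    simp [Finset.sum_mul, hqorth]
  have hqf : ∀ i t, q i t * f i = q i t := fun i t => by
    rw [← hqsum i]
    simp [Finset.mul_sum, hqorth]
  have hqq : ∀ i j s t, q i s * q j t = if i = j then (if s = t then q i s else 0) else 0 := by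
    intro i j s t
    split_ifs with h1 h2
    · subst h1 h2
      exact (hq _ _).1.idem
    · subst h1
      rw [hqorth, if_neg h2]
    · rw [← hqf, ← hfq j, mul_assoc, ← mul_assoc (f i), horth, if_neg h1, zero_mul, mul_zero]
  refine ⟨m₀, fun t => ∑ i, q i t, fun t => ⟨⟨?_, ?_, fun k hk => ?_⟩, ?_, fun k hk h0 => ?_⟩,
    fun s t => ?_, ?_, ?_⟩
  · simp [Finset.sum_mul, Finset.mul_sum, hqq]
  · rw [map_sum]
    exact Finset.sum_congr rfl fun i _ => (hq i t).1.symm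
  · rw [Finset.sum_mul, Finset.mul_sum]
    exact Finset.sum_congr rfl fun i _ => (hq i t).1.comm k hk
  · exact N.sum_mem fun i _ => (hq i t).2.2.2
  · rw [← mul_one k, ← hsum, Finset.mul_sum]
    refine Finset.sum_eq_zero fun i _ => ?_
    by_contra hki
    obtain ⟨l, -, hl⟩ := (hf i).exists_inv (k * f i)
      (mem_cornerOf.2 ⟨K.mul_mem hk (hf i).mem, by rw [mul_assoc, (hf i).idem]⟩) hki
    have h1 : f i * ∑ j, q j t = q i t := by
      rw [Finset.mul_sum, Finset.sum_eq_single i, hfq]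
      · intro j _ hj
        rw [← hfq j, ← mul_assoc, horth, if_neg hj.symm, zero_mul]
      · simp
    apply (hq i t).2.1
    rw [← hfq, ← hl, mul_assoc, mul_assoc, hfq, ← h1, ← mul_assoc k, hc k hk _ (hf i).mem,
      mul_assoc, h0, mul_zero, mul_zero]
  · by_cases h1 : s = t
    · subst h1
      simp [Finset.sum_mul, Finset.mul_sum, hqq]
    · simp [Finset.sum_mul, Finset.mul_sum, hqq, h1]
  · rw [Finset.sum_comm]
    simp [hqsum, hsum]
  · rw [← hsum, B.rank_sum horth, finrank_eq_sum_cornerOf (fun i => (hf i).mem) horth hsum,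
      Finset.mul_sum]
    exact Finset.sum_congr rfl fun i _ => by rw [hrank]; ring

/-- If the algebra has a frame and `K` is neat, then `1` is a sum of orthogonal symmetric
idempotents commuting with `K`, on each of which `K` acts faithfully. Their number is the quotient
of the capacity and the dimension of `K`. -/
theorem exists_idempotents (B : Frame σ) (hσ : σ.IsAlgebraWithInvolution) {K : Subalgebra F A}
    (hc : ∀ x ∈ K, ∀ y ∈ K, x * y = y * x) (hK : σ.IsNeat K) :
    ∃ (m : ℕ) (P : Fin m → A), (∀ t, SymIdempotent σ K (P t) ∧
        (σ.type = .symplectic → P t ∈ σ.symd) ∧ ∀ k ∈ K, k * P t = 0 → k = 0) ∧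
      (∀ s t, P s * P t = if s = t then P s else 0) ∧ ∑ t, P t = 1 ∧
      m * Module.finrank F K = σ.capacity := by
  have := hσ.nontrivial
  have := hσ.finiteDimensional
  obtain ⟨S⟩ := exists_symSep hc (fun x hx => hK.le_symm hx) hK.etale
  obtain ⟨s, f, hf, horth, hsum⟩ := exists_isPrimitive hK.etale
  have htype := fun i => (B.type_restrictCorner_eq_iff hσ (hf i).idem (hK.le_symm (hf i).mem)
    (hf i).ne_zero).1 (hK.type_eq _ _ (hf i).mem (hf i).ne_zero)
  by_cases hs : σ.type = .symplectic
  · obtain ⟨h1, hε, hd⟩ := (B.type_eq_symplectic_iff hσ).1 hs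
    obtain ⟨m, P, hP, h2, h3, h4⟩ := B.exists_idempotents_of_atoms hσ hc hK.free hf horth hsum
      two_ne_zero (N := σ.symd) fun i => (S.exists_atoms_of_alternating B hσ h1 (hf i)
        fun v hv hfv => S.form_self_eq_zero B h1 hε (S.comm_mem (hf i).mem)
          ((htype i h1 hε).2 hd) hv hfv).2
    refine ⟨m, P, fun t => ⟨(hP t).1, fun _ => (hP t).2.1, (hP t).2.2⟩, h2, h3, ?_⟩
    have h5 : Module.finrank F (Subalgebra.center F A) = 1 := by
      rcases hσ.finrank_center with ⟨-, h⟩ | ⟨h, -⟩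
      · exact h
      · exact absurd h1 h
    rw [B.rank_one, h5, mul_one] at h4
    simp only [capacity, hs]
    rw [B.degree_eq hσ, ← h4]
    refine (Nat.div_eq_of_eq_mul_left two_pos ?_).symm
    ring
  · have hδ : Module.finrank F (Subalgebra.center F A) ≠ 0 := by
      rcases hσ.finrank_center with ⟨-, h⟩ | ⟨-, h⟩ <;> omega
    obtain ⟨m, P, hP, h2, h3, h4⟩ := B.exists_idempotents_of_atoms hσ hc hK.free hf horth hsum
      hδ (N := ⊤) fun i => by
        obtain ⟨m, q, hq, h5, h6⟩ := S.exists_atoms B hσ (hf i) fun h1 ⟨hε, hd⟩ =>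
          hs ((B.type_eq_symplectic_iff hσ).2 ⟨h1, hε, (htype i h1 hε).1 hd⟩)
        exact ⟨m, q, fun t => ⟨(hq t).1, (hq t).2.1, (hq t).2.2, trivial⟩, h5, h6⟩
    refine ⟨m, P, fun t => ⟨(hP t).1, fun h => absurd h hs, (hP t).2.2⟩, h2, h3, ?_⟩
    have h5 : σ.capacity = B.n := by
      rw [capacity]
      rcases h : σ.type with _ | _ | _
      · exact B.degree_eq hσ
      · exact absurd h hs
      · exact B.degree_eq hσ
    rw [h5]
    rw [B.rank_one] at h4
    refine Nat.eq_of_mul_eq_mul_right (Nat.pos_of_ne_zero hδ) ?_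
    rw [← h4]
    ring

end Frame

end FInvolution

/-! ### The overalgebra generated by symmetric idempotents -/

namespace FInvolution

variable {F : Type u} {A : Type v} [Field F] [Ring A] [Algebra F A]

/-- The commutative ring structure on a subalgebra whose elements commute. -/
abbrev commRingOf (K : Subalgebra F A) (hc : ∀ x ∈ K, ∀ y ∈ K, x * y = y * x) : CommRing K :=
  { (inferInstance : Ring K) with
    mul_comm := fun x y => Subtype.ext (hc x.1 x.2 y.1 y.2) }

theorem _root_.IsEtaleAlgebra.of_algEquiv {B C : Type v} [Ring B] [Algebra F B] [Ring C]
    [Algebra F C] (h : IsEtaleAlgebra F B) (e : B ≃ₐ[F] C) : IsEtaleAlgebra F C := by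
  obtain ⟨n, E, h1, h2, h3, ⟨φ⟩⟩ := h
  exact ⟨n, E, h1, h2, h3, ⟨e.symm.trans φ⟩⟩

theorem _root_.IsEtaleAlgebra.pi {K : Subalgebra F A} (hc : ∀ x ∈ K, ∀ y ∈ K, x * y = y * x)
    (h : IsEtaleAlgebra F K) (m : ℕ) : IsEtaleAlgebra F (Fin m → K) := by
  let inst : CommRing K := commRingOf K hc
  have h1 : Algebra.Etale F K := (isEtaleAlgebra_iff_etale F K).1 h
  exact (isEtaleAlgebra_iff_etale F (Fin m → K)).2 inferInstance

theorem _root_.IsSplitEtaleAlgebra.pi {B : Type v} [Ring B] [Algebra F B]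
    (h : IsSplitEtaleAlgebra F B) (m : ℕ) : IsSplitEtaleAlgebra F (Fin m → B) := by
  obtain ⟨n, ⟨e⟩⟩ := h
  let c : (Fin m → Fin n → F) ≃ₐ[F] (Fin m × Fin n → F) :=
    { (Equiv.curry (Fin m) (Fin n) F).symm with
      map_mul' := fun _ _ => rfl
      map_add' := fun _ _ => rfl
      commutes' := fun _ => rfl }
  exact ⟨m * n, ⟨(AlgEquiv.piCongrRight fun _ => e).trans (c.trans
    (AlgEquiv.piCongrLeft F (fun _ => F) finProdFinEquiv))⟩⟩

/-- Orthogonal symmetric idempotents `P_t` with sum one that commute with `K`, and on each of which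
`K` acts faithfully, provide the overalgebra `∑ K P_t ≅ K^m` of `K`. -/
theorem exists_subalgebra_of_idempotents {σ : FInvolution F A} {K : Subalgebra F A}
    (hs : ∀ x ∈ K, σ x = x) {m : ℕ} {P : Fin m → A}
    (hP : ∀ t, SymIdempotent σ K (P t)) (hf : ∀ t, ∀ k ∈ K, k * P t = 0 → k = 0)
    (horth : ∀ s t, P s * P t = if s = t then P s else 0) (hsum : ∑ t, P t = 1) :
    ∃ (L : Subalgebra F A) (hKL : K ≤ L), Nonempty ((Fin m → K) ≃ₐ[F] L) ∧
      Subalgebra.toSubmodule L ≤ σ.symm ∧ K.IsFreeOver L hKL := by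
  let φ : (Fin m → K) →ₗ[F] A := ∑ t, LinearMap.mulRight F (P t) ∘ₗ
    (Subalgebra.toSubmodule K).subtype ∘ₗ LinearMap.proj t
  have hφ : ∀ l, φ l = ∑ t, (l t).1 * P t := fun l => by
    simp only [φ, LinearMap.sum_apply]
    rfl
  have hmul : ∀ l t, φ l * P t = (l t).1 * P t := fun l t => by
    rw [hφ, Finset.sum_mul, Finset.sum_eq_single t]
    · rw [mul_assoc, (hP t).idem]
    · intro s _ hst
      rw [mul_assoc, horth, if_neg hst, mul_zero]
    · simp
  have hconst : ∀ k : K, φ (fun _ => k) = k := fun k => by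
    rw [hφ, ← Finset.mul_sum, hsum, mul_one]
  let ψ : (Fin m → K) →ₐ[F] A := AlgHom.ofLinearMap φ (hconst 1) fun x y => by
    rw [hφ y, Finset.mul_sum, hφ]
    refine Finset.sum_congr rfl fun t _ => ?_
    rw [(hP t).comm _ (y t).2, ← mul_assoc, hmul, mul_assoc, ← (hP t).comm _ (y t).2, ← mul_assoc]
    rfl
  have hi : Function.Injective ψ := by
    rw [injective_iff_map_eq_zero]
    intro l hl
    funext t
    apply Subtype.ext
    refine hf t _ (l t).2 ?_
    rw [← hmul]
    exact (congrArg (· * P t) hl).trans (zero_mul _)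
  have hKL : K ≤ ψ.range := fun k hk => ⟨fun _ => ⟨k, hk⟩, hconst ⟨k, hk⟩⟩
  refine ⟨ψ.range, hKL, ⟨AlgEquiv.ofInjective ψ hi⟩, ?_, ?_⟩
  · rintro _ ⟨l, rfl⟩
    change σ (φ l) = φ l
    rw [hφ, map_sum]
    refine Finset.sum_congr rfl fun t _ => ?_
    rw [apply_mul, (hP t).symm, hs _ (l t).2, (hP t).comm _ (l t).2]
  · let inst : Module K ψ.range := Module.compHom ψ.range (Subalgebra.inclusion hKL).toRingHom
    have h : ∀ (k : K) (l : Fin m → K), AlgEquiv.ofInjective ψ hi (k • l) =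
        k • AlgEquiv.ofInjective ψ hi l := fun k l => by
      apply Subtype.ext
      change φ (k • l) = k.1 * φ l
      rw [hφ, hφ, Finset.mul_sum]
      exact Finset.sum_congr rfl fun t _ => mul_assoc _ _ _
    let e : (Fin m → K) ≃ₗ[K] ψ.range :=
      { (AlgEquiv.ofInjective ψ hi).toLinearEquiv with map_smul' := h }
    exact Module.Free.of_equiv e

theorem finrank_eq_of_algEquiv_pi [FiniteDimensional F A] {K L : Subalgebra F A} {m : ℕ}
    (e : (Fin m → K) ≃ₐ[F] L) :
    Module.finrank F L = m * Module.finrank F K := by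
  rw [← e.toLinearEquiv.finrank_eq, Module.finrank_pi_fintype]
  simp

end FInvolution

/-! ### Neat subalgebras under scalar extension -/

namespace FInvolution

open TensorProduct

variable {F : Type u} {A : Type v} [Field F] [Ring A] [Algebra F A]

section Coordinates

variable {E : Type w} [Field E] [Algebra F E] {ι : Type w} {β : Module.Basis ι F E}
  {r : E ⊗[F] A ≃ₗ[F] (ι →₀ A)}

/-- The involution acts on elements of `E ⊗ A` coordinate by coordinate. -/
theorem coord_apply (hr : ∀ c a i, r (c ⊗ₜ a) i = β.repr c i • a) (σ : FInvolution F A)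
    (x : E ⊗[F] A) (i : ι) : r (σ.baseChange E x) i = σ (r x i) := by
  induction x using TensorProduct.induction_on with
  | zero => simp
  | add x y hx hy => simp [hx, hy]
  | tmul c a => simp [hr]

theorem coord_mem (hr : ∀ c a i, r (c ⊗ₜ a) i = β.repr c i • a) {K : Subalgebra F A}
    {x : E ⊗[F] A} (hx : x ∈ K.baseChange E) (i : ι) : r x i ∈ K := by
  obtain ⟨y, rfl⟩ := hx
  induction y using TensorProduct.induction_on with
  | zero => simp
  | add x y hx hy =>
    rw [map_add, map_add]
    exact K.add_mem hx hy
  | tmul c a =>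
    have : r (c ⊗ₜ[F] a.1) i ∈ K := by
      rw [hr]
      exact K.smul_mem a.2 _
    exact this

theorem coord_symd (hr : ∀ c a i, r (c ⊗ₜ a) i = β.repr c i • a) {σ : FInvolution F A}
    {x : E ⊗[F] A} (hx : x ∈ (σ.baseChange E).symd) (i : ι) : r x i ∈ σ.symd := by
  obtain ⟨y, rfl⟩ := mem_symd.1 hx
  rw [map_add, Finsupp.add_apply, coord_apply hr]
  exact mem_symd.2 ⟨_, rfl⟩

end Coordinates

section

variable (E : Type w) [Field E] [Algebra F E]

theorem tmul_mem_symd {σ : FInvolution F A} {x : A} (hx : x ∈ σ.symd) (c : E) :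
    c ⊗ₜ x ∈ (σ.baseChange E).symd := by
  obtain ⟨y, rfl⟩ := mem_symd.1 hx
  exact mem_symd.2 ⟨c ⊗ₜ y, by rw [baseChange_tmul, TensorProduct.tmul_add]⟩

theorem one_mem_symd_baseChange {σ : FInvolution F A} :
    1 ∈ (σ.baseChange E).symd ↔ (1 : A) ∈ σ.symd := by
  constructor
  · intro h
    obtain ⟨ι, β, r, hr, -⟩ := exists_tmul_coordinates (F := F) E A
    obtain ⟨i, hi⟩ : ∃ i, β.repr 1 i ≠ 0 := by
      by_contra hcon
      push Not at hcon
      exact one_ne_zero (β.repr.map_eq_zero_iff.1 (Finsupp.ext hcon))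
    have h1 := coord_symd hr h i
    rw [Algebra.TensorProduct.one_def, hr] at h1
    have h2 := Submodule.smul_mem _ (β.repr 1 i)⁻¹ h1
    rwa [smul_smul, inv_mul_cancel₀ hi, one_smul] at h2
  · exact fun h => tmul_mem_symd E h 1

theorem IsAlgebraWithInvolution.type_baseChange {σ : FInvolution F A}
    (hσ : σ.IsAlgebraWithInvolution) : (σ.baseChange E).type = σ.type := by
  rw [hσ.type_eq, (hσ.baseChange E).type_eq, one_mem_symd_baseChange, isFirstKind_tmul,
    Algebra.TensorProduct.one_def, skewDominant_tmul]

theorem IsAlgebraWithInvolution.finrank_center_baseChange {σ : FInvolution F A}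
    (hσ : σ.IsAlgebraWithInvolution) :
    Module.finrank E (Subalgebra.center E (E ⊗[F] A)) =
      Module.finrank F (Subalgebra.center F A) := by
  rcases hσ.finrank_center with ⟨h1, h2⟩ | ⟨h1, h2⟩ <;>
  rcases (hσ.baseChange E).finrank_center with ⟨h3, h4⟩ | ⟨h3, h4⟩ <;>
  rw [isFirstKind_tmul] at h3 <;> first | contradiction | rw [h2, h4]

theorem IsAlgebraWithInvolution.capacity_baseChange {σ : FInvolution F A}
    (hσ : σ.IsAlgebraWithInvolution) : (σ.baseChange E).capacity = σ.capacity := by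
  have h : (σ.baseChange E).degree = σ.degree := by
    rw [(hσ.baseChange E).degree_eq, hσ.degree_eq, hσ.finrank_center_baseChange E,
      Module.finrank_baseChange]
  simp only [capacity, h, hσ.type_baseChange E]

/-- An algebraically closed field has no nontrivial finite-dimensional division algebras. -/
theorem IsAlgebraWithInvolution.exists_frame_of_isAlgClosed [IsAlgClosed F] {σ : FInvolution F A}
    (hσ : σ.IsAlgebraWithInvolution) : Nonempty (Frame σ) := by
  refine (hσ.isUnitSplit ?_).exists_frame hσ
  intro D _ _ _ x y
  obtain ⟨c, rfl⟩ := (IsAlgClosed.algebraMap_bijective_of_isIntegral (k := F) (K := D)).2 x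
  exact Algebra.commutes c y

/-- The base change of a subalgebra is its tensor product with the larger field. -/
noncomputable def baseChangeEquiv (K : Subalgebra F A) : E ⊗[F] K ≃ₐ[E] K.baseChange E :=
  AlgEquiv.ofInjective (Algebra.TensorProduct.map (AlgHom.id E E) K.val)
    (Module.Flat.lTensor_preserves_injective_linearMap (M := E) K.val.toLinearMap
      Subtype.val_injective)

theorem finrank_subalgebra_baseChange (K : Subalgebra F A) :
    Module.finrank E (K.baseChange E) = Module.finrank F K := by
  rw [← (baseChangeEquiv E K).toLinearEquiv.finrank_eq, Module.finrank_baseChange]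

theorem _root_.IsEtaleAlgebra.baseChange {K : Subalgebra F A}
    (hc : ∀ x ∈ K, ∀ y ∈ K, x * y = y * x) (h : IsEtaleAlgebra F K) :
    IsEtaleAlgebra E (K.baseChange E) := by
  let inst : CommRing K := commRingOf K hc
  have h1 : Algebra.Etale F K := (isEtaleAlgebra_iff_etale F K).1 h
  have h2 : IsEtaleAlgebra E (E ⊗[F] K) :=
    (isEtaleAlgebra_iff_etale E (E ⊗[F] K)).2 inferInstance
  exact h2.of_algEquiv (baseChangeEquiv E K)

theorem baseChange_comm {K : Subalgebra F A} (hc : ∀ x ∈ K, ∀ y ∈ K, x * y = y * x) :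
    ∀ x ∈ K.baseChange E, ∀ y ∈ K.baseChange E, x * y = y * x := by
  let inst : CommRing K := commRingOf K hc
  rintro _ ⟨x, rfl⟩ _ ⟨y, rfl⟩
  have : x * y = y * x := mul_comm x y
  exact (map_mul _ x y).symm.trans ((congrArg _ this).trans (map_mul _ y x))

theorem baseChange_symm {σ : FInvolution F A} {K : Subalgebra F A} (hs : ∀ x ∈ K, σ x = x) :
    ∀ x ∈ K.baseChange E, σ.baseChange E x = x := by
  rintro _ ⟨x, rfl⟩
  induction x using TensorProduct.induction_on with
  | zero => simp
  | add x y hx hy => rw [map_add, map_add, hx, hy]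
  | tmul c a =>
    change σ.baseChange E (c ⊗ₜ a.1) = c ⊗ₜ a.1
    rw [baseChange_tmul, hs _ a.2]

/-- Freeness of `A` over a subalgebra is preserved under scalar extension. -/
theorem free_baseChange [FiniteDimensional F A] {K : Subalgebra F A} (h : Module.Free K A) :
    Module.Free (K.baseChange E) (E ⊗[F] A) := by
  have : Module.Finite K A := Module.Finite.of_restrictScalars_finite F K A
  obtain ⟨ι, _, ⟨b⟩⟩ : ∃ (ι : Type v) (_ : Fintype ι), Nonempty (Module.Basis ι K A) := by
    rcases subsingleton_or_nontrivial K with h | h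
    · have : Subsingleton A := Module.subsingleton K A
      exact ⟨PEmpty, inferInstance, ⟨Module.Basis.empty A⟩⟩
    · exact ⟨_, inferInstance, ⟨Module.Free.chooseBasis K A⟩⟩
  let φ : (ι → K.baseChange E) →ₗ[E] E ⊗[F] A :=
    ∑ j, LinearMap.mulRight E (1 ⊗ₜ b j) ∘ₗ (Subalgebra.toSubmodule (K.baseChange E)).subtype ∘ₗ
      LinearMap.proj j
  have hφ : ∀ l, φ l = ∑ j, (l j).1 * (1 ⊗ₜ b j) := fun l => by
    simp only [φ, LinearMap.sum_apply]
    rfl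
  have hs : Function.Surjective φ := by
    rw [← LinearMap.range_eq_top, eq_top_iff]
    rintro x -
    induction x using TensorProduct.induction_on with
    | zero => exact Submodule.zero_mem _
    | add x y hx hy => exact Submodule.add_mem _ hx hy
    | tmul c a =>
      refine ⟨fun j => ⟨c ⊗ₜ (b.repr a j).1, Subalgebra.tmul_mem_baseChange (b.repr a j).2 c⟩, ?_⟩
      have h1 : a = ∑ j, (b.repr a j).1 * b j := (b.sum_repr a).symm
      conv_rhs => rw [h1, TensorProduct.tmul_sum]
      rw [hφ]
      exact Finset.sum_congr rfl fun j _ => by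
        rw [Algebra.TensorProduct.tmul_mul_tmul, mul_one]
  have hdim : Module.finrank E (ι → K.baseChange E) = Module.finrank E (E ⊗[F] A) := by
    have h1 : Module.finrank F (ι → K) = Module.finrank F A :=
      (b.equivFun.restrictScalars F).symm.finrank_eq
    rw [Module.finrank_pi_fintype] at h1 ⊢
    simp only [finrank_subalgebra_baseChange, Module.finrank_baseChange]
    exact h1
  have hi : Function.Injective φ := (LinearMap.injective_iff_surjective_of_finrank_eq_finrank
    hdim).2 hs
  let e : (ι → K.baseChange E) ≃ₗ[K.baseChange E] E ⊗[F] A :=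
    { LinearEquiv.ofBijective φ ⟨hi, hs⟩ with
      map_smul' := fun k l => by
        change φ (k • l) = k.1 * φ l
        rw [hφ, hφ, Finset.mul_sum]
        exact Finset.sum_congr rfl fun t _ => mul_assoc _ _ _ }
  exact Module.Free.of_equiv e

theorem one_tmul_ne_zero {a : A} (ha : a ≠ 0) : (1 : E) ⊗ₜ[F] a ≠ 0 := by
  intro h
  obtain ⟨ι, β, r, hr, -⟩ := exists_tmul_coordinates (F := F) E A
  obtain ⟨i, hi⟩ : ∃ i, β.repr 1 i ≠ 0 := by
    by_contra hcon
    push Not at hcon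
    exact one_ne_zero (β.repr.map_eq_zero_iff.1 (Finsupp.ext hcon))
  have h2 := hr 1 a i
  rw [h, map_zero] at h2
  exact ha ((smul_eq_zero.1 h2.symm).resolve_left hi)

variable {E} in
/-- The condition on types in the definition of neat subalgebras, read off from a frame over a
larger field. -/
theorem Frame.type_restrictCorner_eq_iff_of_baseChange {σ : FInvolution F A}
    (B : Frame (σ.baseChange E)) (hσ : σ.IsAlgebraWithInvolution) {e : A}
    (he : IsIdempotentElem e) (hs : e ∈ σ.symm) (h0 : e ≠ 0) :
    (σ.restrictCorner he hs).type = σ.type ↔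
      (IsFirstKind F A → B.ε = -1 → (e ∈ σ.symd ↔ (1 : A) ∈ σ.symd)) := by
  have := hσ.nontrivial
  have := hσ.finiteDimensional
  have hSD : IsFirstKind F A → ∀ p : A, p * p = p → σ p = p → p ≠ 0 →
      (σ.SkewDominant p ↔ B.ε = -1) := fun h1 p hp hps hp0 => by
    rw [← skewDominant_tmul E, B.skewDominant_iff ((isFirstKind_tmul E).2 h1) _ _
      (one_tmul_ne_zero E hp0)]
    · simp [hp]
    · simp [hps]
  rw [hσ.type_eq, hσ.type_restrictCorner he hs h0]
  by_cases h1 : IsFirstKind F A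
  · rw [if_pos h1, if_pos h1, hSD h1 1 (mul_one 1) σ.apply_one one_ne_zero, hSD h1 e he hs h0]
    by_cases h2 : B.ε = -1
    · by_cases h3 : e ∈ σ.symd <;> by_cases h4 : (1 : A) ∈ σ.symd <;> simp [h1, h2, h3, h4]
    · simp [h2]
  · simp [h1]

/-- Neat subalgebras remain neat over an algebraically closed extension. -/
theorem IsNeat.baseChange [IsAlgClosed E] {σ : FInvolution F A} (hσ : σ.IsAlgebraWithInvolution)
    {K : Subalgebra F A} (hc : ∀ x ∈ K, ∀ y ∈ K, x * y = y * x) (hK : σ.IsNeat K) :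
    (σ.baseChange E).IsNeat (K.baseChange E) := by
  have := hσ.finiteDimensional
  have := hσ.nontrivial
  have hσ' := hσ.baseChange E
  obtain ⟨B⟩ := hσ'.exists_frame_of_isAlgClosed
  have hs := baseChange_symm E (σ := σ) (K := K) (fun x hx => hK.le_symm hx)
  refine ⟨hK.etale.baseChange E hc, hs, free_baseChange E hK.free, fun e he heK h0 => ?_⟩
  refine (B.type_restrictCorner_eq_iff hσ' he (hs e heK) h0).2 fun h1 hε => ?_
  constructor
  · intro hd
    rw [one_mem_symd_baseChange]
    rw [isFirstKind_tmul] at h1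
    -- some coordinate of `e` is a nonzero symmetrized element of `K`
    obtain ⟨ι, β, r, hr, -⟩ := exists_tmul_coordinates (F := F) E A
    obtain ⟨i, hi⟩ : ∃ i, r e i ≠ 0 := by
      by_contra hcon
      push Not at hcon
      exact h0 (r.map_eq_zero_iff.1 (Finsupp.ext hcon))
    have hk := coord_mem hr heK i
    have hkd := coord_symd hr hd i
    generalize r e i = k at hi hk hkd
    obtain ⟨S⟩ := exists_symSep hc (fun x hx => hK.le_symm hx) hK.etale
    obtain ⟨s, f, hf, -, hsum⟩ := exists_isPrimitive hK.etale
    obtain ⟨y, hy⟩ := mem_symd.1 hkd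
    -- `k` is the symmetrization of an element commuting with `K`, so the symmetrized elements
    -- contain `K k`, and with it some primitive idempotent of `K`
    have hKk : ∀ l ∈ K, l * k ∈ σ.symd := by
      intro l hl
      refine mem_symd.2 ⟨l * S.proj y, ?_⟩
      rw [apply_mul, S.symm l hl, ← S.comm_apply (fun k hk => S.proj_comm y hk) l hl, ← mul_add,
        S.apply_proj, ← map_add, hy]
      congr 1
      have := S.proj_mul_left (S.comm_mem hk) 1
      rwa [mul_one, S.proj_one, mul_one] at this
    obtain ⟨j, hj⟩ : ∃ j, k * f j ≠ 0 := by
      by_contra hcon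
      push Not at hcon
      apply hi
      rw [← mul_one k, ← hsum, Finset.mul_sum]
      exact Finset.sum_eq_zero fun j _ => hcon j
    obtain ⟨l, hl, hlk⟩ := (hf j).exists_inv (k * f j) (mem_cornerOf.2
      ⟨K.mul_mem hk (hf j).mem, by rw [mul_assoc, (hf j).idem]⟩) hj
    have hfd : f j ∈ σ.symd := by
      have h2 := hKk l hl.1
      have h3 : l * k = f j := by
        rw [← hlk, S.comm _ hk _ (hf j).mem, ← mul_assoc, (mem_cornerOf.1 hl).2]
      rwa [h3] at h2
    exact ((B.type_restrictCorner_eq_iff_of_baseChange hσ (hf j).idem (hK.le_symm (hf j).mem)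
      (hf j).ne_zero).1 (hK.type_eq _ _ (hf j).mem (hf j).ne_zero) h1 hε).1 hfd
  · intro hd
    have := mem_symd_of_conj (hs e heK) hd
    rwa [mul_one, he.eq] at this

end

end FInvolution

/-! ### Étale subalgebras and freeness -/

namespace FInvolution

open TensorProduct

variable {F : Type u} {A : Type v} [Field F] [Ring A] [Algebra F A]

attribute [local instance] IsArtinianRing.fieldOfSubtypeIsMaximal in
/-- A reduced finite algebra over an algebraically closed field is a product of copies of the
field. -/
theorem _root_.Algebra.Etale.of_isReduced_of_isAlgClosed {E B : Type*} [Field E] [IsAlgClosed E]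
    [CommRing B] [Algebra E B] [Module.Finite E B] [IsReduced B] : Algebra.Etale E B := by
  have : IsArtinianRing B := .of_finite E B
  have h : Algebra.FormallyEtale E B := by
    rw [Algebra.FormallyEtale.iff_of_equiv ((IsArtinianRing.equivPi B).restrictScalars E),
      Algebra.FormallyEtale.pi_iff]
    intro I
    have : Module.Finite E (B ⧸ I.asIdeal) := inferInstance
    exact Algebra.FormallyEtale.of_isSeparable E (B ⧸ I.asIdeal)
  have : Algebra.FinitePresentation E B :=
    (Algebra.FinitePresentation.of_finiteType (R := E) (A := B)).1 inferInstance
  exact ⟨h, this⟩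

/-- Subalgebras of étale algebras over a field are étale. -/
theorem _root_.IsEtaleAlgebra.of_le [FiniteDimensional F A] {K L : Subalgebra F A} (hKL : K ≤ L)
    (hc : ∀ x ∈ L, ∀ y ∈ L, x * y = y * x) (h : IsEtaleAlgebra F L) : IsEtaleAlgebra F K := by
  let inst : CommRing L := commRingOf L hc
  let inst : CommRing K := commRingOf K fun x hx y hy => hc x (hKL hx) y (hKL hy)
  have h1 : Algebra.Etale F L := (isEtaleAlgebra_iff_etale F L).1 h
  rw [isEtaleAlgebra_iff_etale F K]
  let E := AlgebraicClosure F
  have h2 : IsReduced (E ⊗[F] L) := Algebra.FormallyUnramified.isReduced_of_field E _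
  have h3 : IsReduced (E ⊗[F] K) := isReduced_of_injective
    (Algebra.TensorProduct.map (AlgHom.id E E) (Subalgebra.inclusion hKL))
    (Module.Flat.lTensor_preserves_injective_linearMap (M := E)
      (Subalgebra.inclusion hKL).toLinearMap (Subalgebra.inclusion_injective hKL))
  have h4 : Algebra.Etale E (E ⊗[F] K) := Algebra.Etale.of_isReduced_of_isAlgClosed
  exact Algebra.Etale.of_etale_tensorProduct_of_faithfullyFlat E

theorem finrank_cornerOf_baseChange (E : Type w) [Field E] [Algebra F E] (L : Subalgebra F A)
    {e : A} (he : e ∈ L) (hee : e * e = e) :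
    Module.finrank E (cornerOf (L.baseChange E) (1 ⊗ₜ e)) = Module.finrank F (cornerOf L e) := by
  let g : L →ₗ[F] A := LinearMap.mulRight F e ∘ₗ L.val.toLinearMap
  have h1 : LinearMap.range g = cornerOf L e := by
    ext x
    constructor
    · rintro ⟨l, rfl⟩
      exact mem_cornerOf.2 ⟨L.mul_mem l.2 he, (mul_assoc _ _ _).trans (by rw [hee]; rfl)⟩
    · intro hx
      exact ⟨⟨x, hx.1⟩, hx.2⟩
  have h2 : LinearMap.range (g.baseChange E) = cornerOf (L.baseChange E) (1 ⊗ₜ e) := by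
    have h3 : ∀ y, g.baseChange E y =
        Algebra.TensorProduct.map (AlgHom.id E E) L.val y * (1 ⊗ₜ e) := by
      intro y
      induction y using TensorProduct.induction_on with
      | zero => simp
      | add x y hx hy => rw [map_add, map_add, hx, hy, add_mul]
      | tmul c a => simp [g]
    ext x
    constructor
    · rintro ⟨l, rfl⟩
      rw [h3]
      refine mem_cornerOf.2
        ⟨Subalgebra.mul_mem _ ⟨l, rfl⟩ (Subalgebra.tmul_mem_baseChange he 1), ?_⟩
      rw [mul_assoc, Algebra.TensorProduct.tmul_mul_tmul, hee, mul_one]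
    · intro hx
      obtain ⟨⟨y, hy⟩, h⟩ := mem_cornerOf.1 hx
      refine ⟨y, ?_⟩
      rw [h3, ← h]
      exact congrArg (· * _) hy
  rw [← h1, ← h2, LinearMap.finrank_range_baseChange]

/-- If the dimensions of `f A` and `f L` are proportional as `f` varies over the idempotents of
the étale algebra `L`, then `A` is free over `L`. -/
theorem free_of_finrank_peirce [FiniteDimensional F A] {L : Subalgebra F A}
    (he : IsEtaleAlgebra F L)
    {r : ℕ} (h : ∀ f ∈ L, f * f = f →
      Module.finrank F (LinearMap.range (peirce F f 1)) = r * Module.finrank F (cornerOf L f)) :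
    Module.Free L A := by
  obtain ⟨s, E, _, _, hfin, ⟨φ⟩⟩ := he
  have := fun i => (hfin i).1
  -- `ψ i` embeds the `i`-th factor
  obtain ⟨ψ, hψ⟩ : ∃ ψ : ∀ i, E i → A, ∀ i c, ψ i c = (φ.symm (Pi.single i c)).1 :=
    ⟨_, fun _ _ => rfl⟩
  have hψL : ∀ i c, ψ i c ∈ L := fun i c => hψ i c ▸ (φ.symm _).2
  have hadd : ∀ i c d, ψ i (c + d) = ψ i c + ψ i d := fun i c d => by
    simp only [hψ, Pi.single_add, map_add]
    rfl
  have hmul : ∀ i c d, ψ i (c * d) = ψ i c * ψ i d := fun i c d => by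
    simp only [hψ, Pi.single_mul, map_mul]
    rfl
  have hsmul : ∀ i (a : F) c, ψ i (a • c) = a • ψ i c := fun i a c => by
    have h1 : (Pi.single i (a • c) : ∀ i, E i) = a • Pi.single i c := Pi.single_smul i a c
    rw [hψ, hψ, h1, map_smul]
    rfl
  have hinj : ∀ i c, ψ i c = 0 → c = 0 := fun i c h0 => by
    rw [hψ] at h0
    have h1 : φ.symm (Pi.single i c) = 0 := Subtype.ext h0
    rwa [map_eq_zero_iff _ φ.symm.injective, Pi.single_eq_zero_iff] at h1
  have hLψ : ∀ (l : L) i, l.1 * ψ i 1 = ψ i (φ l i) := fun l i => by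
    have h1 : l * φ.symm (Pi.single i 1) = φ.symm (Pi.single i (φ l i)) := by
      apply φ.injective
      rw [map_mul, φ.apply_symm_apply, φ.apply_symm_apply, ← Pi.single_mul_right, mul_one]
    rw [hψ, hψ, ← h1]
    rfl
  have horth : ∀ i j, ψ i 1 * ψ j 1 = if i = j then ψ i 1 else 0 := by
    intro i j
    split_ifs with h1
    · subst h1
      rw [← hmul, mul_one]
    · have := hLψ ⟨ψ i 1, hψL i 1⟩ j
      rw [this]
      have h2 : (⟨ψ i 1, hψL i 1⟩ : L) = φ.symm (Pi.single i 1) := Subtype.ext (hψ i 1)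
      rw [h2, φ.apply_symm_apply, Pi.single_eq_of_ne (Ne.symm h1), hψ, Pi.single_zero, map_zero]
      rfl
  have hsum : ∑ i, ψ i 1 = 1 := by
    have h1 : ∑ i, φ.symm (Pi.single i 1) = 1 := by
      rw [← map_sum, ← map_one φ.symm]
      congr 1
      exact Finset.univ_sum_single (1 : ∀ i, E i)
    have := congrArg Subtype.val h1
    rw [AddSubmonoidClass.coe_finsetSum] at this
    simp only [hψ]
    exact this
  let M (i : Fin s) : Submodule F A := LinearMap.range (peirce F (ψ i 1) 1)
  have hM : ∀ i x, x ∈ M i ↔ ψ i 1 * x = x := by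
    intro i x
    constructor
    · rintro ⟨y, rfl⟩
      rw [peirce_apply, mul_one, ← mul_assoc, horth, if_pos rfl]
    · intro hx
      exact ⟨x, by rw [peirce_apply, mul_one, hx]⟩
  let modM (i : Fin s) : Module (E i) (M i) :=
    { smul := fun c x => ⟨ψ i c * x.1, (hM i _).2 (by rw [← mul_assoc, ← hmul, one_mul])⟩
      one_smul := fun x => Subtype.ext ((hM i _).1 x.2)
      mul_smul := fun c d x => Subtype.ext (by
        change ψ i (c * d) * x.1 = ψ i c * (ψ i d * x.1)
        rw [hmul, mul_assoc])
      smul_zero := fun c => Subtype.ext (mul_zero _)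
      smul_add := fun c x y => Subtype.ext (mul_add _ _ _)
      add_smul := fun c d x => Subtype.ext (by
        change ψ i (c + d) * x.1 = ψ i c * x.1 + ψ i d * x.1
        rw [hadd, add_mul])
      zero_smul := fun x => Subtype.ext (by
        change ψ i 0 * x.1 = 0
        rw [hψ, Pi.single_zero, map_zero]
        exact zero_mul _) }
  have tower (i : Fin s) : IsScalarTower F (E i) (M i) := ⟨fun a c x => Subtype.ext (by
    change ψ i (a • c) * x.1 = a • (ψ i c * x.1)
    rw [hsmul, smul_mul_assoc])⟩
  have hcor : ∀ i, Module.finrank F (cornerOf L (ψ i 1)) = Module.finrank F (E i) := by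
    intro i
    let g : E i →ₗ[F] A := { toFun := ψ i, map_add' := hadd i, map_smul' := hsmul i }
    have hg : LinearMap.range g = cornerOf L (ψ i 1) := by
      ext x
      constructor
      · rintro ⟨c, rfl⟩
        refine mem_cornerOf.2 ⟨hψL i c, ?_⟩
        change ψ i c * ψ i 1 = ψ i c
        rw [← hmul, mul_one]
      · intro hx
        obtain ⟨hx, h1⟩ := mem_cornerOf.1 hx
        exact ⟨φ ⟨x, hx⟩ i, (hLψ ⟨x, hx⟩ i).symm.trans h1⟩
    rw [← hg, LinearMap.finrank_range_of_inj]
    rw [injective_iff_map_eq_zero]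
    exact hinj i
  have hdim : ∀ i, Module.finrank F (M i) = r * Module.finrank F (E i) := fun i => by
    rw [← hcor]
    exact h _ (hψL i 1) (by rw [horth, if_pos rfl])
  have hrank : ∀ i, Module.finrank (E i) (M i) = r := fun i => by
    have h1 := Module.finrank_mul_finrank F (E i) (M i)
    rw [hdim, mul_comm r] at h1
    exact Nat.eq_of_mul_eq_mul_left Module.finrank_pos h1
  have hfinM : ∀ i, Module.Finite (E i) (M i) := fun i =>
    Module.Finite.of_restrictScalars_finite F (E i) (M i)
  let b (i : Fin s) : Module.Basis (Fin r) (E i) (M i) :=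
    (Module.finBasis (E i) (M i)).reindex (finCongr (hrank i))
  -- sums of corresponding basis elements of the components form a basis over `L`
  let w (k : Fin r) : A := ∑ i, (b i k).1
  have hw : ∀ i k, ψ i 1 * w k = (b i k).1 := by
    intro i k
    rw [Finset.mul_sum, Finset.sum_eq_single i]
    · exact (hM i _).1 (b i k).2
    · intro j _ hj
      rw [← (hM j _).1 (b j k).2, ← mul_assoc, horth, if_neg (Ne.symm hj), zero_mul]
    · simp
  let Φ : (Fin r → L) →ₗ[F] A := ∑ k, LinearMap.mulRight F (w k) ∘ₗ
    (Subalgebra.toSubmodule L).subtype ∘ₗ LinearMap.proj k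
  have hΦ : ∀ l, Φ l = ∑ k, (l k).1 * w k := fun l => by
    simp only [Φ, LinearMap.sum_apply]
    rfl
  have hΦi : Function.Injective Φ := by
    rw [injective_iff_map_eq_zero]
    intro l hl
    have h1 : ∀ i k, φ (l k) i = 0 := by
      intro i
      apply Fintype.linearIndependent_iff.1 (b i).linearIndependent
      apply Subtype.ext
      rw [AddSubmonoidClass.coe_finsetSum]
      have h2 := congrArg (ψ i 1 * ·) hl
      simp only [hΦ, Finset.mul_sum, mul_zero] at h2
      refine (Finset.sum_congr rfl fun k _ => ?_).trans h2
      change ψ i (φ (l k) i) * (b i k).1 = _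
      have h3 : ψ i 1 * (l k).1 = (l k).1 * ψ i 1 := by
        have h4 : (φ.symm (Pi.single i 1)) * l k = l k * φ.symm (Pi.single i 1) := by
          apply φ.injective
          rw [map_mul, map_mul, mul_comm]
        rw [hψ]
        exact congrArg Subtype.val h4
      rw [← hLψ, ← mul_assoc, h3, mul_assoc, ← hw i k, ← mul_assoc (ψ i 1), horth, if_pos rfl,
        mul_assoc]
    funext k
    apply φ.injective
    rw [Pi.zero_apply, map_zero]
    funext i
    exact h1 i k
  have hdimL : Module.finrank F (Fin r → L) = Module.finrank F A := by
    have h1 := finrank_peirce_sum horth (1 : A) (F := F)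
    have h2 : peirce F (1 : A) 1 = LinearMap.id := by ext; simp
    rw [hsum, h2, LinearMap.range_id, finrank_top] at h1
    rw [h1, Module.finrank_pi_fintype, finrank_eq_sum_cornerOf (fun i => hψL i 1) horth hsum]
    simp only [hcor, Finset.sum_const, Finset.card_univ, Fintype.card_fin, smul_eq_mul,
      Finset.mul_sum]
    exact Finset.sum_congr rfl fun i _ => (hdim i).symm
  let e : (Fin r → L) ≃ₗ[L] A :=
    { LinearEquiv.ofBijective Φ ⟨hΦi, (LinearMap.injective_iff_surjective_of_finrank_eq_finrank
        hdimL).1 hΦi⟩ with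
      map_smul' := fun k l => by
        change Φ (k • l) = k.1 * Φ l
        rw [hΦ, hΦ, Finset.mul_sum]
        exact Finset.sum_congr rfl fun t _ => mul_assoc _ _ _ }
  exact Module.Free.of_equiv e

/-- Over an algebraically closed field, primitive idempotents generate one-dimensional corners. -/
theorem IsPrimitive.finrank_cornerOf [FiniteDimensional F A] [IsAlgClosed F] {K : Subalgebra F A}
    (hc : ∀ x ∈ K, ∀ y ∈ K, x * y = y * x) {f : A} (hf : IsPrimitive K f) :
    Module.finrank F (cornerOf K f) = 1 := by
  have hff : f ∈ cornerOf K f := mem_cornerOf.2 ⟨hf.mem, hf.idem⟩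
  refine finrank_eq_one ⟨f, hff⟩ (fun h => hf.ne_zero (congrArg Subtype.val h)) fun ⟨k, hk⟩ => ?_
  let g : Module.End F (cornerOf K f) :=
    { toFun := fun x => ⟨k * x.1, mem_cornerOf.2 ⟨K.mul_mem hk.1 x.2.1, by
        rw [mul_assoc, (mem_cornerOf.1 x.2).2]⟩⟩
      map_add' := fun x y => Subtype.ext (mul_add _ _ _)
      map_smul' := fun c x => Subtype.ext (mul_smul_comm _ _ _) }
  have : Nontrivial (cornerOf K f) :=
    ⟨⟨⟨f, hff⟩, 0, fun h => hf.ne_zero (congrArg Subtype.val h)⟩⟩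
  obtain ⟨c, hcg⟩ := Module.End.exists_eigenvalue g
  obtain ⟨x, hx⟩ := hcg.exists_hasEigenvector
  refine ⟨c, Subtype.ext ?_⟩
  have h1 : k * x.1 = c • x.1 := congrArg Subtype.val hx.apply_eq_smul
  have h2 : (k - c • f) ∈ cornerOf K f :=
    Submodule.sub_mem _ hk (Submodule.smul_mem _ _ hff)
  by_contra hne
  obtain ⟨l, hl, hlk⟩ := hf.exists_inv _ h2 (fun h => hne (sub_eq_zero.1 h).symm)
  apply hx.2
  apply Subtype.ext
  have h3 : f * x.1 = x.1 := by rw [hc _ hf.mem _ x.2.1, (mem_cornerOf.1 x.2).2]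
  refine h3.symm.trans ((congrArg (· * x.1) hlk.symm).trans ?_)
  change l * (k - c • f) * x.1 = 0
  rw [mul_assoc, sub_mul, h1, smul_mul_assoc, h3, sub_self, mul_zero]

end FInvolution

/-! ### Subalgebras of étale algebras of maximal dimension -/

namespace FInvolution

open TensorProduct

variable {F : Type u} {A : Type v} [Field F] [Ring A] [Algebra F A]

/-- A subalgebra of symmetric elements is commutative, as the involution reverses products. -/
theorem comm_of_le_symm {σ : FInvolution F A} {K : Subalgebra F A} (hs : ∀ x ∈ K, σ x = x) :
    ∀ x ∈ K, ∀ y ∈ K, x * y = y * x := fun x hx y hy => by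
  have h := hs _ (K.mul_mem hx hy)
  rw [apply_mul, hs x hx, hs y hy] at h
  exact h.symm

theorem IsPrimitive.mul_eq_zero_or {K : Subalgebra F A} (hc : ∀ x ∈ K, ∀ y ∈ K, x * y = y * x)
    {f e : A} (hf : IsPrimitive K f) (he : e ∈ K) (hee : e * e = e) :
    e * f = 0 ∨ e * f = f := by
  by_cases h : e * f = 0
  · exact Or.inl h
  obtain ⟨l, hl, hlf⟩ := hf.exists_inv (e * f)
    (mem_cornerOf.2 ⟨K.mul_mem he hf.mem, by rw [mul_assoc, hf.idem]⟩) h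
  right
  nth_rewrite 1 [← hlf]
  rw [← mul_assoc e, hc e he l hl.1, mul_assoc, ← mul_assoc e, hee, hlf]

/-- Over an algebraically closed field, an étale subalgebra of symmetric elements whose dimension
is the capacity has primitive idempotents of equal rank, so that ranks are proportional to
dimensions of corners. Moreover the form is alternating on `e V` for a nonzero idempotent `e` of the
étale algebra only if it is alternating on `V`. -/
theorem Frame.exists_rank_eq [IsAlgClosed F] {σ : FInvolution F A} (B : Frame σ)
    (hσ : σ.IsAlgebraWithInvolution) {L : Subalgebra F A} (he : IsEtaleAlgebra F L)
    (hs : ∀ x ∈ L, σ x = x) (hdim : Module.finrank F L = σ.capacity) :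
    (∃ δ, ∀ e ∈ L, e * e = e → B.rank e = δ * Module.finrank F (cornerOf L e)) ∧
    (∀ e ∈ L, e * e = e → e ≠ 0 → e ∈ σ.symd → IsFirstKind F A → B.ε = -1 →
      (1 : A) ∈ σ.symd) := by
  have := hσ.nontrivial
  have := hσ.finiteDimensional
  have hc := comm_of_le_symm hs
  obtain ⟨S⟩ := exists_symSep hc hs he
  obtain ⟨s, f, hf, horth, hsum⟩ := exists_isPrimitive he
  have hcor : ∀ i, Module.finrank F (cornerOf L (f i)) = 1 := fun i => (hf i).finrank_cornerOf hc
  have hs' : s = σ.capacity := by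
    rw [← hdim, finrank_eq_sum_cornerOf (fun i => (hf i).mem) horth hsum]
    simp [hcor]
  have hrank1 : ∑ i, B.rank (f i) = B.n * Module.finrank F (Subalgebra.center F A) := by
    rw [← B.rank_sum horth, hsum, B.rank_one]
  have hpos : ∀ i, B.rank (f i) ≠ 0 := fun i h => (hf i).ne_zero (B.eq_zero_of_rank h)
  have hatoms : ∀ {c : ℕ} {i : Fin s} {m : ℕ} {q : Fin m → A},
      (∀ t, B.rank (q t) = c * Module.finrank F (cornerOf L (f i))) →
      (∀ s t, q s * q t = if s = t then q s else 0) → ∑ t, q t = f i → B.rank (f i) = m * c := by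
    intro c i m q h1 h2 h3
    have h4 := B.rank_sum h2
    rw [h3, Finset.sum_congr rfl fun t _ => h1 t, hcor] at h4
    simpa using h4
  -- an alternating form has even rank
  have heven : IsFirstKind F A → B.ε = -1 → ∀ i, f i ∈ σ.symd → ∃ m, B.rank (f i) = m * 2 := by
    intro h1 hε i hd
    obtain ⟨-, m, q, h2, h3, h4⟩ := S.exists_atoms_of_alternating B hσ h1 (hf i)
      fun v hv hfv => S.form_self_eq_zero B h1 hε (S.comm_mem (hf i).mem) hd hv hfv
    exact ⟨m, hatoms (fun t => (h2 t).2.2.1) h3 h4⟩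
  -- all ranks are at least `δ`, where `δ` is `1` for orthogonal and `2` for symplectic and unitary
  -- involutions, and their average is `δ`
  obtain ⟨δ, hδ, hδ1⟩ : ∃ δ, (∀ i, B.rank (f i) = δ) ∧
      (IsFirstKind F A → σ.type ≠ .symplectic → δ = 1) := by
    have key : ∀ δ, (∀ i, δ ≤ B.rank (f i)) → ∑ i, B.rank (f i) = s * δ →
        ∀ i, B.rank (f i) = δ := by
      intro δ h1 h2 i
      have h3 : ∑ i : Fin s, δ = ∑ i, B.rank (f i) := by
        rw [h2]
        simp
      exact ((Finset.sum_eq_sum_iff_of_le fun i _ => h1 i).1 h3 i (Finset.mem_univ i)).symm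
    by_cases hsy : σ.type = .symplectic
    · obtain ⟨h1, hε, hd⟩ := (B.type_eq_symplectic_iff hσ).1 hsy
      have hfd : ∀ i, f i ∈ σ.symd := fun i => by
        have := mem_symd_of_conj (hs _ (hf i).mem) hd
        rwa [mul_one, (hf i).idem] at this
      choose m hm using fun i => heven h1 hε i (hfd i)
      refine ⟨2, key 2 (fun i => ?_) ?_, fun _ h => absurd hsy h⟩
      · have := hpos i
        have := hm i
        omega
      · have h5 : Module.finrank F (Subalgebra.center F A) = 1 := by
          rcases hσ.finrank_center with ⟨-, h⟩ | ⟨h, -⟩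
          · exact h
          · exact absurd h1 h
        have h6 : s = B.n / 2 := by rw [hs', capacity, hsy, B.degree_eq hσ]
        rw [h5, mul_one] at hrank1
        have h7 : B.n = (∑ i, m i) * 2 := by
          rw [← hrank1, Finset.sum_mul]
          exact Finset.sum_congr rfl fun i _ => hm i
        rw [hrank1]
        omega
    · have h5 : s = B.n := by
        rw [hs', capacity]
        rcases h : σ.type with _ | _ | _
        · exact B.degree_eq hσ
        · exact absurd h hsy
        · exact B.degree_eq hσ
      rcases hσ.finrank_center with ⟨h1, h2⟩ | ⟨h1, h2⟩
      · refine ⟨1, key 1 (fun i => Nat.pos_of_ne_zero (hpos i)) ?_, fun _ _ => rfl⟩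
        rw [hrank1, h2, h5]
      · refine ⟨2, key 2 (fun i => ?_) ?_, fun h => absurd h h1⟩
        · obtain ⟨m, q, h3, h4, h6⟩ := S.exists_atoms B hσ (hf i) fun h => absurd h h1
          have h7 := hatoms (fun t => (h3 t).2.2) h4 h6
          have := hpos i
          rw [h2] at h7
          omega
        · rw [hrank1, h2, h5]
  refine ⟨⟨δ, fun e heL hee => ?_⟩, fun e heL hee h0 hd h1 hε => ?_⟩
  · have hgo : ∀ i j, (e * f i) * (e * f j) = if i = j then e * f i else 0 := by
      intro i j
      rw [← mul_assoc, hc _ (L.mul_mem heL (hf i).mem) e heL, ← mul_assoc, hee, mul_assoc, horth]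
      split_ifs <;> simp
    have hgs : ∑ i, e * f i = e := by rw [← Finset.mul_sum, hsum, mul_one]
    have hr := B.rank_sum hgo
    have hd := finrank_cornerOf_sum (fun i => L.mul_mem heL (hf i).mem) hgo
    rw [hgs] at hr hd
    rw [hr, hd, Finset.mul_sum]
    refine Finset.sum_congr rfl fun i _ => ?_
    rcases (hf i).mul_eq_zero_or hc heL hee with h | h
    · have h1 : cornerOf L (0 : A) = ⊥ := by
        rw [eq_bot_iff]
        intro x hx
        rw [← (mem_cornerOf.1 hx).2, mul_zero]
        exact Submodule.zero_mem _
      have h2 : peirce F (0 : A) B.e = 0 := by ext; simp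
      rw [h, h1, finrank_bot, rank, h2, LinearMap.range_zero, finrank_bot, mul_zero]
    · rw [h, hδ, hcor, mul_one]
  · obtain ⟨i, hi⟩ : ∃ i, e * f i ≠ 0 := by
      by_contra hcon
      push Not at hcon
      apply h0
      rw [← mul_one e, ← hsum, Finset.mul_sum]
      exact Finset.sum_eq_zero fun j _ => hcon j
    have hef := ((hf i).mul_eq_zero_or hc heL hee).resolve_left hi
    have hfd : f i ∈ σ.symd := by
      have := mem_symd_of_conj (hs _ (hf i).mem) hd
      rwa [hc _ (hf i).mem e heL, hef, (hf i).idem] at this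
    by_contra hcon
    have hns : σ.type ≠ .symplectic := fun h => hcon ((B.type_eq_symplectic_iff hσ).1 h).2.2
    obtain ⟨m, hm⟩ := heven h1 hε i hfd
    rw [hδ, hδ1 h1 hns] at hm
    omega

theorem free_of_isFreeOver {K L : Subalgebra F A} {hKL : K ≤ L} (h : K.IsFreeOver L hKL)
    (hL : Module.Free L A) : Module.Free K A := by
  let inst : Module K L := Module.compHom L (Subalgebra.inclusion hKL).toRingHom
  have h' : Module.Free K L := h
  let b := Module.Free.chooseBasis K L
  let c := Module.Free.chooseBasis L A
  have : IsScalarTower K L A := ⟨fun k l a => mul_assoc k.1 l.1 a⟩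
  exact Module.Free.of_basis (b.smulTower c)

/-- Subalgebras over which an étale algebra of symmetric elements is free are neat, if the dimension
of the étale algebra is the capacity. -/
theorem IsAlgebraWithInvolution.isNeat_of_le {σ : FInvolution F A}
    (hσ : σ.IsAlgebraWithInvolution) {K L : Subalgebra F A} (hKL : K ≤ L)
    (he : IsEtaleAlgebra F L) (hs : ∀ x ∈ L, σ x = x) (hdim : Module.finrank F L = σ.capacity)
    (hfree : K.IsFreeOver L hKL) : σ.IsNeat K := by
  have := hσ.finiteDimensional
  have hc := comm_of_le_symm hs
  let E := AlgebraicClosure F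
  have hσ' := hσ.baseChange E
  obtain ⟨B⟩ := hσ'.exists_frame_of_isAlgClosed
  obtain ⟨⟨δ, hδ⟩, hd⟩ := B.exists_rank_eq hσ' (he.baseChange E hc) (baseChange_symm E hs) (by
    rw [finrank_subalgebra_baseChange, hdim, hσ.capacity_baseChange E])
  have hidem : ∀ {e : A}, e * e = e → ((1 : E) ⊗ₜ[F] e) * (1 ⊗ₜ e) = 1 ⊗ₜ e := fun h => by
    rw [Algebra.TensorProduct.tmul_mul_tmul, h, mul_one]
  have hL : Module.Free L A := by
    refine free_of_finrank_peirce he (r := B.n * δ) fun e heL hee => ?_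
    rw [← finrank_cornerOf_baseChange E L heL hee, ← LinearMap.finrank_range_baseChange E,
      ← peirce_tmul, ← Algebra.TensorProduct.one_def, B.finrank_peirce_one,
      hδ _ (Subalgebra.tmul_mem_baseChange heL 1) (hidem hee), mul_assoc]
  refine ⟨he.of_le hKL hc, fun x hx => hs x (hKL hx), free_of_isFreeOver hfree hL,
    fun e hee heK h0 => ?_⟩
  refine (B.type_restrictCorner_eq_iff_of_baseChange hσ hee (hs e (hKL heK)) h0).2 fun h1 hε =>
    ⟨fun h => ?_, fun h => ?_⟩
  · rw [← one_mem_symd_baseChange E]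
    exact hd _ (Subalgebra.tmul_mem_baseChange (hKL heK) 1) (hidem hee) (one_tmul_ne_zero E h0)
      (tmul_mem_symd E h 1) ((isFirstKind_tmul E).2 h1) hε
  · have := mem_symd_of_conj (hs e (hKL heK)) h
    rwa [mul_one, hee.eq] at this

end FInvolution

/-! ### The bound on the dimension of symmetric subalgebras -/

namespace FInvolution

open Polynomial

variable {F : Type u} {A : Type v} [Field F] [Ring A] [Algebra F A]

/-- An endomorphism of a finite-dimensional space has a cyclic vector for its whole minimal
polynomial. -/
theorem _root_.Module.End.exists_aeval_eq_zero {M : Type*} [AddCommGroup M] [Module F M]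
    [FiniteDimensional F M] (T : Module.End F M) :
    ∃ v : M, ∀ q : F[X], aeval T q v = 0 → aeval T q = 0 := by
  obtain ⟨x, hx⟩ := Module.exists_ker_toSpanSingleton_eq_annihilator F[X] (Module.AEval' T)
  obtain ⟨v, rfl⟩ := (Module.AEval'.of T).surjective x
  have hsmul : ∀ (q : F[X]) (w : M), q • Module.AEval'.of T w =
      Module.AEval'.of T (aeval T q w) := fun q w => (Module.AEval.of_aeval_smul T q w).symm
  refine ⟨v, fun q hq => LinearMap.ext fun w => ?_⟩
  have h1 : q ∈ LinearMap.ker (LinearMap.toSpanSingleton F[X] (Module.AEval' T)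
      (Module.AEval'.of T v)) := by
    rw [LinearMap.mem_ker, LinearMap.toSpanSingleton_apply, hsmul, hq, map_zero]
  rw [hx, Module.mem_annihilator] at h1
  have h2 := h1 (Module.AEval'.of T w)
  rw [hsmul, (Module.AEval'.of T).map_eq_zero_iff] at h2
  exact h2

namespace Frame

variable {σ : FInvolution F A} (B : Frame σ)

/-- An element commuting with `p` has a cyclic vector in `p V`. -/
theorem exists_cyclic [FiniteDimensional F A] {p x : A} (hp : p * p = p) (hx : x * p = p * x) :
    ∃ v, p * v = v ∧ v * B.e = v ∧ ∀ q : F[X], aeval x q * v = 0 → aeval x q * p = 0 := by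
  let T : Module.End F (LinearMap.range (peirce F p B.e)) :=
    (LinearMap.mulLeft F x).restrict fun y hy => by
      obtain ⟨h1, h2⟩ := (B.mem_range_peirce hp).1 hy
      refine (B.mem_range_peirce hp).2 ⟨?_, ?_⟩
      · rw [LinearMap.mulLeft_apply, ← mul_assoc, ← hx, mul_assoc, h1]
      · rw [LinearMap.mulLeft_apply, mul_assoc, h2]
  have hT : ∀ (q : F[X]) y, (aeval T q y).1 = aeval x q * y.1 := by
    intro q y
    induction q using Polynomial.induction_on' with
    | add q r hq hr => rw [map_add, map_add, add_mul, ← hq, ← hr]; rfl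
    | monomial n c =>
      have h1 : ∀ n : ℕ, ((T ^ n) y).1 = x ^ n * y.1 := by
        intro n
        induction n with
        | zero => simp
        | succ n ih =>
          rw [pow_succ', pow_succ', mul_assoc, ← ih]
          rfl
      rw [aeval_monomial, aeval_monomial, mul_assoc, ← h1, ← Algebra.smul_def, ← Algebra.smul_def]
      rfl
  obtain ⟨v, hv⟩ := Module.End.exists_aeval_eq_zero T
  obtain ⟨h1, h2⟩ := (B.mem_range_peirce hp).1 v.2
  refine ⟨v.1, h1, h2, fun q hq => B.ext_mul fun y hy => ?_⟩
  have h3 := hv q (Subtype.ext ((hT q v).trans hq))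
  have h4 := hT q ⟨p * y, (B.mem_range_peirce hp).2
    ⟨by rw [← mul_assoc, hp], by rw [mul_assoc, hy]⟩⟩
  rw [h3] at h4
  rw [zero_mul, mul_assoc]
  exact h4.symm

/-- The space of polynomials in `x`, multiplied by `f`. -/
noncomputable def polySpan (F : Type u) {A : Type v} [Field F] [Ring A] [Algebra F A] (x f : A) :
    Submodule F A :=
  LinearMap.range (LinearMap.mulRight F f ∘ₗ (aeval x : F[X] →ₐ[F] A).toLinearMap)

theorem mem_polySpan {x f y : A} : y ∈ polySpan F x f ↔ ∃ q : F[X], aeval x q * f = y := Iff.rfl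

theorem aeval_comm {x f : A} (h : x * f = f * x) (q : F[X]) : aeval x q * f = f * aeval x q := by
  have h1 : Commute f x := h.symm
  induction q using Polynomial.induction_on' with
  | add q r hq hr => rw [map_add, add_mul, mul_add, hq, hr]
  | monomial n c =>
    rw [aeval_monomial, mul_assoc, ← (h1.pow_right n).eq, ← mul_assoc, ← mul_assoc,
      Algebra.commutes]

theorem apply_aeval {x : A} (h : σ x = x) (q : F[X]) : σ (aeval x q) = aeval x q := by
  have h1 : ∀ n : ℕ, σ (x ^ n) = x ^ n := by
    intro n
    induction n with
    | zero => simp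
    | succ n ih => rw [pow_succ, apply_mul, ih, h, ← pow_succ', pow_succ]
  induction q using Polynomial.induction_on' with
  | add q r hq hr => rw [map_add, map_add, hq, hr]
  | monomial n c => rw [aeval_monomial, ← Algebra.smul_def, map_smul, h1]

/-- If `1` and the symmetric element `x` are symmetrized elements, then so are all polynomials in
`x`, because `x ^ (n + 2) = x * x ^ n * σ x`. -/
theorem aeval_mem_symd {x : A} (h1 : (1 : A) ∈ σ.symd) (h : σ x = x) (hx : x ∈ σ.symd)
    (q : F[X]) : aeval x q ∈ σ.symd := by
  have hpow : ∀ n : ℕ, x ^ n ∈ σ.symd := by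
    intro n
    induction n using Nat.strong_induction_on with
    | _ n ih =>
      match n, ih with
      | 0, _ => rwa [pow_zero]
      | 1, _ => rwa [pow_one]
      | n + 2, ih =>
        have := mem_symd_of_conj h (ih n (by omega))
        rwa [← pow_succ', ← pow_succ] at this
  induction q using Polynomial.induction_on' with
  | add q r hq hr =>
    rw [map_add]
    exact Submodule.add_mem _ hq hr
  | monomial n c =>
    rw [aeval_monomial, ← Algebra.smul_def]
    exact Submodule.smul_mem _ _ (hpow n)

/-- Multiplication by a cyclic vector of `p V` embeds the polynomials in `x` into `p V`. -/
theorem finrank_polySpan_le [FiniteDimensional F A] {p f x : A} (hp : p * p = p)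
    (hx : x * p = p * x) (hfp : f * p = p)
    (hzero : ∀ q : F[X], aeval x q * p = 0 → aeval x q * f = 0) :
    Module.finrank F (polySpan F x f) ≤ B.rank p := by
  obtain ⟨v, hpv, hv, hcyc⟩ := B.exists_cyclic hp hx
  have hfv : f * v = v := SymSep.mul_eq_of_mul_eq hfp hpv
  refine LinearMap.finrank_le_finrank_of_injective (f := ((LinearMap.mulRight F v) ∘ₗ
    (polySpan F x f).subtype).codRestrict (LinearMap.range (peirce F p B.e)) ?_) ?_
  · rintro ⟨_, q, rfl⟩
    refine (B.mem_range_peirce hp).2 ⟨?_, ?_⟩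
    · change p * (aeval x q * f * v) = aeval x q * f * v
      rw [mul_assoc, hfv, ← mul_assoc, ← aeval_comm hx, mul_assoc, hpv]
    · change aeval x q * f * v * B.e = aeval x q * f * v
      rw [mul_assoc, hv]
  · rw [injective_iff_map_eq_zero]
    rintro ⟨_, q, rfl⟩ h
    apply Subtype.ext
    have h1 : aeval x q * f * v = 0 := congrArg Subtype.val h
    rw [mul_assoc, hfv] at h1
    exact hzero q (hcyc q h1)

/-- If the form is alternating, the image of the polynomials in a symmetrized element is
isotropic. -/
theorem two_mul_finrank_polySpan_le [FiniteDimensional F A] (h1 : IsFirstKind F A)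
    (hε : B.ε = -1) (hd : (1 : A) ∈ σ.symd) {f x : A} (hf : f * f = f) (hfs : σ f = f)
    (hx : x * f = f * x) (hxs : σ x = x) (hxd : x ∈ σ.symd) :
    2 * Module.finrank F (polySpan F x f) ≤ B.rank f := by
  obtain ⟨v, hfv, hv, hcyc⟩ := B.exists_cyclic hf hx
  rcases subsingleton_or_nontrivial A with hA | hA
  · have h0 : Module.finrank F (polySpan F x f) = 0 := Module.finrank_zero_of_subsingleton
    rw [h0]
    exact Nat.zero_le _
  obtain ⟨l, hl⟩ : ∃ l : A →ₗ[F] F, l 1 ≠ 0 := by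
    by_contra! h
    exact one_ne_zero ((Module.forall_dual_apply_eq_zero_iff F (1 : A)).1 h)
  let V := LinearMap.range (peirce F f B.e)
  have hV : ∀ y ∈ V, f * y = y ∧ y * B.e = y := fun y hy => (B.mem_range_peirce hf).1 hy
  let b : LinearMap.BilinForm F V := LinearMap.mk₂ F (fun w y => l (B.form w.1 y.1))
    (fun w w' y => by
      change l (B.form (w.1 + w'.1) y.1) = _
      rw [B.form_add_left, map_add])
    (fun c w y => by
      change l (B.form (c • w.1) y.1) = _
      rw [← B.formLeft_apply, map_smul, map_smul, B.formLeft_apply])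
    (fun w y y' => by
      change l (B.form w.1 (y.1 + y'.1)) = _
      rw [B.form_add_right, map_add])
    (fun c w y => by
      change l (B.form w.1 (c • y.1)) = _
      rw [B.form_smul_right, map_smul])
  have hb : ∀ w y : V, b w y = l (B.form w.1 y.1) := fun w y => rfl
  have hlf : ∀ w y : A, y * B.e = y → l (B.form w y) = 0 → B.form w y = 0 := by
    intro w y hy h
    obtain ⟨c, hc⟩ := h1 _ (B.form_spec w hy).1
    rw [hc, map_smul, smul_eq_mul, mul_eq_zero, or_iff_left hl] at h
    rw [hc, h, zero_smul]
  have hswap : ∀ w y : A, w * B.e = w → y * B.e = y → B.form y w = - B.form w y := by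
    intro w y hw hy
    obtain ⟨c, hc⟩ := h1 _ (B.form_spec w hy).1
    have h2 := B.apply_form hw hy
    rw [hc, map_smul, σ.apply_one, hε, neg_one_smul] at h2
    rw [hc, h2, neg_neg]
  have hleft : ∀ w : V, (∀ y, b w y = 0) → w = 0 := by
    intro w h
    obtain ⟨hw1, hw2⟩ := hV w.1 w.2
    refine Subtype.ext (B.eq_zero_of_form hw2 fun y hy => hlf _ _ hy ?_)
    rw [← hw1, B.form_mul_left, hfs]
    exact h ⟨f * y, (B.mem_range_peirce hf).2
      ⟨by rw [← mul_assoc, hf], by rw [mul_assoc, hy]⟩⟩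
  have hbswap : ∀ w y : V, b y w = - b w y := fun w y => by
    rw [hb, hb, hswap _ _ (hV w.1 w.2).2 (hV y.1 y.2).2, map_neg]
  have hnd : b.Nondegenerate := by
    refine ⟨hleft, fun y h => hleft y fun w => ?_⟩
    rw [hbswap, h, neg_zero]
  -- the vectors `q(x) v` span an isotropic subspace
  have hmem : ∀ q : F[X], aeval x q * v ∈ V := fun q => (B.mem_range_peirce hf).2
    ⟨by rw [← mul_assoc, ← aeval_comm hx, mul_assoc, hfv], by rw [mul_assoc, hv]⟩
  let g : F[X] →ₗ[F] V := (LinearMap.mulRight F v ∘ₗ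
    (aeval x : F[X] →ₐ[F] A).toLinearMap).codRestrict V hmem
  have hg : ∀ q, (g q).1 = aeval x q * v := fun q => rfl
  have hiso : ∀ q r, b (g q) (g r) = 0 := by
    intro q r
    obtain ⟨a, ha⟩ := mem_symd.1 (aeval_mem_symd hd hxs hxd (q * r))
    rw [hb, hg, hg, B.form_mul_left, apply_aeval hxs, ← mul_assoc, ← map_mul, ← ha, add_mul,
      B.form_add_right, ← B.form_mul_left, hswap _ _ hv (by rw [mul_assoc, hv]), add_neg_cancel,
      map_zero]
  have hle : LinearMap.range g ≤ b.orthogonal (LinearMap.range g) := by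
    rintro _ ⟨r, rfl⟩
    rw [LinearMap.BilinForm.mem_orthogonal_iff]
    rintro _ ⟨q, rfl⟩
    exact hiso q r
  have h2 := LinearMap.BilinForm.finrank_orthogonal hnd (LinearMap.range g)
  have h3 := Submodule.finrank_mono hle
  have h4 := Submodule.finrank_le (LinearMap.range g)
  have h5 : Module.finrank F (polySpan F x f) ≤ Module.finrank F (LinearMap.range g) := by
    refine LinearMap.finrank_le_finrank_of_injective (f := ((LinearMap.mulRight F v ∘ₗ
      (polySpan F x f).subtype).codRestrict V ?_).codRestrict (LinearMap.range g) ?_) ?_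
    · rintro ⟨_, q, rfl⟩
      change aeval x q * f * v ∈ V
      rw [mul_assoc, hfv]
      exact hmem q
    · rintro ⟨_, q, rfl⟩
      refine ⟨q, Subtype.ext ?_⟩
      change aeval x q * v = aeval x q * f * v
      rw [mul_assoc, hfv]
    · rw [injective_iff_map_eq_zero]
      rintro ⟨_, q, rfl⟩ h
      have h' : aeval x q * f * v = 0 := congrArg (fun y => y.1.1) h
      rw [mul_assoc, hfv] at h'
      exact Subtype.ext (hcyc q h')
  have h6 : Module.finrank F V = B.rank f := rfl
  omega

/-- If the algebra is of the second kind and its center splits, then `f V` is the sum of two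
subspaces on which the polynomials in a symmetric element act faithfully. -/
theorem two_mul_finrank_polySpan_le_of_central [FiniteDimensional F A] {z f x : A}
    (hz : ∀ a, a * z = z * a) (hzz : z * z = z) (hσz : σ z = 1 - z) (hf : f * f = f)
    (hfs : σ f = f) (hx : x * f = f * x) (hxs : σ x = x) :
    2 * Module.finrank F (polySpan F x f) ≤ B.rank f := by
  have hle : ∀ y, (∀ a, a * y = y * a) → y * y = y → σ y = 1 - y →
      Module.finrank F (polySpan F x f) ≤ B.rank (y * f) := by
    intro y hy hyy hσy
    refine B.finrank_polySpan_le (p := y * f) ?_ ?_ ?_ fun q hq => ?_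
    · rw [mul_assoc, ← mul_assoc f, hy, mul_assoc y, hf, ← mul_assoc, hyy]
    · rw [← mul_assoc, hy, mul_assoc, hx, mul_assoc]
    · rw [← mul_assoc, hy, mul_assoc, hf]
    · -- `q(x) f` is symmetric, so it is killed by `1 - y = σ(y)` as well
      have h1 : y * (aeval x q * f) = 0 := by rw [← mul_assoc, ← hy, mul_assoc, hq]
      have h2 := congrArg σ h1
      rw [apply_mul, apply_mul, hfs, apply_aeval hxs, ← aeval_comm hx, map_zero, hσy, mul_sub,
        mul_one, hy, h1, sub_zero] at h2
      exact h2
  have huc : ∀ a, a * (1 - z) = (1 - z) * a := fun a => by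
    rw [mul_sub, sub_mul, hz, mul_one, one_mul]
  have hzu : z * (1 - z) = 0 := by rw [mul_sub, mul_one, hzz, sub_self]
  have huz : (1 - z) * z = 0 := by rw [sub_mul, one_mul, hzz, sub_self]
  have huu : (1 - z) * (1 - z) = 1 - z := by rw [mul_sub, huz, mul_one, sub_zero]
  have h1 := hle z hz hzz hσz
  have h2 := hle (1 - z) huc huu (by rw [map_sub, hσz, apply_one])
  have hmul : ∀ a b, (∀ y, y * b = b * y) → a * f * (b * f) = a * b * f := fun a b hb => by
    rw [mul_assoc, ← mul_assoc f, hb, mul_assoc b, hf, ← mul_assoc]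
  have h3 := B.rank_add (p := z * f) (q := (1 - z) * f) (by rw [hmul _ _ hz, hzz])
    (by rw [hmul _ _ huc, huu]) (by rw [hmul _ _ huc, hzu, zero_mul])
    (by rw [hmul _ _ hz, huz, zero_mul])
  rw [← add_mul, add_sub_cancel, one_mul] at h3
  omega

end Frame

/-- Over an algebraically closed field, the center of an algebra with involution of the second
kind has a nontrivial idempotent. -/
theorem IsAlgebraWithInvolution.exists_central_idempotent [IsAlgClosed F] {σ : FInvolution F A}
    (hσ : σ.IsAlgebraWithInvolution) (h : ¬ IsFirstKind F A) :
    ∃ z : A, (∀ a, a * z = z * a) ∧ z * z = z ∧ σ z = 1 - z := by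
  rcases hσ.isSimpleRing_or_exists with hs | ⟨z, hz, hzz, h0, h1⟩
  · exfalso
    have := hσ.finiteDimensional
    have hf : IsField (Subalgebra.center F A) := IsSimpleRing.isField_center A
    have := hf.isDomain
    refine h fun x hx => ?_
    obtain ⟨c, hc⟩ := (IsAlgClosed.algebraMap_bijective_of_isIntegral (k := F)
      (K := Subalgebra.center F A)).2 ⟨x, Subalgebra.mem_center_iff.2 hx⟩
    exact ⟨c, (congrArg Subtype.val hc).symm.trans (Algebra.algebraMap_eq_smul_one c)⟩
  · exact ⟨z, hz, hzz, hσ.apply_central_idempotent hz hzz h0 h1⟩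

/-- Over an algebraically closed field, an algebra generated by an étale algebra `K` of symmetric
elements and one symmetric element commuting with `K` has at most the dimension given by the
capacity. -/
theorem IsAlgebraWithInvolution.finrank_le_capacity [IsAlgClosed F] {σ : FInvolution F A}
    (hσ : σ.IsAlgebraWithInvolution) {K L : Subalgebra F A} (he : IsEtaleAlgebra F K)
    (hs : ∀ k ∈ K, σ k = k) {x : A} (hx : ∀ k ∈ K, k * x = x * k) (hxs : σ x = x)
    (hxd : σ.type = .symplectic → x ∈ σ.symd) (hKL : K ≤ L)
    (hL : ∀ y ∈ L, y ∈ Submodule.span F {y | ∃ k ∈ K, ∃ i : ℕ, k * x ^ i = y}) :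
    Module.finrank F L ≤ σ.capacity := by
  have := hσ.nontrivial
  have := hσ.finiteDimensional
  have hc := comm_of_le_symm hs
  obtain ⟨B⟩ := hσ.exists_frame_of_isAlgClosed
  obtain ⟨s, f, hf, horth, hsum⟩ := exists_isPrimitive he
  -- `K (f i)` is one-dimensional, so `L (f i)` consists of polynomials in `x`
  have hcor : ∀ i, cornerOf L (f i) ≤ Frame.polySpan F x (f i) := by
    intro i y hy
    obtain ⟨hyL, hyf⟩ := mem_cornerOf.1 hy
    rw [← hyf]
    have hy' := hL y hyL
    clear hyf hy hyL
    induction hy' using Submodule.span_induction with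
    | mem y hy =>
      obtain ⟨k, hk, n, rfl⟩ := hy
      have hff : f i ∈ cornerOf K (f i) := mem_cornerOf.2 ⟨(hf i).mem, (hf i).idem⟩
      obtain ⟨c, hck⟩ := (finrank_eq_one_iff_of_nonzero' (⟨f i, hff⟩ : cornerOf K (f i))
        (fun h => (hf i).ne_zero (congrArg Subtype.val h))).1 ((hf i).finrank_cornerOf hc)
        ⟨k * f i, mem_cornerOf.2 ⟨K.mul_mem hk (hf i).mem, by rw [mul_assoc, (hf i).idem]⟩⟩
      have hck' : c • f i = k * f i := congrArg Subtype.val hck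
      have hcomm : Commute k (x ^ n) := (show Commute k x from hx k hk).pow_right n
      refine Frame.mem_polySpan.2 ⟨monomial n c, ?_⟩
      rw [aeval_monomial, ← Algebra.smul_def, smul_mul_assoc, ← mul_smul_comm, hck', ← mul_assoc,
        ← hcomm.eq]
    | zero => simp
    | add y z _ _ hy hz =>
      rw [add_mul]
      exact Submodule.add_mem _ hy hz
    | smul c y _ hy =>
      rw [smul_mul_assoc]
      exact Submodule.smul_mem _ _ hy
  have hdim := finrank_eq_sum_cornerOf (fun i => hKL (hf i).mem) horth hsum
  have hrank : ∑ i, B.rank (f i) = B.n * Module.finrank F (Subalgebra.center F A) := by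
    rw [← B.rank_sum horth, hsum, B.rank_one]
  have hdeg := B.degree_eq hσ
  have hxf : ∀ i, x * f i = f i * x := fun i => (hx _ (hf i).mem).symm
  have key : ∀ δ, (∀ i, δ * Module.finrank F (Frame.polySpan F x (f i)) ≤ B.rank (f i)) →
      δ * Module.finrank F L ≤ B.n * Module.finrank F (Subalgebra.center F A) := by
    intro δ h
    rw [hdim, ← hrank, Finset.mul_sum]
    exact Finset.sum_le_sum fun i _ =>
      (Nat.mul_le_mul_left _ (Submodule.finrank_mono (hcor i))).trans (h i)
  by_cases hsy : σ.type = .symplectic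
  · obtain ⟨h1, hε, hd⟩ := (B.type_eq_symplectic_iff hσ).1 hsy
    have h2 := key 2 fun i => B.two_mul_finrank_polySpan_le h1 hε hd (hf i).idem
      (hs _ (hf i).mem) (hxf i) hxs (hxd hsy)
    have h3 : σ.capacity = σ.degree / 2 := by simp only [capacity, hsy]
    rcases hσ.finrank_center with ⟨_, h⟩ | ⟨h, _⟩
    · rw [h, mul_one] at h2
      omega
    · exact absurd h1 h
  · have h3 : σ.capacity = σ.degree := by
      rw [capacity]
      cases h : σ.type <;> simp_all
    rcases hσ.finrank_center with ⟨_, h⟩ | ⟨h1, h⟩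
    · have h2 := key 1 fun i => by
        rw [one_mul]
        exact B.finrank_polySpan_le (hf i).idem (hxf i) (hf i).idem fun q hq => hq
      rw [h, mul_one] at h2
      omega
    · obtain ⟨z, hz, hzz, hσz⟩ := hσ.exists_central_idempotent h1
      have h2 := key 2 fun i => B.two_mul_finrank_polySpan_le_of_central hz hzz hσz (hf i).idem
        (hs _ (hf i).mem) (hxf i) hxs
      rw [h] at h2
      omega

end FInvolution

/-! ### Polynomial maps and density -/

namespace FInvolution

open TensorProduct

/-- Maps from an affine space to a vector space which are polynomial in every linear coordinate. -/
def IsPolyMap {E ι N : Type*} [Field E] [AddCommGroup N] [Module E N] (Φ : (ι → E) → N) : Prop :=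
  ∀ l : N →ₗ[E] E, ∃ p : MvPolynomial ι E, ∀ x, l (Φ x) = MvPolynomial.eval x p

namespace IsPolyMap

variable {E ι : Type*} [Field E]

section Module

variable {N N' : Type*} [AddCommGroup N] [Module E N] [AddCommGroup N'] [Module E N']

theorem const (y : N) : IsPolyMap fun _ : ι → E => y := fun l =>
  ⟨MvPolynomial.C (l y), fun x => by simp⟩

theorem coord_smul (i : ι) (y : N) : IsPolyMap fun x : ι → E => x i • y := fun l =>
  ⟨MvPolynomial.C (l y) * MvPolynomial.X i, fun x => by simp [mul_comm]⟩

theorem sum {κ : Type*} (s : Finset κ) {Φ : κ → (ι → E) → N} (h : ∀ k, IsPolyMap (Φ k)) :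
    IsPolyMap fun x => ∑ k ∈ s, Φ k x := fun l => by
  choose p hp using fun k => h k l
  exact ⟨∑ k ∈ s, p k, fun x => by simp [hp]⟩

theorem prodMk {Φ : (ι → E) → N} {Ψ : (ι → E) → N'} (hΦ : IsPolyMap Φ) (hΨ : IsPolyMap Ψ) :
    IsPolyMap fun x => (Φ x, Ψ x) := fun l => by
  obtain ⟨p, hp⟩ := hΦ (l ∘ₗ LinearMap.inl E N N')
  obtain ⟨q, hq⟩ := hΨ (l ∘ₗ LinearMap.inr E N N')
  refine ⟨p + q, fun x => ?_⟩
  rw [map_add, ← hp, ← hq, LinearMap.comp_apply, LinearMap.comp_apply, ← map_add]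
  simp

end Module

section Algebra

variable {N : Type*} [Ring N] [Algebra E N] [FiniteDimensional E N]

theorem mul {Φ Ψ : (ι → E) → N} (hΦ : IsPolyMap Φ) (hΨ : IsPolyMap Ψ) :
    IsPolyMap fun x => Φ x * Ψ x := fun l => by
  let b := Module.finBasis E N
  choose p hp using fun i => hΦ (b.coord i)
  choose q hq using fun i => hΨ (b.coord i)
  refine ⟨∑ i, ∑ j, MvPolynomial.C (l (b i * b j)) * (p i * q j), fun x => ?_⟩
  simp only [map_sum, map_mul, MvPolynomial.eval_C, ← hp, ← hq, Module.Basis.coord_apply]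
  nth_rewrite 1 [← b.sum_repr (Φ x), ← b.sum_repr (Ψ x)]
  simp only [Finset.sum_mul, Finset.mul_sum, map_sum, smul_mul_smul_comm, map_smul, smul_eq_mul]
  rw [Finset.sum_comm]
  exact Finset.sum_congr rfl fun i _ => Finset.sum_congr rfl fun j _ => mul_comm _ _

theorem pow {Φ : (ι → E) → N} (hΦ : IsPolyMap Φ) (n : ℕ) : IsPolyMap fun x => Φ x ^ n := by
  induction n with
  | zero =>
    simp only [pow_zero]
    exact const 1
  | succ n ih =>
    simp only [pow_succ]
    exact ih.mul hΦ

end Algebra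

/-- Linear independence of a family of polynomial maps is an open condition. -/
theorem exists_eval_ne_zero {N κ : Type*} [AddCommGroup N] [Module E N] [Fintype κ]
    {Φ : κ → (ι → E) → N} (h : ∀ k, IsPolyMap (Φ k)) {β : ι → E}
    (hβ : LinearIndependent E fun k => Φ k β) :
    ∃ p : MvPolynomial ι E, MvPolynomial.eval β p ≠ 0 ∧
      ∀ x, MvPolynomial.eval x p ≠ 0 → LinearIndependent E fun k => Φ k x := by
  classical
  -- the polynomial is the determinant of the coordinates with respect to functionals dual to the
  -- family at `β`
  obtain ⟨g, hg⟩ := LinearMap.exists_leftInverse_of_injective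
    (Fintype.linearCombination E fun k => Φ k β)
    (LinearMap.ker_eq_bot.2 (LinearIndependent.fintypeLinearCombination_injective hβ))
  choose p hp using fun k j => h k (LinearMap.proj j ∘ₗ g)
  have hp' : ∀ k j x, g (Φ k x) j = MvPolynomial.eval x (p k j) := fun k j x => hp k j x
  have hdet : ∀ x, MvPolynomial.eval x (Matrix.of p).det =
      (Matrix.of fun k j => g (Φ k x) j).det := by
    intro x
    rw [RingHom.map_det]
    congr 1
    ext k j
    simp [hp']
  refine ⟨(Matrix.of p).det, ?_, fun x hx => ?_⟩
  · rw [hdet]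
    have : (Matrix.of fun k j => g (Φ k β) j) = 1 := by
      ext k j
      have h1 := LinearMap.congr_fun hg (Pi.single k 1)
      simp only [LinearMap.comp_apply, Fintype.linearCombination_apply_single, one_smul,
        LinearMap.id_apply] at h1
      rw [Matrix.of_apply, h1, Matrix.one_apply, Pi.single_apply]
      simp only [eq_comm]
    rw [this, Matrix.det_one]
    exact one_ne_zero
  · rw [Fintype.linearIndependent_iff]
    intro c hc
    rw [hdet] at hx
    have h2 : Matrix.vecMul c (Matrix.of fun k j => g (Φ k x) j) = 0 := by
      ext j
      have := congrArg (fun y => g y j) hc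
      simpa [Matrix.vecMul, dotProduct] using this
    exact congrFun (Matrix.eq_zero_of_vecMul_eq_zero hx h2)

end IsPolyMap

/-- A nonzero polynomial does not vanish at all points with coordinates in an infinite subfield. -/
theorem _root_.MvPolynomial.exists_eval_algebraMap_ne_zero {F E ι : Type*} [Field F] [Infinite F]
    [Field E] [Algebra F E] {p : MvPolynomial ι E} (hp : p ≠ 0) :
    ∃ a : ι → F, MvPolynomial.eval (fun i => algebraMap F E (a i)) p ≠ 0 := by
  by_contra! h
  refine hp (MvPolynomial.funext_set (fun _ => Set.range (algebraMap F E))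
    (fun i => Set.infinite_range_of_injective (algebraMap F E).injective) fun x hx => ?_)
  choose a ha using fun i => hx i (Set.mem_univ i)
  obtain rfl : (fun i => algebraMap F E (a i)) = x := funext ha
  rw [h, map_zero]

variable {F : Type u} {A : Type v} [Field F] [Ring A] [Algebra F A]

/-- The elements `b j * x ^ i` are linearly independent for `i < m`, and the pairs
`(b j * x ^ i, b j * (i * x ^ (i - 1)))`, consisting of the values of `b j * X ^ i` and its
derivative at `x`, are linearly independent for `i < 2 * m`. -/
def IsGeneric (F : Type u) {A : Type v} [Field F] [Ring A] [Algebra F A] {N : ℕ} (b : Fin N → A)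
    (m : ℕ) (x : A) : Prop :=
  (LinearIndependent F fun q : Fin m × Fin N => b q.2 * x ^ q.1.1) ∧
    LinearIndependent F fun q : Fin (2 * m) × Fin N =>
      (b q.2 * x ^ q.1.1, b q.2 * ((q.1.1 : A) * x ^ (q.1.1 - 1)))

/-- If a subspace of `A` contains a generic element after extension of scalars from an infinite
field, then it contains a generic element. -/
theorem exists_isGeneric [Infinite F] [FiniteDimensional F A] (E : Type w) [Field E] [Algebra F E]
    {N m : ℕ} (b : Fin N → A) (W : Submodule F A) {ι : Type*} (s : Finset ι) (β : ι → E)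
    (y : ι → A) (hy : ∀ i, y i ∈ W)
    (h : IsGeneric E (fun j => (1 : E) ⊗ₜ[F] b j) m (∑ i ∈ s, β i ⊗ₜ[F] y i)) :
    ∃ x ∈ W, IsGeneric F b m x := by
  let X : (ι → E) → E ⊗[F] A := fun c => ∑ i ∈ s, c i • (1 : E) ⊗ₜ[F] y i
  have hX : IsPolyMap X := IsPolyMap.sum s fun i => IsPolyMap.coord_smul i _
  have hXβ : X β = ∑ i ∈ s, β i ⊗ₜ[F] y i := by
    simp only [X, TensorProduct.smul_tmul', smul_eq_mul, mul_one]
  rw [← hXβ] at h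
  obtain ⟨p, hp, hp'⟩ := IsPolyMap.exists_eval_ne_zero (E := E) (β := β)
    (Φ := fun (q : Fin m × Fin N) c => (1 : E) ⊗ₜ[F] b q.2 * X c ^ q.1.1)
    (fun q => (IsPolyMap.const _).mul (hX.pow _)) h.1
  obtain ⟨r, hr, hr'⟩ := IsPolyMap.exists_eval_ne_zero (E := E) (β := β)
    (Φ := fun (q : Fin (2 * m) × Fin N) c => ((1 : E) ⊗ₜ[F] b q.2 * X c ^ q.1.1,
      (1 : E) ⊗ₜ[F] b q.2 * ((q.1.1 : E ⊗[F] A) * X c ^ (q.1.1 - 1))))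
    (fun q => ((IsPolyMap.const _).mul (hX.pow _)).prodMk
      ((IsPolyMap.const _).mul ((IsPolyMap.const _).mul (hX.pow _)))) h.2
  have hpr : p * r ≠ 0 := fun h => by
    have := congrArg (MvPolynomial.eval β) h
    rw [map_mul, map_zero, mul_eq_zero] at this
    exact this.elim hp hr
  obtain ⟨a, ha⟩ := MvPolynomial.exists_eval_algebraMap_ne_zero (F := F) hpr
  rw [map_mul, mul_ne_zero_iff] at ha
  have hXa : X (fun i => algebraMap F E (a i)) = 1 ⊗ₜ[F] ∑ i ∈ s, a i • y i := by
    simp only [X, TensorProduct.tmul_sum, TensorProduct.tmul_smul, algebraMap_smul]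
  have h1 := hp' _ ha.1
  have h2 := hr' _ ha.2
  refine ⟨∑ i ∈ s, a i • y i, W.sum_mem fun i _ => W.smul_mem _ (hy i), ?_, ?_⟩
  · refine LinearIndependent.of_comp (TensorProduct.mk F E A 1) ?_
    have h3 := h1.restrict_scalars' F
    simp only [hXa] at h3
    have h5 : (TensorProduct.mk F E A 1 ∘ fun q : Fin m × Fin N =>
        b q.2 * (∑ i ∈ s, a i • y i) ^ q.1.1) = fun q => (1 : E) ⊗ₜ[F] b q.2 *
        (1 ⊗ₜ[F] ∑ i ∈ s, a i • y i) ^ q.1.1 := by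
      funext q
      simp only [Function.comp_apply, TensorProduct.mk_apply, Algebra.TensorProduct.tmul_pow,
        one_pow, Algebra.TensorProduct.tmul_mul_tmul, mul_one]
    rw [h5]
    exact h3
  · refine LinearIndependent.of_comp
      ((TensorProduct.mk F E A 1).prodMap (TensorProduct.mk F E A 1)) ?_
    have h3 := h2.restrict_scalars' F
    simp only [hXa] at h3
    have h4 : ∀ n : ℕ, (n : E ⊗[F] A) = 1 ⊗ₜ[F] (n : A) := fun n =>
      (map_natCast (Algebra.TensorProduct.includeRight : A →ₐ[F] E ⊗[F] A) n).symm
    have h5 : ((TensorProduct.mk F E A 1).prodMap (TensorProduct.mk F E A 1) ∘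
        fun q : Fin (2 * m) × Fin N => (b q.2 * (∑ i ∈ s, a i • y i) ^ q.1.1,
          b q.2 * ((q.1.1 : A) * (∑ i ∈ s, a i • y i) ^ (q.1.1 - 1)))) =
        fun q => ((1 : E) ⊗ₜ[F] b q.2 * (1 ⊗ₜ[F] ∑ i ∈ s, a i • y i) ^ q.1.1,
          (1 : E) ⊗ₜ[F] b q.2 * ((q.1.1 : E ⊗[F] A) *
            (1 ⊗ₜ[F] ∑ i ∈ s, a i • y i) ^ (q.1.1 - 1))) := by
      funext q
      simp only [Function.comp_apply, LinearMap.prodMap_apply, TensorProduct.mk_apply, h4,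
        Algebra.TensorProduct.tmul_pow, one_pow, Algebra.TensorProduct.tmul_mul_tmul, mul_one]
    rw [h5]
    exact h3

end FInvolution

/-! ### Generic symmetric elements -/

namespace FInvolution

open TensorProduct Polynomial

variable {F : Type u} {A : Type v} [Field F] [Ring A] [Algebra F A]

theorem _root_.Polynomial.ofFn_eq_zero [DecidableEq F] {n : ℕ} {a : Fin n → F}
    (h : ofFn n a = 0) : a = 0 := by
  funext i
  rw [← ofFn_coeff_eq_val_of_lt a i.2, h, coeff_zero, Pi.zero_apply]

theorem _root_.Polynomial.eval_ofFn [DecidableEq F] {n : ℕ} (a : Fin n → F) (c : F) :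
    (ofFn n a).eval c = ∑ i, a i * c ^ i.1 := by
  rw [ofFn_eq_sum_monomial, eval_finsetSum]
  simp

theorem _root_.Polynomial.eval_derivative_ofFn [DecidableEq F] {n : ℕ} (a : Fin n → F) (c : F) :
    (derivative (ofFn n a)).eval c = ∑ i, a i * (i.1 * c ^ (i.1 - 1)) := by
  rw [ofFn_eq_sum_monomial, derivative_sum, eval_finsetSum]
  simp [derivative_monomial, mul_assoc]

/-- A polynomial with `m` double roots whose degree is less than `2 m` vanishes. -/
theorem _root_.Polynomial.eq_zero_of_double_roots {m : ℕ} {c : Fin m → F}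
    (hc : Function.Injective c) {p : F[X]} (hp : p.degree < (2 * m : ℕ))
    (h : ∀ t, p.eval (c t) = 0) (h' : ∀ t, (derivative p).eval (c t) = 0) : p = 0 := by
  by_contra h0
  have hdvd : ∏ t, (X - C (c t)) ^ 2 ∣ p := by
    refine Fintype.prod_dvd_of_coprime (fun s t hst => ?_) fun t => ?_
    · exact (pairwise_coprime_X_sub_C hc hst).pow
    · exact (le_rootMultiplicity_iff h0).1
        ((one_lt_rootMultiplicity_iff_isRoot h0).2 ⟨h t, h' t⟩)
  have h1 := degree_le_of_dvd hdvd h0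
  rw [degree_prod] at h1
  simp only [degree_pow, degree_X_sub_C, Finset.sum_const, Finset.card_univ, Fintype.card_fin] at h1
  refine absurd hp (not_lt.2 (le_trans (le_of_eq ?_) h1))
  simp [mul_comm]

/-- If `K` acts faithfully on each of the orthogonal idempotents `P t`, then a combination of the
`P t` with distinct coefficients is generic. -/
theorem isGeneric_sum {K : Subalgebra F A} {N m : ℕ} {b : Fin N → A} (hb : ∀ j, b j ∈ K)
    (hli : LinearIndependent F b) {P : Fin m → A}
    (hf : ∀ t, ∀ k ∈ K, k * P t = 0 → k = 0)
    (horth : ∀ s t, P s * P t = if s = t then P s else 0) {c : Fin m → F}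
    (hc : Function.Injective c) : IsGeneric F b m (∑ t, c t • P t) := by
  classical
  set x := ∑ t, c t • P t with hx
  have hpow : ∀ t (n : ℕ), x ^ n * P t = c t ^ n • P t := by
    intro t n
    induction n with
    | zero => simp
    | succ n ih =>
      have h1 : x * P t = c t • P t := by
        rw [hx, Finset.sum_mul, Finset.sum_eq_single t]
        · rw [smul_mul_assoc, horth, if_pos rfl]
        · intro s _ hst
          rw [smul_mul_assoc, horth, if_neg hst, smul_zero]
        · simp
      rw [pow_succ, mul_assoc, h1, mul_smul_comm, ih, smul_smul, pow_succ, mul_comm]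
  -- multiplying a relation by `P t` turns `x` into the scalar `c t`; as `K` acts faithfully on
  -- `P t`, the coefficients of each `b j` satisfy the resulting relation
  have key : ∀ {n : ℕ} (l : Fin n × Fin N → F) (Z : Fin n → A) (t : Fin m) (u : Fin n → F),
      (∀ i, Z i * P t = u i • P t) → ∑ q, l q • (b q.2 * Z q.1) = 0 →
      ∀ j, ∑ i, l (i, j) * u i = 0 := by
    intro n l Z t u hZ h
    refine Fintype.linearIndependent_iff.1 hli _ (hf t _
      (K.sum_mem fun j _ => K.smul_mem (hb j) _) ?_)
    have h1 := congrArg (· * P t) h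
    simp only [zero_mul, Finset.sum_mul, smul_mul_assoc, mul_assoc, hZ, mul_smul_comm,
      smul_smul] at h1
    rw [Fintype.sum_prod_type, Finset.sum_comm] at h1
    rw [Finset.sum_mul, ← h1]
    refine Finset.sum_congr rfl fun j _ => ?_
    rw [smul_mul_assoc, Finset.sum_smul]
  constructor
  · rw [Fintype.linearIndependent_iff]
    intro l hl
    have h1 : ∀ j, (fun i => l (i, j)) = 0 := by
      intro j
      refine ofFn_eq_zero (eq_zero_of_degree_lt_of_eval_finset_eq_zero
        (Finset.univ.image c) ?_ ?_)
      · rw [Finset.card_image_of_injective _ hc, Finset.card_univ, Fintype.card_fin]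
        exact ofFn_degree_lt _
      · intro y hy
        obtain ⟨t, -, rfl⟩ := Finset.mem_image.1 hy
        rw [eval_ofFn]
        exact key l (fun i => x ^ i.1) t _ (fun i => hpow t i) hl j
    exact fun q => congrFun (h1 q.2) q.1
  · rw [Fintype.linearIndependent_iff]
    intro l hl
    have hl1 : ∑ q, l q • (b q.2 * x ^ q.1.1) = 0 := by
      simpa [Prod.fst_sum] using congrArg Prod.fst hl
    have hl2 : ∑ q, l q • (b q.2 * ((q.1.1 : A) * x ^ (q.1.1 - 1))) = 0 := by
      simpa [Prod.snd_sum] using congrArg Prod.snd hl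
    have h1 : ∀ j, (fun i => l (i, j)) = 0 := by
      intro j
      refine ofFn_eq_zero (eq_zero_of_double_roots hc (ofFn_degree_lt _) (fun t => ?_)
        fun t => ?_)
      · rw [eval_ofFn]
        exact key l (fun i => x ^ i.1) t _ (fun i => hpow t i) hl1 j
      · rw [eval_derivative_ofFn]
        refine key l (fun i => (i.1 : A) * x ^ (i.1 - 1)) t _ (fun i => ?_) hl2 j
        rw [mul_assoc, hpow, mul_smul_comm, ← nsmul_eq_mul, ← Nat.cast_smul_eq_nsmul F, smul_smul,
          mul_comm]
    exact fun q => congrFun (h1 q.2) q.1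

/-- The symmetric elements commuting with `K`; they are required to be symmetrized elements if the
involution is symplectic. -/
def commutingSymm (σ : FInvolution F A) (K : Subalgebra F A) : Submodule F A where
  carrier := {x | (∀ k ∈ K, k * x = x * k) ∧ σ x = x ∧ (σ.type = .symplectic → x ∈ σ.symd)}
  add_mem' hx hy := ⟨fun k hk => by rw [mul_add, add_mul, hx.1 k hk, hy.1 k hk],
    by rw [map_add, hx.2.1, hy.2.1], fun h => add_mem (hx.2.2 h) (hy.2.2 h)⟩
  zero_mem' := ⟨fun k _ => by simp, map_zero _, fun _ => zero_mem _⟩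
  smul_mem' c x hx := ⟨fun k hk => by rw [mul_smul_comm, smul_mul_assoc, hx.1 k hk],
    by rw [map_smul, hx.2.1], fun h => Submodule.smul_mem _ c (hx.2.2 h)⟩

/-- A neat subalgebra over an algebraic closure provides the idempotents; the generic element
obtained from them descends to an infinite base field. -/
theorem IsAlgebraWithInvolution.exists_isGeneric [Infinite F] {σ : FInvolution F A}
    (hσ : σ.IsAlgebraWithInvolution) {K : Subalgebra F A}
    (hc : ∀ x ∈ K, ∀ y ∈ K, x * y = y * x) (hK : σ.IsNeat K) {N : ℕ} {b : Fin N → A}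
    (hb : ∀ j, b j ∈ K) (hli : LinearIndependent F b) :
    ∃ (m : ℕ) (x : A), m * Module.finrank F K = σ.capacity ∧ x ∈ commutingSymm σ K ∧
      IsGeneric F b m x := by
  have := hσ.finiteDimensional
  let E := AlgebraicClosure F
  have : Infinite E := Infinite.of_injective _ (algebraMap F E).injective
  have hσ' := hσ.baseChange E
  obtain ⟨B⟩ := hσ'.exists_frame_of_isAlgClosed
  obtain ⟨m, P, hP, horth, -, hm⟩ := B.exists_idempotents hσ' (baseChange_comm E hc)
    (hK.baseChange E hσ hc)
  rw [finrank_subalgebra_baseChange, hσ.capacity_baseChange E] at hm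
  let c : Fin m → E := fun t => Infinite.natEmbedding E t
  have hcinj : Function.Injective c :=
    (Infinite.natEmbedding E).injective.comp Fin.val_injective
  obtain ⟨ι, β, r, hr, hsum⟩ := exists_tmul_coordinates (F := F) E A
  have hgen := isGeneric_sum (K := K.baseChange E) (b := fun j => (1 : E) ⊗ₜ[F] b j)
    (fun j => Subalgebra.tmul_mem_baseChange (hb j) 1) (Module.Flat.linearIndependent_one_tmul hli)
    (fun t => (hP t).2.2) horth hcinj
  have hx : ∑ t, c t • P t ∈ commutingSymm (σ.baseChange E) (K.baseChange E) :=
    Submodule.sum_mem _ fun t _ => Submodule.smul_mem _ _ ⟨(hP t).1.comm, (hP t).1.symm, (hP t).2.1⟩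
  generalize ∑ t, c t • P t = x at hgen hx
  obtain ⟨hxK, hxs, hxd⟩ := hx
  rw [hσ.type_baseChange E] at hxd
  have hleft : ∀ (k : A) z i, r ((1 ⊗ₜ k) * z) i = k * r z i := by
    intro k z i
    induction z using TensorProduct.induction_on with
    | zero => simp
    | add y z hy hz => rw [mul_add, map_add, map_add, Finsupp.add_apply, hy, hz, ← mul_add]; rfl
    | tmul d a => rw [Algebra.TensorProduct.tmul_mul_tmul, hr, hr, one_mul, mul_smul_comm]
  have hright : ∀ (k : A) z i, r (z * (1 ⊗ₜ k)) i = r z i * k := by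
    intro k z i
    induction z using TensorProduct.induction_on with
    | zero => simp
    | add y z hy hz => rw [add_mul, map_add, map_add, Finsupp.add_apply, hy, hz, ← add_mul]; rfl
    | tmul d a => rw [Algebra.TensorProduct.tmul_mul_tmul, hr, hr, mul_one, smul_mul_assoc]
  -- the coordinates of the generic element over `E` span a space of admissible elements of `A`
  rw [hsum x] at hgen
  obtain ⟨y, hy, hy'⟩ := FInvolution.exists_isGeneric E b (commutingSymm σ K) (r x).support β (r x)
    (fun i => ⟨fun k hk => by
        rw [← hleft, ← hright, hxK _ (Subalgebra.tmul_mem_baseChange hk 1)],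
      by rw [← coord_apply hr, hxs], fun h => coord_symd hr (hxd h) i⟩) hgen
  exact ⟨m, y, hm, hy, hy'⟩

end FInvolution

/-! ### The algebra generated by a generic element -/

namespace FInvolution

open TensorProduct Polynomial

/-- An algebra generated by a simple zero of a polynomial is unramified. -/
theorem _root_.Algebra.FormallyUnramified.of_aeval_derivative_eq_one {R S : Type*} [CommRing R]
    [CommRing S] [Algebra R S] {x : S} (hx : ∀ y : S, ∃ p : R[X], aeval x p = y) {g : R[X]}
    (h : aeval x g = 0) (h' : aeval x (derivative g) = 1) : Algebra.FormallyUnramified R S := by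
  have hDx : KaehlerDifferential.D R S x = 0 := by
    have h1 := (KaehlerDifferential.D R S).map_aeval g x
    rw [h, h', map_zero, one_smul] at h1
    exact h1.symm
  have hD : ∀ y, KaehlerDifferential.D R S y = 0 := fun y => by
    obtain ⟨p, rfl⟩ := hx y
    rw [Derivation.map_aeval, hDx, smul_zero]
  have h2 := KaehlerDifferential.span_range_derivation R S
  have h3 : Set.range (KaehlerDifferential.D R S) ⊆ {0} := by
    rintro _ ⟨y, rfl⟩
    exact hD y
  have h4 : (⊤ : Submodule S (Ω[S⁄R])) ≤ ⊥ := by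
    rw [← h2]
    exact (Submodule.span_mono h3).trans (by simp)
  exact ⟨⟨fun a b => by
    rw [(Submodule.mem_bot S).1 (h4 (Submodule.mem_top (x := a))),
      (Submodule.mem_bot S).1 (h4 (Submodule.mem_top (x := b)))]⟩⟩

variable {F : Type u} {A : Type v} [Field F] [Ring A] [Algebra F A]

/-- The subalgebra generated by a subalgebra `K` and an element `x` commuting with `K`. -/
noncomputable def extend (K : Subalgebra F A) {x : A} (hx : ∀ k ∈ K, k * x = x * k) :
    Subalgebra F A :=
  (Submodule.span F {y | ∃ k ∈ K, ∃ i : ℕ, k * x ^ i = y}).toSubalgebra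
    (Submodule.subset_span ⟨1, K.one_mem, 0, by simp⟩) fun y z hy hz => by
      induction hy, hz using Submodule.span_induction₂ with
      | mem_mem y z hy hz =>
        obtain ⟨k, hk, i, rfl⟩ := hy
        obtain ⟨l, hl, j, rfl⟩ := hz
        have hc : Commute l (x ^ i) := (show Commute l x from hx l hl).pow_right i
        refine Submodule.subset_span ⟨k * l, K.mul_mem hk hl, i + j, ?_⟩
        rw [pow_add, mul_assoc, ← mul_assoc l, hc.eq]
        simp only [mul_assoc]
      | zero_left => simp
      | zero_right => simp
      | add_left y y' z _ _ _ h h' => rw [add_mul]; exact add_mem h h'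
      | add_right y z z' _ _ _ h h' => rw [mul_add]; exact add_mem h h'
      | smul_left c y z _ _ h => rw [smul_mul_assoc]; exact Submodule.smul_mem _ c h
      | smul_right c y z _ _ h => rw [mul_smul_comm]; exact Submodule.smul_mem _ c h

section Extend

variable {K : Subalgebra F A} {x : A} (hx : ∀ k ∈ K, k * x = x * k)

theorem mem_extend {y : A} : y ∈ extend K hx ↔
    y ∈ Submodule.span F {y | ∃ k ∈ K, ∃ i : ℕ, k * x ^ i = y} := Iff.rfl

theorem mul_pow_mem_extend {k : A} (hk : k ∈ K) (i : ℕ) : k * x ^ i ∈ extend K hx :=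
  Submodule.subset_span ⟨k, hk, i, rfl⟩

theorem le_extend : K ≤ extend K hx := fun k hk => by
  have := mul_pow_mem_extend hx hk 0
  rwa [pow_zero, mul_one] at this

theorem apply_of_mem_extend {σ : FInvolution F A} (hs : ∀ k ∈ K, σ k = k) (hxs : σ x = x) {y : A}
    (hy : y ∈ extend K hx) : σ y = y := by
  rw [mem_extend] at hy
  induction hy using Submodule.span_induction with
  | mem y hy =>
    obtain ⟨k, hk, i, rfl⟩ := hy
    have hc : Commute k (x ^ i) := (show Commute k x from hx k hk).pow_right i
    have h1 : σ (x ^ i) = x ^ i := by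
      have := Frame.apply_aeval hxs (X ^ i : F[X])
      rwa [map_pow, aeval_X] at this
    rw [apply_mul, hs k hk, h1, hc.eq]
  | zero => simp
  | add y z _ _ hy hz => rw [map_add, hy, hz]
  | smul c y _ hy => rw [map_smul, hy]

end Extend

/-- The bound on the dimension over an algebraically closed field descends to any base field. -/
theorem IsAlgebraWithInvolution.finrank_extend_le {σ : FInvolution F A}
    (hσ : σ.IsAlgebraWithInvolution) {K : Subalgebra F A} (he : IsEtaleAlgebra F K)
    (hs : ∀ k ∈ K, σ k = k) {x : A} (hx : x ∈ commutingSymm σ K) :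
    Module.finrank F (extend K hx.1) ≤ σ.capacity := by
  let E := AlgebraicClosure F
  rw [← finrank_subalgebra_baseChange E, ← hσ.capacity_baseChange E]
  have hmem : ∀ {k : A} (_ : k ∈ K) (c : E), c ⊗ₜ[F] k ∈ K.baseChange E := fun hk c =>
    Subalgebra.tmul_mem_baseChange hk c
  refine (hσ.baseChange E).finrank_le_capacity (K := K.baseChange E) (x := 1 ⊗ₜ[F] x)
    (he.baseChange E (comm_of_le_symm hs)) (baseChange_symm E hs) ?_ ?_ ?_ ?_ ?_
  · rintro _ ⟨k, rfl⟩
    induction k using TensorProduct.induction_on with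
    | zero => simp
    | add y z hy hz => rw [map_add, add_mul, mul_add, hy, hz]
    | tmul c k =>
      change (c ⊗ₜ[F] k.1) * (1 ⊗ₜ[F] x) = (1 ⊗ₜ[F] x) * (c ⊗ₜ[F] k.1)
      rw [Algebra.TensorProduct.tmul_mul_tmul, Algebra.TensorProduct.tmul_mul_tmul, hx.1 _ k.2,
        mul_comm]
  · rw [baseChange_tmul, hx.2.1]
  · intro h
    rw [hσ.type_baseChange E] at h
    exact tmul_mem_symd E (hx.2.2 h) 1
  · rintro _ ⟨k, rfl⟩
    induction k using TensorProduct.induction_on with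
    | zero => simp
    | add y z hy hz =>
      rw [map_add]
      exact add_mem hy hz
    | tmul c k => exact Subalgebra.tmul_mem_baseChange (le_extend hx.1 k.2) c
  · rintro _ ⟨y, rfl⟩
    induction y using TensorProduct.induction_on with
    | zero => simp
    | add y z hy hz =>
      rw [map_add]
      exact add_mem hy hz
    | tmul c y =>
      obtain ⟨y, hy⟩ := y
      change c ⊗ₜ[F] y ∈ _
      rw [mem_extend] at hy
      induction hy using Submodule.span_induction with
      | mem y hy =>
        obtain ⟨k, hk, i, rfl⟩ := hy
        refine Submodule.subset_span ⟨c ⊗ₜ[F] k, hmem hk c, i, ?_⟩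
        rw [Algebra.TensorProduct.tmul_pow, Algebra.TensorProduct.tmul_mul_tmul, one_pow, mul_one]
      | zero => simp
      | add y z _ _ hy hz =>
        rw [TensorProduct.tmul_add]
        exact add_mem hy hz
      | smul d y _ hy =>
        rw [TensorProduct.tmul_smul]
        exact Submodule.smul_of_tower_mem _ d hy

/-- If `K` and a generic element `x` generate an algebra of the smallest possible dimension, then
this algebra is étale and free over `K`. -/
theorem IsGeneric.etale_extend [FiniteDimensional F A] {σ : FInvolution F A} {K : Subalgebra F A}
    (he : IsEtaleAlgebra F K)
    (hs : ∀ k ∈ K, σ k = k) {x : A} (hx : ∀ k ∈ K, k * x = x * k) (hxs : σ x = x) {m N : ℕ}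
    {b : Fin N → K} (hb : Submodule.span F (Set.range b) = ⊤)
    (hgen : IsGeneric F (fun j => (b j).1) m x)
    (hle : Module.finrank F (extend K hx) ≤ m * N) (hN : Module.finrank F K = N) :
    IsEtaleAlgebra F (extend K hx) ∧ Module.finrank F (extend K hx) = m * N ∧
      K.IsFreeOver (extend K hx) (le_extend hx) := by
  let L := extend K hx
  have hKL : K ≤ L := le_extend hx
  have hsL : ∀ y ∈ L, σ y = y := fun y => apply_of_mem_extend hx hs hxs
  have hmem : ∀ j i, (b j).1 * x ^ i ∈ L := fun j i => mul_pow_mem_extend hx (b j).2 i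
  have hxL : x ∈ L := by simpa using mul_pow_mem_extend hx K.one_mem 1
  let xL : L := ⟨x, hxL⟩
  have hdim : Module.finrank F L = m * N := by
    refine le_antisymm hle ?_
    have h1 : LinearIndependent F fun q : Fin m × Fin N => (⟨_, hmem q.2 q.1⟩ : L) :=
      LinearIndependent.of_comp L.val.toLinearMap hgen.1
    simpa using h1.fintype_card_le_finrank
  refine ⟨?_, hdim, ?_⟩
  · have h1 : LinearIndependent F fun q : Fin (2 * m) × Fin N =>
        ((⟨_, hmem q.2 q.1⟩, ⟨(b q.2).1 * ((q.1.1 : A) * x ^ (q.1.1 - 1)),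
          L.mul_mem (hKL (b q.2).2) (L.mul_mem (natCast_mem L _) (L.pow_mem hxL _))⟩) : L × L) :=
      LinearIndependent.of_comp (L.val.toLinearMap.prodMap L.val.toLinearMap) hgen.2
    -- the pairs are as many as the dimension of `L × L`
    have h2 := h1.span_eq_top_of_card_eq_finrank' (by
      rw [Module.finrank_prod, hdim]
      simp
      ring)
    -- expressing `(0, 1)` by the pairs gives a polynomial `g` over `K` that vanishes at `x` and has
    -- derivative `1` there
    obtain ⟨l, hl⟩ := (Submodule.mem_span_range_iff_exists_fun F).1
      (h2.symm ▸ Submodule.mem_top : ((0, 1) : L × L) ∈ _)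
    let iK : CommRing K := commRingOf K (comm_of_le_symm hs)
    let iL : CommRing L := commRingOf L (comm_of_le_symm hsL)
    let iKL : Algebra K L := (Subalgebra.inclusion hKL).toRingHom.toAlgebra
    have : IsScalarTower F K L := IsScalarTower.of_algebraMap_eq fun c => rfl
    let g : K[X] := ∑ q : Fin (2 * m) × Fin N, monomial q.1.1 (l q • b q.2)
    have hunr : Algebra.FormallyUnramified K L := by
      refine Algebra.FormallyUnramified.of_aeval_derivative_eq_one (x := xL) (g := g) ?_ ?_ ?_
      · suffices h : ∀ y ∈ L, ∃ p : K[X], (aeval xL p).1 = y from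
          fun y => (h y.1 y.2).imp fun p hp => Subtype.ext hp
        intro y hy
        rw [mem_extend] at hy
        induction hy using Submodule.span_induction with
        | mem y hy =>
          obtain ⟨k, hk, i, rfl⟩ := hy
          exact ⟨monomial i ⟨k, hk⟩, by rw [aeval_monomial]; rfl⟩
        | zero => exact ⟨0, by rw [map_zero]; rfl⟩
        | add y z _ _ hy hz =>
          obtain ⟨p, rfl⟩ := hy
          obtain ⟨q, rfl⟩ := hz
          exact ⟨p + q, by rw [map_add]; rfl⟩
        | smul c y _ hy =>
          obtain ⟨p, rfl⟩ := hy
          exact ⟨C (algebraMap F K c) * p, by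
            rw [map_mul, aeval_C]
            exact (Algebra.smul_def c (aeval xL p).1).symm⟩
      · refine Eq.trans ?_ (congrArg Prod.fst hl)
        rw [map_sum, Prod.fst_sum]
        refine Finset.sum_congr rfl fun q _ => ?_
        rw [aeval_monomial, Prod.smul_fst]
        exact Subtype.ext (smul_mul_assoc (l q) (b q.2).1 (x ^ q.1.1))
      · refine Eq.trans ?_ (congrArg Prod.snd hl)
        rw [derivative_sum, map_sum, Prod.snd_sum]
        refine Finset.sum_congr rfl fun q _ => ?_
        rw [derivative_monomial, aeval_monomial, Prod.smul_snd]
        apply Subtype.ext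
        change (l q • (b q.2).1 * ((q.1.1 : K) : A)) * x ^ (q.1.1 - 1) = l q • _
        rw [mul_assoc, smul_mul_assoc]
        rfl
    have het : Algebra.Etale F K := (isEtaleAlgebra_iff_etale F K).1 he
    have : Algebra.FormallyUnramified F L := Algebra.FormallyUnramified.comp F K L
    have : Module.Finite F L := FiniteDimensional.finiteDimensional_subalgebra L
    have : Algebra.FormallyEtale F L := Algebra.FormallyEtale.of_formallyUnramified_of_field F L
    have : Algebra.Etale F L :=
      ⟨inferInstance, Algebra.FinitePresentation.of_finiteType.1 inferInstance⟩
    exact (isEtaleAlgebra_iff_etale F L).2 this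
  · let inst : Module K L := Module.compHom L (Subalgebra.inclusion hKL).toRingHom
    change Module.Free K L
    let φ : (Fin m → K) →ₗ[K] L :=
      { toFun := fun k => ∑ i, k i • xL ^ i.1
        map_add' := fun k l => by simp only [Pi.add_apply, add_smul, Finset.sum_add_distrib]
        map_smul' := fun c k => by
          simp only [Pi.smul_apply, smul_eq_mul, mul_smul, Finset.smul_sum, RingHom.id_apply] }
    have hφ : ∀ k, (φ k).1 = ∑ i, (k i).1 * x ^ i.1 := fun k =>
      AddSubmonoidClass.coe_finsetSum _ _
    let ψ : (Fin m → K) →ₗ[F] L :=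
      { toFun := φ
        map_add' := map_add φ
        map_smul' := fun c k => by
          apply Subtype.ext
          change (φ _).1 = c • (φ k).1
          rw [hφ, hφ, Finset.smul_sum]
          exact Finset.sum_congr rfl fun i _ => smul_mul_assoc c (k i).1 _ }
    have hinj : Function.Injective ψ := by
      rw [injective_iff_map_eq_zero]
      intro k hk
      have h1 : ∑ i, (k i).1 * x ^ i.1 = 0 := (hφ k).symm.trans (congrArg Subtype.val hk)
      choose l hl using fun i => (Submodule.mem_span_range_iff_exists_fun F).1
        (hb.symm ▸ Submodule.mem_top : k i ∈ _)
      have hl' : ∀ i, (k i).1 = ∑ j, l i j • (b j).1 := fun i => by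
        rw [← hl i]
        exact AddSubmonoidClass.coe_finsetSum _ _
      have h2 := Fintype.linearIndependent_iff.1 hgen.1 (fun q => l q.1 q.2) (by
        rw [Fintype.sum_prod_type, ← h1]
        refine Finset.sum_congr rfl fun i _ => ?_
        rw [hl', Finset.sum_mul]
        simp only [smul_mul_assoc])
      funext i
      rw [← hl i]
      exact Finset.sum_eq_zero fun j _ => by rw [h2 (i, j), zero_smul]
    have hsurj : Function.Surjective ψ := by
      refine (LinearMap.injective_iff_surjective_of_finrank_eq_finrank ?_).1 hinj
      rw [hdim, Module.finrank_pi_fintype, hN]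
      simp
    exact Module.Free.of_equiv (LinearEquiv.ofBijective φ ⟨hinj, hsurj⟩)

end FInvolution

/-! ### Existence of the overalgebra and divisibility -/

namespace FInvolution

variable {F : Type u} {A : Type v} [Field F] [Ring A] [Algebra F A]

/-- If the algebra is a matrix algebra, then the idempotents on which `K` acts faithfully exist over
the base field, and they generate the overalgebra `K^m`. -/
theorem Frame.exists_subalgebra {σ : FInvolution F A} (B : Frame σ)
    (hσ : σ.IsAlgebraWithInvolution) {K : Subalgebra F A}
    (hc : ∀ x ∈ K, ∀ y ∈ K, x * y = y * x) (hK : σ.IsNeat K) :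
    ∃ (m : ℕ) (L : Subalgebra F A) (hKL : K ≤ L), Nonempty ((Fin m → K) ≃ₐ[F] L) ∧
      Subalgebra.toSubmodule L ≤ σ.symm ∧ Module.finrank F L = σ.capacity ∧
      K.IsFreeOver L hKL := by
  have := hσ.finiteDimensional
  obtain ⟨m, P, hP, horth, hsum, hm⟩ := B.exists_idempotents hσ hc hK
  obtain ⟨L, hKL, ⟨e⟩, hs, hfree⟩ := exists_subalgebra_of_idempotents (σ := σ)
    (fun x hx => hK.le_symm hx) (fun t => (hP t).1) (fun t => (hP t).2.2) horth hsum
  exact ⟨m, L, hKL, ⟨e⟩, hs, (finrank_eq_of_algEquiv_pi e).trans hm, hfree⟩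

/-- The quotient is the number of idempotents found over an algebraic closure. -/
theorem IsAlgebraWithInvolution.finrank_dvd_capacity {σ : FInvolution F A}
    (hσ : σ.IsAlgebraWithInvolution) {K : Subalgebra F A}
    (hc : ∀ x ∈ K, ∀ y ∈ K, x * y = y * x) (hK : σ.IsNeat K) :
    Module.finrank F K ∣ σ.capacity := by
  let E := AlgebraicClosure F
  have hσ' := hσ.baseChange E
  obtain ⟨B⟩ := hσ'.exists_frame_of_isAlgClosed
  obtain ⟨m, -, -, -, -, hm⟩ := B.exists_idempotents hσ' (baseChange_comm E hc)
    (hK.baseChange E hσ hc)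
  rw [finrank_subalgebra_baseChange, hσ.capacity_baseChange E] at hm
  exact ⟨m, by rw [← hm, mul_comm]⟩

/-- Over a finite field every algebra with involution is split; over an infinite field there is
a generic symmetric element. -/
theorem IsAlgebraWithInvolution.exists_subalgebra {σ : FInvolution F A}
    (hσ : σ.IsAlgebraWithInvolution) {K : Subalgebra F A}
    (hc : ∀ x ∈ K, ∀ y ∈ K, x * y = y * x) (hK : σ.IsNeat K) :
    ∃ (L : Subalgebra F A) (hKL : K ≤ L), IsEtaleAlgebra F L ∧
      Subalgebra.toSubmodule L ≤ σ.symm ∧ Module.finrank F L = σ.capacity ∧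
      K.IsFreeOver L hKL := by
  have := hσ.finiteDimensional
  have hs : ∀ k ∈ K, σ k = k := fun k hk => hK.le_symm hk
  cases finite_or_infinite F
  · obtain ⟨B⟩ := (hσ.isUnitSplit fun D _ _ _ x y => by
      have : Finite D := Module.finite_of_finite F
      exact (littleWedderburn D).mul_comm x y).exists_frame hσ
    obtain ⟨m, L, hKL, ⟨e⟩, h⟩ := B.exists_subalgebra hσ hc hK
    exact ⟨L, hKL, (hK.etale.pi hc m).of_algEquiv e, h⟩
  · let b := Module.finBasis F K
    obtain ⟨m, x, hm, hx, hgen⟩ := hσ.exists_isGeneric hc hK (b := fun j => (b j).1)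
      (fun j => (b j).2) (LinearIndependent.map' b.linearIndependent K.val.toLinearMap
        (LinearMap.ker_eq_bot.2 Subtype.val_injective))
    have hle := hσ.finrank_extend_le hK.etale hs hx
    obtain ⟨h1, h2, h3⟩ := hgen.etale_extend hK.etale hs hx.1 hx.2.1 b.span_eq
      (hle.trans hm.ge) rfl
    exact ⟨extend K hx.1, le_extend hx.1, h1,
      fun y hy => apply_of_mem_extend hx.1 hs hx.2.1 hy, h2.trans hm, h3⟩

end FInvolution

theorem mainTheorem7 {F : Type u} {A : Type v} [Field F] [Ring A] [Algebra F A]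
    (σ : FInvolution F A) (hσ : σ.IsAlgebraWithInvolution)
    (K : Subalgebra F A) (hK : ∀ x ∈ K, ∀ y ∈ K, x * y = y * x) :
    (σ.IsNeat K ↔
      ∃ (L : Subalgebra F A) (hKL : K ≤ L),
        IsEtaleAlgebra F L ∧ Subalgebra.toSubmodule L ≤ σ.symm ∧
        Module.finrank F L = σ.capacity ∧ K.IsFreeOver L hKL) ∧
    (σ.IsNeat K → IsSplitEtaleAlgebra F K → σ.IsSplit →
      ∃ (L : Subalgebra F A) (hKL : K ≤ L),
        IsSplitEtaleAlgebra F L ∧ Subalgebra.toSubmodule L ≤ σ.symm ∧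
        Module.finrank F L = σ.capacity ∧ K.IsFreeOver L hKL) ∧
    (σ.IsNeat K → Module.finrank F K ∣ σ.capacity) := by
  refine ⟨⟨hσ.exists_subalgebra hK, ?_⟩, ?_, hσ.finrank_dvd_capacity hK⟩
  · rintro ⟨L, hKL, he, hs, hdim, hfree⟩
    exact hσ.isNeat_of_le hKL he (fun x hx => hs hx) hdim hfree
  · intro hneat hsplit hA
    obtain ⟨B⟩ := (hσ.isUnitSplit_of_isSplit hA).exists_frame hσ
    obtain ⟨m, L, hKL, ⟨e⟩, h⟩ := B.exists_subalgebra hσ hK hneat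
    obtain ⟨n, ⟨φ⟩⟩ := hsplit.pi m
    exact ⟨L, hKL, ⟨n, ⟨e.symm.trans φ⟩⟩, h⟩
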